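/- **Setting.** A stochastic game $G=\langle Q,q_0,\delta\rangle$ over finite nonempty action sets $A_1,A_2$ has a finite set $Q$ of states, an initial state $q_0$, and a transition function $\delta:Q\times A_1\times A_2\to\mathcal D(Q)$; in every round the two players choose actions $a\in A_1$, $b\in A_2$ simultaneously and independently, and the next state is drawn from $\delta(q,a,b)$. The game is *one-sided (player 1 partial, player 2 perfect)* if player 1 sees no actions and sees states only up to an equivalence relation on $Q$, whose set of classes (observations) is $\mathcal O_1$, while player 2 sees all states and actions. Strategies map finite prefixes of plays to actions (pure) or to distributions on actions (randomized), and must be observation-based, i.e. take the same value on prefixes that the player cannot distinguish. Let $\mathcal T\subseteq Q$ and let $\mathsf{Reach}(\mathcal T)$ be the set of plays that visit $\mathcal T$. A strategy of player 1 is almost-sure (resp. positive) winning if against every observation-based randomized strategy of player 2 the play from $q_0$ satisfies the objective with probability $1$ (resp. with probability $>0$); it is sure winning if all plays compatible with it satisfy the objective. For $s\subseteq Q$ let $\mathsf{Post}_{a,-}(s)=\bigcup_{q\in s,\,b\in A_2}\mathsf{Supp}(\delta(q,a,b))$. **The game $H$.** The states of $H$ are the pairs $(s,o)$ with $o\subseteq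 s\subseteq Q$ (belief, obligation set) and two absorbing states $\bot_1$, $\bot_2$ (losing for player 1, resp. for player 2). Player 1's actions are the pairs $(a,u)\in A_1\times 2^Q$, player 2's actions are the observations $\gamma\in\mathcal O_1$. Both players have perfect observation. The initial state is $(\emptyset,\emptyset)$ if $q_0\in\mathcal T$, and $(\{q_0\},\{q_0\})$ otherwise. The state $(\emptyset,\emptyset)$ is absorbing. In a state $(s,o)$ with $s\neq\emptyset$, under $(a,u)$ and $\gamma$: if $\mathsf{Supp}(\delta(q,a,b))\cap u=\emptyset$ for some $q\in o$, $b\in A_2$, the next state is $\bot_1$; otherwise, if $\mathsf{Post}_{a,-}(s)\cap\gamma=\emptyset$, the next state is $\bot_2$; otherwise it is $(s',o')$ with $s'=(\mathsf{Post}_{a,-}(s)\cap\gamma)\setminus\mathcal T$, and $o'=s'$ if $o=\emptyset$, $o'=(\mathsf{Post}_{a,-}(o)\cap\gamma\cap u)\setminus\mathcal T$ if $o\neq\emptyset$. The set of accepting states is $\alpha=\{(s,\emptyset)\mid s\subseteq Q\}\cup\{\bot_2\}$. The Büchi objective for $\alpha$ requires infinitely many visits to $\alpha$, the reachability objective at least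 one. **Lemma.** Let $G$ be a one-sided stochastic game with player 1 partial and player 2 perfect, and let $\mathcal T\subseteq Q$. 1. $H$ is a deterministic game of perfect observation. Player 1 has a pure observation-based almost-sure winning strategy for $\mathsf{Reach}(\mathcal T)$ in $G$ if and only if player 1 has a (pure) sure winning strategy in $H$ for the Büchi objective for $\alpha$. Player 1 has a pure observation-based positive winning strategy for $\mathsf{Reach}(\mathcal T)$ in $G$ if and only if player 1 has a (pure) sure winning strategy in $H$ for the reachability objective for $\alpha$. 2. $H$ can be constructed in time exponential in the size of $G$ and polynomial in the sizes of the action sets: there are one program for a random access machine (unit cost; tests, indirect addressing, addition and truncated subtraction of natural numbers) and one constant $c$ such that, for all $G$ with rational transition probabilities and all $\mathcal T$, given an explicit description of $(G,\mathcal T)$ (with one machine word for each number), the program outputs an explicit description of $(H,\alpha)$ (initial state, accepting states and full successor table, for some numbering of the states and actions) within $2^{c|Q|}\cdot(|A_1|\,|A_2|)^c$ steps. -/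

import Mathlib

/-! ### Stochastic games with partial observation -/

/-- What a player can distinguish: an equivalence relation on the states, on the actions of
player 1 and on the actions of player 2. -/
structure View (Q A₁ A₂ : Type*) where
  st : Setoid Q
  act₁ : Setoid A₁
  act₂ : Setoid A₂

/-- Perfect observation: all three equivalences are equality. -/
def View.perfect (Q A₁ A₂ : Type*) : View Q A₁ A₂ := ⟨⊥, ⊥, ⊥⟩

/-- The actions (of both players) are invisible: all actions are equivalent. -/
def View.ActionsInvisible {Q A₁ A₂ : Type*} (v : View Q A₁ A₂) : Prop :=
  v.act₁ = ⊤ ∧ v.act₂ = ⊤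

/-- The observations: the equivalence classes of states. -/
abbrev View.Obs {Q A₁ A₂ : Type*} (v : View Q A₁ A₂) : Type _ := Quotient v.st

/-- The observation of a state. -/
def View.obs {Q A₁ A₂ : Type*} (v : View Q A₁ A₂) (q : Q) : v.Obs := Quotient.mk v.st q

/-- A (concurrent, two-player) stochastic game with partial observation. -/
structure StochGame (Q A₁ A₂ : Type*) where
  init : Q
  δ : Q → A₁ → A₂ → PMF Q
  view₁ : View Q A₁ A₂
  view₂ : View Q A₁ A₂

/-- One round of a play: the current state and the two actions that are chosen there. -/
@[ext] structure Round (Q A₁ A₂ : Type*) where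
  state : Q
  act₁ : A₁
  act₂ : A₂

instance Round.instMeasurableSpace (Q A₁ A₂ : Type*) : MeasurableSpace (Round Q A₁ A₂) := ⊤

instance Round.instDiscreteMeasurableSpace (Q A₁ A₂ : Type*) :
    DiscreteMeasurableSpace (Round Q A₁ A₂) := ⟨fun _ => trivial⟩

instance Round.instFinite (Q A₁ A₂ : Type*) [Finite Q] [Finite A₁] [Finite A₂] :
    Finite (Round Q A₁ A₂) :=
  Finite.of_injective (fun r : Round Q A₁ A₂ => (r.state, r.act₁, r.act₂)) (by
    intro x y h
    simp only [Prod.mk.injEq] at h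
    exact Round.ext h.1 h.2.1 h.2.2)

/-- A finite history `q₀ a₀ b₀ q₁ … a_{k-1} b_{k-1} q_k`: the completed rounds, oldest first,
and the current state. -/
structure Hist (Q A₁ A₂ : Type*) where
  past : List (Round Q A₁ A₂)
  last : Q

/-- The prefix of length `k` of an infinite sequence of rounds. -/
def histOf {Q A₁ A₂ : Type*} (ρ : ℕ → Round Q A₁ A₂) (k : ℕ) : Hist Q A₁ A₂ :=
  ⟨List.ofFn fun i : Fin k => ρ i, (ρ k).state⟩

/-- The player with this view cannot distinguish the two histories. -/
def View.Indist {Q A₁ A₂ : Type*} (v : View Q A₁ A₂) (h h' : Hist Q A₁ A₂) : Prop :=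
  List.Forall₂ (fun x y : Round Q A₁ A₂ =>
    v.st x.state y.state ∧ v.act₁ x.act₁ y.act₁ ∧ v.act₂ x.act₂ y.act₂) h.past h'.past ∧
  v.st h.last h'.last

namespace StochGame

variable {Q A₁ A₂ : Type*} (G : StochGame Q A₁ A₂)

/-- The game is deterministic: every transition distribution is a Dirac distribution. -/
def IsDeterministic : Prop := ∀ q a b, ∃ q', G.δ q a b = PMF.pure q'

/-- Both players have perfect observation. -/
def PerfectObservation : Prop :=
  G.view₁ = View.perfect Q A₁ A₂ ∧ G.view₂ = View.perfect Q A₁ A₂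

/-- One-sided games: player 1 has partial observation of the states (and does not see the
actions), player 2 has perfect observation. -/
def OneSided : Prop := G.view₁.ActionsInvisible ∧ G.view₂ = View.perfect Q A₁ A₂

/-- The plays of the game, from its initial state. -/
def Plays : Set (ℕ → Round Q A₁ A₂) :=
  {ρ | (ρ 0).state = G.init ∧
    ∀ j, 0 < G.δ (ρ j).state (ρ j).act₁ (ρ j).act₂ (ρ (j + 1)).state}

/-- The finite prefixes of plays. -/
def Prefs : Set (Hist Q A₁ A₂) := {h | ∃ ρ ∈ G.Plays, ∃ k, h = histOf ρ k}

/-- A strategy (pure if `D` is the set of actions, randomized if `D` is the set of distributions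
on actions) is observation-based for a given view. -/
def ObservationBased {D : Type*} (v : View Q A₁ A₂) (σ : Hist Q A₁ A₂ → D) : Prop :=
  ∀ h ∈ G.Prefs, ∀ h' ∈ G.Prefs, v.Indist h h' → σ h = σ h'

/-- The distribution of the round played after the history `h`: the players choose their
actions independently. -/
noncomputable def roundPMF (σ : Hist Q A₁ A₂ → PMF A₁) (π : Hist Q A₁ A₂ → PMF A₂)
    (h : Hist Q A₁ A₂) : PMF (Round Q A₁ A₂) :=
  (σ h).bind fun a => (π h).bind fun b => PMF.pure ⟨h.last, a, b⟩

/-- The distribution of round `n + 1`, given the rounds `0, …, n`: the next state is drawn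
according to `δ`, and then the players choose their actions. -/
noncomputable def nextPMF (σ : Hist Q A₁ A₂ → PMF A₁) (π : Hist Q A₁ A₂ → PMF A₂) (n : ℕ)
    (x : (i : Finset.Iic n) → Round Q A₁ A₂) : PMF (Round Q A₁ A₂) :=
  let cur : Round Q A₁ A₂ := x ⟨n, Finset.mem_Iic.mpr le_rfl⟩
  (G.δ cur.state cur.act₁ cur.act₂).bind fun q' =>
    roundPMF σ π
      ⟨List.ofFn fun i : Fin (n + 1) => x ⟨i, Finset.mem_Iic.mpr (Nat.lt_succ_iff.mp i.2)⟩, q'⟩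

/-- `nextPMF` as a Markov kernel. -/
noncomputable def nextKernel [Finite Q] [Finite A₁] [Finite A₂]
    (σ : Hist Q A₁ A₂ → PMF A₁) (π : Hist Q A₁ A₂ → PMF A₂) (n : ℕ) :
    ProbabilityTheory.Kernel ((i : Finset.Iic n) → Round Q A₁ A₂) (Round Q A₁ A₂) :=
  ProbabilityTheory.Kernel.ofFunOfCountable fun x => (G.nextPMF σ π n x).toMeasure

instance nextKernel_isMarkov [Finite Q] [Finite A₁] [Finite A₂]
    (σ : Hist Q A₁ A₂ → PMF A₁) (π : Hist Q A₁ A₂ → PMF A₂) (n : ℕ) :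
    ProbabilityTheory.IsMarkovKernel (G.nextKernel σ π n) :=
  ⟨fun x => PMF.toMeasure.isProbabilityMeasure (G.nextPMF σ π n x)⟩

/-- The probability measure on infinite sequences of rounds induced by the strategies `σ` and `π`
from the initial state. -/
noncomputable def law [Finite Q] [Finite A₁] [Finite A₂]
    (σ : Hist Q A₁ A₂ → PMF A₁) (π : Hist Q A₁ A₂ → PMF A₂) :
    MeasureTheory.Measure (ℕ → Round Q A₁ A₂) :=
  ProbabilityTheory.Kernel.trajMeasure (X := fun _ => Round Q A₁ A₂)
    (roundPMF σ π ⟨[], G.init⟩).toMeasure (G.nextKernel σ π)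

/-- The reachability objective. -/
def Reach (T : Set Q) : Set (ℕ → Round Q A₁ A₂) := {ρ | ∃ i, (ρ i).state ∈ T}

/-- The Büchi objective. -/
def Buchi (T : Set Q) : Set (ℕ → Round Q A₁ A₂) := {ρ | ∀ i, ∃ j, i ≤ j ∧ (ρ j).state ∈ T}

/-- Player 1 has a pure (observation-based) almost-sure winning strategy for `φ`. -/
def PureAlmostSureWinning [Finite Q] [Finite A₁] [Finite A₂]
    (φ : Set (ℕ → Round Q A₁ A₂)) : Prop :=
  ∃ σ : Hist Q A₁ A₂ → A₁, G.ObservationBased G.view₁ σ ∧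
    ∀ π : Hist Q A₁ A₂ → PMF A₂, G.ObservationBased G.view₂ π →
      G.law (fun h => PMF.pure (σ h)) π φ = 1

/-- Player 1 has a pure (observation-based) positive winning strategy for `φ`. -/
def PurePositiveWinning [Finite Q] [Finite A₁] [Finite A₂]
    (φ : Set (ℕ → Round Q A₁ A₂)) : Prop :=
  ∃ σ : Hist Q A₁ A₂ → A₁, G.ObservationBased G.view₁ σ ∧
    ∀ π : Hist Q A₁ A₂ → PMF A₂, G.ObservationBased G.view₂ π →
      0 < G.law (fun h => PMF.pure (σ h)) π φ

/-- A play is compatible with a pure strategy of player 1. -/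
def Compatible (σ : Hist Q A₁ A₂ → A₁) (ρ : ℕ → Round Q A₁ A₂) : Prop :=
  ∀ j, (ρ j).act₁ = σ (histOf ρ j)

/-- Player 1 has a (pure, observation-based) sure winning strategy for `φ`. -/
def SureWinning (φ : Set (ℕ → Round Q A₁ A₂)) : Prop :=
  ∃ σ : Hist Q A₁ A₂ → A₁, G.ObservationBased G.view₁ σ ∧
    ∀ ρ ∈ G.Plays, Compatible σ ρ → ρ ∈ φ

/-! ### The game on pairs (belief, obligation set) -/

/-- The possible successors of the states of `s` under the action `a` of player 1. -/
def Post (a : A₁) (s : Set Q) : Set Q := {q' | ∃ q ∈ s, ∃ b : A₂, q' ∈ (G.δ q a b).support}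

theorem Post_mono (a : A₁) {s s' : Set Q} (h : s ⊆ s') : G.Post a s ⊆ G.Post a s' :=
  fun _ ⟨q, hq, hb⟩ => ⟨q, h hq, hb⟩

/-- The states with observation `γ`, for player 1. -/
def cls (γ : G.view₁.Obs) : Set Q := {q | G.view₁.obs q = γ}

end StochGame

/-- The states of the belief game: the pairs `(s, o)` with `o ⊆ s`, and two absorbing states,
one that is losing for player 1 and one that is losing for player 2. -/
inductive BeliefState (Q : Type*) where
  | pair (s o : Set Q) (h : o ⊆ s)
  | lost₁
  | lost₂

/-- The accepting states: the pairs with an empty obligation set (and the absorbing state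
that is losing for player 2). -/
def BeliefState.accepting (Q : Type*) : Set (BeliefState Q) :=
  {ℓ | (∃ s h, ℓ = .pair s ∅ h) ∨ ℓ = .lost₂}

namespace StochGame

variable {Q A₁ A₂ : Type*} (G : StochGame Q A₁ A₂) (T : Set Q)

open Classical in
/-- The initial state of the belief game. -/
noncomputable def beliefInit : BeliefState Q :=
  if G.init ∈ T then .pair ∅ ∅ subset_rfl else .pair {G.init} {G.init} subset_rfl

open Classical in
/-- The transition function of the belief game. Player 1 plays an action `a` with a witness set
`u`, player 2 plays an observation `γ`. -/
noncomputable def beliefStep : BeliefState Q → A₁ × Set Q → G.view₁.Obs → BeliefState Q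
  | .lost₁, _, _ => .lost₁
  | .lost₂, _, _ => .lost₂
  | .pair s o h, (a, u), γ =>
    if s = ∅ then .pair s o h
    else if ¬ ∀ q ∈ o, ∀ b : A₂, ((G.δ q a b).support ∩ u).Nonempty then .lost₁
    else if ¬ (G.Post a s ∩ G.cls γ).Nonempty then .lost₂
    else if o = ∅ then
      .pair ((G.Post a s ∩ G.cls γ) \ T) ((G.Post a s ∩ G.cls γ) \ T) subset_rfl
    else
      .pair ((G.Post a s ∩ G.cls γ) \ T) ((G.Post a o ∩ G.cls γ ∩ u) \ T)
        (Set.sdiff_subset_sdiff_left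
          (Set.inter_subset_left.trans (Set.inter_subset_inter_left _ (G.Post_mono a h))))

/-- The belief game, a deterministic game of perfect observation. -/
noncomputable def beliefGame : StochGame (BeliefState Q) (A₁ × Set Q) G.view₁.Obs where
  init := G.beliefInit T
  δ ℓ a γ := PMF.pure (G.beliefStep T ℓ a γ)
  view₁ := View.perfect _ _ _
  view₂ := View.perfect _ _ _

/-! ### Games as words -/

/-- The word `w` is a description of the game `G` with the target set `T`: for some numberings of
the states, of the actions and of player 1's observations, `w` lists the number of states, of
actions of player 1, of actions of player 2 and of observations, the initial state, the observation
of every state, the indicator function of the target set, and all transition probabilities, each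
as a fraction of two natural numbers. -/
def Describes (w : List ℕ) : Prop :=
  ∃ (n m₁ m₂ k : ℕ) (eQ : Q ≃ Fin n) (e₁ : A₁ ≃ Fin m₁) (e₂ : A₂ ≃ Fin m₂)
    (eO : G.view₁.Obs ≃ Fin k) (num den : Q → A₁ → A₂ → Q → ℕ) (tgt : Q → ℕ),
    (∀ q a b q', 0 < den q a b q' ∧
      G.δ q a b q' = (num q a b q' : ENNReal) / (den q a b q' : ENNReal)) ∧
    (∀ q, (q ∈ T → tgt q = 1) ∧ (q ∉ T → tgt q = 0)) ∧
    w = [n, m₁, m₂, k, (eQ G.init : ℕ)] ++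
      (List.finRange n).map (fun i => (eO (G.view₁.obs (eQ.symm i)) : ℕ)) ++
      (List.finRange n).map (fun i => tgt (eQ.symm i)) ++
      (List.finRange n).flatMap fun i => (List.finRange m₁).flatMap fun x =>
        (List.finRange m₂).flatMap fun y => (List.finRange n).flatMap fun j =>
          [num (eQ.symm i) (e₁.symm x) (e₂.symm y) (eQ.symm j),
            den (eQ.symm i) (e₁.symm x) (e₂.symm y) (eQ.symm j)]

/-- The word `w` is an explicit description of the deterministic game of perfect observation `G`
with the set `T` of accepting states: for some numberings of the states and of the actions, `w`
lists the number of states, of actions of player 1 and of actions of player 2, the initial state,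
the indicator function of `T`, and the complete successor table. -/
def DescribesDet (w : List ℕ) : Prop :=
  G.PerfectObservation ∧
  ∃ (n m₁ m₂ : ℕ) (eQ : Q ≃ Fin n) (e₁ : A₁ ≃ Fin m₁) (e₂ : A₂ ≃ Fin m₂)
    (succ : Q → A₁ → A₂ → Q) (tgt : Q → ℕ),
    (∀ q a b, G.δ q a b = PMF.pure (succ q a b)) ∧
    (∀ q, (q ∈ T → tgt q = 1) ∧ (q ∉ T → tgt q = 0)) ∧
    w = [n, m₁, m₂, (eQ G.init : ℕ)] ++
      (List.finRange n).map (fun i => tgt (eQ.symm i)) ++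
      (List.finRange n).flatMap fun i => (List.finRange m₁).flatMap fun x =>
        (List.finRange m₂).map fun y => (eQ (succ (eQ.symm i) (e₁.symm x) (e₂.symm y)) : ℕ)

end StochGame

/-! ### A random access machine with a step count

Structured programs over natural-number variables and arrays of natural numbers with indirect
addressing. The arithmetic is addition and truncated subtraction; every operation, test and memory
access costs one unit. -/

/-- Expressions. -/
inductive RExpr where
  | lit (n : ℕ)
  | var (r : ℕ)
  | add (e f : RExpr)
  | sub (e f : RExpr)
  /-- the entry of array `k` at the index `e` -/
  | get (k : ℕ) (e : RExpr)

/-- Programs. -/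
inductive RProg where
  | skip
  /-- variable `r` := `e` -/
  | assign (r : ℕ) (e : RExpr)
  /-- array `k` at index `i` := `e` -/
  | put (k : ℕ) (i e : RExpr)
  | seq (p p' : RProg)
  /-- if `e ≠ 0` then `p` else `p'` -/
  | cond (e : RExpr) (p p' : RProg)
  /-- while `e ≠ 0` do `p` -/
  | loop (e : RExpr) (p : RProg)

/-- The contents of the variables and of the arrays. -/
structure RStore where
  var : ℕ → ℕ
  arr : ℕ → ℕ → ℕ

def RStore.setVar (s : RStore) (r v : ℕ) : RStore := { s with var := Function.update s.var r v }

def RStore.setArr (s : RStore) (k i v : ℕ) : RStore :=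
  { s with arr := Function.update s.arr k (Function.update (s.arr k) i v) }

def RExpr.eval (s : RStore) : RExpr → ℕ
  | .lit n => n
  | .var r => s.var r
  | .add e f => e.eval s + f.eval s
  | .sub e f => e.eval s - f.eval s
  | .get k e => s.arr k (e.eval s)

/-- The cost of the evaluation of an expression: its number of nodes. -/
def RExpr.cost : RExpr → ℕ
  | .lit _ => 1
  | .var _ => 1
  | .add e f => e.cost + f.cost + 1
  | .sub e f => e.cost + f.cost + 1
  | .get _ e => e.cost + 1

/-- `p.Runs s t s'`: started in the store `s`, the program `p` halts after exactly `t` steps in the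
store `s'`. -/
inductive RProg.Runs : RProg → RStore → ℕ → RStore → Prop
  | skip (s : RStore) : RProg.Runs .skip s 1 s
  | assign (r : ℕ) (e : RExpr) (s : RStore) :
      RProg.Runs (.assign r e) s (e.cost + 1) (s.setVar r (e.eval s))
  | put (k : ℕ) (i e : RExpr) (s : RStore) :
      RProg.Runs (.put k i e) s (i.cost + e.cost + 1) (s.setArr k (i.eval s) (e.eval s))
  | seq {p p' : RProg} {s s' s'' : RStore} {t t' : ℕ} :
      RProg.Runs p s t s' → RProg.Runs p' s' t' s'' → RProg.Runs (.seq p p') s (t + t') s''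
  | condTrue {e : RExpr} {p p' : RProg} {s s' : RStore} {t : ℕ} :
      e.eval s ≠ 0 → RProg.Runs p s t s' → RProg.Runs (.cond e p p') s (e.cost + 1 + t) s'
  | condFalse {e : RExpr} {p p' : RProg} {s s' : RStore} {t : ℕ} :
      e.eval s = 0 → RProg.Runs p' s t s' → RProg.Runs (.cond e p p') s (e.cost + 1 + t) s'
  | loopDone {e : RExpr} {p : RProg} {s : RStore} :
      e.eval s = 0 → RProg.Runs (.loop e p) s (e.cost + 1) s
  | loopStep {e : RExpr} {p : RProg} {s s' s'' : RStore} {t t' : ℕ} :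
      e.eval s ≠ 0 → RProg.Runs p s t s' → RProg.Runs (.loop e p) s' t' s'' →
      RProg.Runs (.loop e p) s (e.cost + 1 + t + t') s''

/-- The initial store: the input word is in array 0, everything else is 0. -/
def RStore.input (w : List ℕ) : RStore where
  var := fun _ => 0
  arr := fun k i => if k = 0 then w.getD i 0 else 0

/-- The output is in array 1, its length is in variable 0. -/
def RStore.HasOutput (s : RStore) (v : List ℕ) : Prop :=
  s.var 0 = v.length ∧ ∀ i < v.length, s.arr 1 i = v.getD i 0

/-- On the input `w`, the program `p` halts within `t` steps with the output `v`. -/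
def RProg.OutputsWithin (p : RProg) (w v : List ℕ) (t : ℕ) : Prop :=
  ∃ t' ≤ t, ∃ s, p.Runs (RStore.input w) t' s ∧ s.HasOutput v

/-! All positive transition probabilities of a finite game have a common lower bound, so for a fixed
pure strategy `σ` of player 1, a function of the observation sequence, winning depends only on
supports. This is measured by `ReachRank`: a situation has rank `n + 1` if, against each action of
player 2, some possible successor lies in the target or has rank `n`. From a situation without rank,
finiteness of `A₂` gives an action of player 2 all of whose outcomes miss the target and again have
no rank; player 2, who sees everything, thus avoids the target forever (`exists_counter_strategy`).
Conversely, rank `n` yields probability at least `ε ^ n` of reaching the target within `n` rounds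
(`law_agree_reachBy`). A rank at the initial state therefore means positive winning, and a uniform
rank in all reachable situations means almost-sure winning, by independent-looking trials with
geometric decay (`pureAlmostSureWinning_of_reachRank`).

The belief game makes player 1 exhibit such ranks. The obligation set holds the states whose rank
still has to decrease, and the witness `u` names their successors of smaller rank, one for each
action of player 2. An empty obligation set means that a round of ranks has been discharged, and it
is then refilled with the whole belief. Given ranks in `G`, `beliefStrategy` plays `σ` with the sets
of smaller rank as witnesses. Given a sure winning strategy in `H`, the attractor yields a
positional strategy with a rank on the states of `H` that drops outside the accepting states
(`SureWinning.exists_rank_buchi`, `SureWinning.exists_rank_reach`). This rank transfers to the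
states of `G` in the obligation set (`reachRank_of_mem_obligation`) and in the belief
(`reachRank_of_mem_belief`). Finiteness of `H` makes the ranks uniformly bounded, which the
counter-strategy argument in `G` alone does not provide.

For the running time, a pair (belief, obligation set) is written as a number with one base-3 digit
per state. Each entry of the output is then defined by bounded quantifiers, bounded sums and
arithmetic. The class `Comp` of functions computable in time polynomial in `2 ^ |Q| * |A₁| * |A₂|`
is closed under these, and a polynomial in a number that is at least 2 is bounded by a power of it.
-/

set_option linter.unusedSectionVars false

/-! ### The law of a play: cylinders, supports and almost sure properties. -/

namespace StochGame

open MeasureTheory ProbabilityTheory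

variable {Q A₁ A₂ : Type*} (G : StochGame Q A₁ A₂)

section Law

variable [Finite Q] [Finite A₁] [Finite A₂]
  (σ : Hist Q A₁ A₂ → PMF A₁) (π : Hist Q A₁ A₂ → PMF A₂)

instance law_isProbability : IsProbabilityMeasure (G.law σ π) := by
  unfold law
  have : IsProbabilityMeasure (roundPMF σ π ⟨[], G.init⟩).toMeasure :=
    PMF.toMeasure.isProbabilityMeasure _
  infer_instance

/-- The sequences of rounds that agree with `ρ₀` up to round `n`. -/
def agree (ρ₀ : ℕ → Round Q A₁ A₂) (n : ℕ) : Set (ℕ → Round Q A₁ A₂) :=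
  {ρ | ∀ i ≤ n, ρ i = ρ₀ i}

theorem agree_eq_preimage (ρ₀ : ℕ → Round Q A₁ A₂) (n : ℕ) :
    agree ρ₀ n = Preorder.frestrictLe (π := fun _ => Round Q A₁ A₂) n ⁻¹'
      {fun i : Finset.Iic n => ρ₀ i} := by
  ext ρ
  simp only [agree, Set.mem_ofPred_eq, Set.mem_preimage, Set.mem_singleton_iff, funext_iff]
  constructor
  · intro h i
    exact h i (Finset.mem_Iic.mp i.2)
  · intro h i hi
    exact h ⟨i, Finset.mem_Iic.mpr hi⟩

theorem measurableSet_agree (ρ₀ : ℕ → Round Q A₁ A₂) (n : ℕ) : MeasurableSet (agree ρ₀ n) := by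
  rw [agree_eq_preimage]
  exact (Preorder.measurable_frestrictLe n) (MeasurableSet.singleton _)

theorem measurableSet_round (n : ℕ) (B : Set (Round Q A₁ A₂)) :
    MeasurableSet {ρ : ℕ → Round Q A₁ A₂ | ρ n ∈ B} :=
  (measurable_pi_apply n) (MeasurableSet.of_discrete (s := B))

/-- The Markov property on cylinders: the joint law of a prefix and the next round is a composition
product with `nextKernel`, evaluated here on the rectangle of one prefix and `B`. -/
theorem law_agree_inter (ρ₀ : ℕ → Round Q A₁ A₂) (n : ℕ) (B : Set (Round Q A₁ A₂)) :
    G.law σ π (agree ρ₀ n ∩ {ρ | ρ (n + 1) ∈ B}) =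
      G.law σ π (agree ρ₀ n) * (G.nextPMF σ π n fun i => ρ₀ i).toMeasure B := by
  have : IsProbabilityMeasure (roundPMF σ π ⟨[], G.init⟩).toMeasure :=
    PMF.toMeasure.isProbabilityMeasure _
  have key := Kernel.map_frestrictLe_trajMeasure_compProd_eq_map_trajMeasure
    (X := fun _ => Round Q A₁ A₂) (μ₀ := (roundPMF σ π ⟨[], G.init⟩).toMeasure)
    (κ := G.nextKernel σ π) (a := n)
  have h1 := congrArg (fun m => m ({fun i : Finset.Iic n => ρ₀ i} ×ˢ B)) key
  rw [Measure.compProd_apply_prod (MeasurableSet.singleton _) MeasurableSet.of_discrete,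
    Measure.map_apply (by fun_prop) ((MeasurableSet.singleton _).prod MeasurableSet.of_discrete),
    lintegral_singleton, Measure.map_apply (by fun_prop) (MeasurableSet.singleton _),
    ← agree_eq_preimage] at h1
  rw [law, mul_comm]
  refine Eq.trans ?_ (h1.symm.trans ?_)
  · rw [agree_eq_preimage]
    rfl
  · rfl

theorem law_zero (B : Set (Round Q A₁ A₂)) :
    G.law σ π {ρ | ρ 0 ∈ B} = (roundPMF σ π ⟨[], G.init⟩).toMeasure B := by
  have : IsProbabilityMeasure (roundPMF σ π ⟨[], G.init⟩).toMeasure :=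
    PMF.toMeasure.isProbabilityMeasure _
  have h : (G.law σ π).map (Preorder.frestrictLe (π := fun _ => Round Q A₁ A₂) 0) =
      (roundPMF σ π ⟨[], G.init⟩).toMeasure.map
        (MeasurableEquiv.piUnique (fun _ : Finset.Iic 0 => Round Q A₁ A₂)).symm := by
    rw [law, Kernel.trajMeasure, Measure.map_comp _ _ (by fun_prop), Kernel.traj_map_frestrictLe,
      Kernel.partialTraj_self, Measure.id_comp]
  have h2 := congrArg (fun m => m {x | x ⟨0, Finset.mem_Iic.mpr le_rfl⟩ ∈ B}) h
  have hm : MeasurableSet {x : (i : Finset.Iic 0) → Round Q A₁ A₂ |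
    x ⟨0, Finset.mem_Iic.mpr le_rfl⟩ ∈ B} := MeasurableSet.of_discrete
  rw [Measure.map_apply (by fun_prop) hm, Measure.map_apply (by fun_prop) hm] at h2
  exact h2

theorem roundPMF_map_state (h : Hist Q A₁ A₂) : (roundPMF σ π h).map Round.state = PMF.pure h.last := by
  simp [roundPMF, PMF.map_bind, PMF.pure_map]

theorem nextPMF_map_state (n : ℕ) (ρ₀ : ℕ → Round Q A₁ A₂) :
    (G.nextPMF σ π n fun i => ρ₀ i).map Round.state =
      G.δ (ρ₀ n).state (ρ₀ n).act₁ (ρ₀ n).act₂ := by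
  simp [nextPMF, PMF.map_bind, roundPMF_map_state]

/-- Projecting the next round to its state removes the strategies from `nextPMF` and leaves only the
transition function. -/
theorem law_agree_inter_state (ρ₀ : ℕ → Round Q A₁ A₂) (n : ℕ) (q : Q) :
    G.law σ π (agree ρ₀ n ∩ {ρ | (ρ (n + 1)).state = q}) =
      G.law σ π (agree ρ₀ n) * G.δ (ρ₀ n).state (ρ₀ n).act₁ (ρ₀ n).act₂ q := by
  let : MeasurableSpace Q := ⊤
  have h := G.law_agree_inter σ π ρ₀ n (Round.state ⁻¹' {q})
  rw [← PMF.toMeasure_map_apply _ _ _ (measurable_of_finite _ ) (MeasurableSet.of_discrete),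
    nextPMF_map_state, PMF.toMeasure_apply_singleton _ _ (MeasurableSet.of_discrete)] at h
  exact h

theorem mem_support_roundPMF (h : Hist Q A₁ A₂) (r : Round Q A₁ A₂) :
    r ∈ (roundPMF σ π h).support ↔
      r.state = h.last ∧ r.act₁ ∈ (σ h).support ∧ r.act₂ ∈ (π h).support := by
  cases r
  simp only [roundPMF, PMF.mem_support_bind_iff, PMF.support_pure, Set.mem_singleton_iff,
    Round.mk.injEq]
  constructor
  · rintro ⟨a, ha, b, hb, h1, rfl, rfl⟩
    exact ⟨h1, ha, hb⟩
  · rintro ⟨h1, ha, hb⟩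
    exact ⟨_, ha, _, hb, h1, rfl, rfl⟩

theorem ae_initial : ∀ᵐ ρ ∂(G.law σ π), (ρ 0).state = G.init ∧
    (ρ 0).act₁ ∈ (σ (histOf ρ 0)).support ∧ (ρ 0).act₂ ∈ (π (histOf ρ 0)).support := by
  have h := G.law_zero σ π ((roundPMF σ π ⟨[], G.init⟩).supportᶜ)
  rw [(PMF.toMeasure_apply_eq_zero_iff _ MeasurableSet.of_discrete).mpr disjoint_compl_right] at h
  rw [ae_iff]
  refine measure_mono_null (fun ρ hρ => ?_) h
  simp only [Set.mem_ofPred_eq, Set.mem_compl_iff] at hρ ⊢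
  intro hs
  apply hρ
  rw [mem_support_roundPMF] at hs
  have : histOf ρ 0 = ⟨[], G.init⟩ := by simp [histOf, hs.1]
  rw [this]
  exact hs

theorem ae_succ (n : ℕ) : ∀ᵐ ρ ∂(G.law σ π),
    0 < G.δ (ρ n).state (ρ n).act₁ (ρ n).act₂ (ρ (n + 1)).state ∧
    (ρ (n + 1)).act₁ ∈ (σ (histOf ρ (n + 1))).support ∧
    (ρ (n + 1)).act₂ ∈ (π (histOf ρ (n + 1))).support := by
  have h : ∀ᵐ ρ ∂(G.law σ π), ρ (n + 1) ∈ (G.nextPMF σ π n fun i => ρ i).support := by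
    rw [ae_iff]
    rcases isEmpty_or_nonempty (Round Q A₁ A₂) with he | he
    · have : IsEmpty (ℕ → Round Q A₁ A₂) := ⟨fun ρ => he.false (ρ 0)⟩
      rw [Set.eq_empty_of_isEmpty {a | _}]
      exact measure_empty
    -- The exceptional set splits into one null piece for each of the countably many prefixes. The
    -- default value after round `n` is not seen by `agree`.
    have hU : {ρ : ℕ → Round Q A₁ A₂ | ρ (n + 1) ∉ (G.nextPMF σ π n fun i => ρ i).support} ⊆
        ⋃ x : (i : Finset.Iic n) → Round Q A₁ A₂,
          (agree (fun i => if h : i ≤ n then x ⟨i, Finset.mem_Iic.mpr h⟩ else he.some) n ∩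
            {ρ | ρ (n + 1) ∈ (G.nextPMF σ π n x).supportᶜ}) := by
      intro ρ hρ
      refine Set.mem_iUnion.mpr ⟨fun i => ρ i, ?_, hρ⟩
      intro i hi
      simp [hi]
    refine measure_mono_null hU (measure_iUnion_null fun x => ?_)
    have := G.law_agree_inter σ π
      (fun i => if h : i ≤ n then x ⟨i, Finset.mem_Iic.mpr h⟩ else he.some) n
      (G.nextPMF σ π n x).supportᶜ
    rw [this]
    have hx : (fun i : Finset.Iic n => (fun i => if h : i ≤ n then x ⟨i, Finset.mem_Iic.mpr h⟩
        else he.some) (i : ℕ)) = x := by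
      funext i
      simp [Finset.mem_Iic.mp i.2]
    rw [hx, (PMF.toMeasure_apply_eq_zero_iff _ MeasurableSet.of_discrete).mpr
      disjoint_compl_right, mul_zero]
  filter_upwards [h] with ρ hρ
  simp only [nextPMF, PMF.mem_support_bind_iff] at hρ
  obtain ⟨q, hq, hr⟩ := hρ
  rw [mem_support_roundPMF] at hr
  obtain ⟨h1, h2, h3⟩ := hr
  subst h1
  exact ⟨pos_iff_ne_zero.mpr hq, h2, h3⟩

/-- This reduces almost sure statements to combinatorial statements about single plays that follow
the supports of both strategies. -/
theorem ae_play : ∀ᵐ ρ ∂(G.law σ π), ρ ∈ G.Plays ∧ ∀ n,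
    (ρ n).act₁ ∈ (σ (histOf ρ n)).support ∧ (ρ n).act₂ ∈ (π (histOf ρ n)).support := by
  filter_upwards [G.ae_initial σ π, ae_all_iff.mpr (G.ae_succ σ π)] with ρ h0 h
  refine ⟨⟨h0.1, fun j => (h j).1⟩, fun n => ?_⟩
  cases n with
  | zero => exact h0.2
  | succ n => exact (h n).2

/-- A finite prefix of a play has positive probability if the strategies choose its actions with
positive probability. -/
theorem law_agree_pos {ρ₀ : ℕ → Round Q A₁ A₂} (hρ : ρ₀ ∈ G.Plays) (n : ℕ)
    (h : ∀ i ≤ n, (ρ₀ i).act₁ ∈ (σ (histOf ρ₀ i)).support ∧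
      (ρ₀ i).act₂ ∈ (π (histOf ρ₀ i)).support) : 0 < G.law σ π (agree ρ₀ n) := by
  induction n with
  | zero =>
    have h0 : agree ρ₀ 0 = {ρ | ρ 0 ∈ ({ρ₀ 0} : Set (Round Q A₁ A₂))} := by
      ext ρ
      simp [agree]
    rw [h0, law_zero, PMF.toMeasure_apply_singleton _ _ MeasurableSet.of_discrete,
      pos_iff_ne_zero, ← PMF.mem_support_iff, mem_support_roundPMF]
    have := h 0 le_rfl
    have h1 : histOf ρ₀ 0 = ⟨[], G.init⟩ := by simp [histOf, hρ.1]
    rw [h1] at this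
    exact ⟨hρ.1, this⟩
  | succ n ih =>
    have h0 : agree ρ₀ (n + 1) =
        agree ρ₀ n ∩ {ρ | ρ (n + 1) ∈ ({ρ₀ (n + 1)} : Set (Round Q A₁ A₂))} := by
      ext ρ
      simp only [agree, Set.mem_inter_iff, Set.mem_ofPred_eq, Set.mem_singleton_iff]
      constructor
      · exact fun h => ⟨fun i hi => h i (by omega), h _ le_rfl⟩
      · rintro ⟨h1, h2⟩ i hi
        rcases Nat.lt_or_ge n i with h3 | h3
        · obtain rfl : i = n + 1 := by omega
          exact h2
        · exact h1 i h3
    rw [h0, law_agree_inter, PMF.toMeasure_apply_singleton _ _ MeasurableSet.of_discrete]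
    refine ENNReal.mul_pos (ih fun i hi => h i (by omega)).ne' ?_
    rw [← PMF.mem_support_iff]
    simp only [nextPMF, PMF.mem_support_bind_iff]
    refine ⟨(ρ₀ (n + 1)).state, (hρ.2 n).ne', ?_⟩
    rw [mem_support_roundPMF]
    exact ⟨rfl, h (n + 1) le_rfl⟩

theorem measurableSet_reach (T : Set Q) : MeasurableSet (Reach (A₁ := A₁) (A₂ := A₂) T) := by
  have : Reach (A₁ := A₁) (A₂ := A₂) T = ⋃ i, {ρ | ρ i ∈ {r | r.state ∈ T}} := by
    ext ρ
    simp [Reach]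
  rw [this]
  exact MeasurableSet.iUnion fun i => measurableSet_round i _

end Law

end StochGame

/-! ### Histories as seen by a player who does not see actions. -/

/-- The sequence of observations of the states of a history. -/
def View.obsList {Q A₁ A₂ : Type*} (v : View Q A₁ A₂) (h : Hist Q A₁ A₂) : List v.Obs :=
  h.past.map (fun r => v.obs r.state) ++ [v.obs h.last]

/-- Without visible actions only the observations of the states remain, so strategies of player 1
may be treated as functions on lists of observations. -/
theorem View.indist_iff_obsList {Q A₁ A₂ : Type*} {v : View Q A₁ A₂} (hv : v.ActionsInvisible)
    (h h' : Hist Q A₁ A₂) : v.Indist h h' ↔ v.obsList h = v.obsList h' := by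
  obtain ⟨p, q⟩ := h
  obtain ⟨p', q'⟩ := h'
  have hst : ∀ x y : Q, v.st x y ↔ v.obs x = v.obs y := fun x y => Quotient.eq.symm
  have htop : ∀ x y : Round Q A₁ A₂, v.act₁ x.act₁ y.act₁ ∧ v.act₂ x.act₂ y.act₂ := by
    intro x y
    rw [hv.1, hv.2]
    exact ⟨trivial, trivial⟩
  simp only [View.Indist, View.obsList, hst, htop, and_true]
  have hap : ∀ (l l' : List v.Obs) (x y : v.Obs), l ++ [x] = l' ++ [y] ↔ l = l' ∧ x = y := by
    intro l l' x y
    rw [← List.concat_eq_append, ← List.concat_eq_append]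
    exact ⟨fun h => ⟨List.init_eq_of_concat_eq h, List.last_eq_of_concat_eq h⟩,
      fun ⟨h, h'⟩ => h ▸ h' ▸ rfl⟩
  rw [hap, ← List.forall₂_eq_eq_eq, List.forall₂_map_left_iff, List.forall₂_map_right_iff]

theorem histOf_succ_past {Q A₁ A₂ : Type*} (ρ : ℕ → Round Q A₁ A₂) (k : ℕ) :
    (histOf ρ (k + 1)).past = (histOf ρ k).past ++ [ρ k] := by
  simp only [histOf, List.ofFn_succ', List.concat_eq_append]
  rfl

theorem histOf_congr {Q A₁ A₂ : Type*} {ρ ρ' : ℕ → Round Q A₁ A₂} {k : ℕ}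
    (h : ∀ i < k, ρ i = ρ' i) (h' : (ρ k).state = (ρ' k).state) : histOf ρ k = histOf ρ' k := by
  simp only [histOf, h', Hist.mk.injEq, and_true]
  congr 1
  funext i
  exact h i i.2

@[simp] theorem histOf_last {Q A₁ A₂ : Type*} (ρ : ℕ → Round Q A₁ A₂) (k : ℕ) :
    (histOf ρ k).last = (ρ k).state := rfl

@[simp] theorem histOf_past_length {Q A₁ A₂ : Type*} (ρ : ℕ → Round Q A₁ A₂) (k : ℕ) :
    (histOf ρ k).past.length = k := by
  simp [histOf]

namespace View

variable {Q A₁ A₂ : Type*} (v : View Q A₁ A₂)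

theorem obsList_histOf_zero (ρ : ℕ → Round Q A₁ A₂) :
    v.obsList (histOf ρ 0) = [v.obs (ρ 0).state] := by
  simp [obsList, histOf]

theorem obsList_histOf_succ (ρ : ℕ → Round Q A₁ A₂) (k : ℕ) :
    v.obsList (histOf ρ (k + 1)) = v.obsList (histOf ρ k) ++ [v.obs (ρ (k + 1)).state] := by
  simp only [obsList, histOf_succ_past, List.map_append, histOf_last, List.map_cons, List.map_nil]

end View

/-! ### Ranks for reachability, and counter-strategies where no rank exists. -/

namespace StochGame

open MeasureTheory ProbabilityTheory

variable {Q A₁ A₂ : Type*} (G : StochGame Q A₁ A₂) (T : Set Q)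

theorem observationBased_of_perfect {D : Type*} {v : View Q A₁ A₂} (hv : v = View.perfect Q A₁ A₂)
    (π : Hist Q A₁ A₂ → D) : G.ObservationBased v π := by
  subst hv
  rintro ⟨p, q⟩ - ⟨p', q'⟩ - ⟨h1, h2⟩
  have h2 : q = q' := h2
  have : p = p' := by
    rw [← List.forall₂_eq_eq_eq]
    refine h1.imp fun x y hxy => ?_
    exact Round.ext hxy.1 hxy.2.1 hxy.2.2
  rw [this, h2]

/-- In `n` rounds at most, the strategy `σ` of player 1 (a function of the observations) can reach
`T` with positive probability, whatever player 2 does; `η` is the list of the observations so far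
and `q` is the current state. -/
def ReachRank (σ : List G.view₁.Obs → A₁) : ℕ → List G.view₁.Obs → Q → Prop
  | 0, _, _ => False
  | n + 1, η, q => ∀ b, ∃ q' ∈ (G.δ q (σ η) b).support,
      q' ∈ T ∨ ReachRank σ n (η ++ [G.view₁.obs q']) q'

/-- Under the strategy `σ`, the state `q` can be reached outside of `T` with the observations
`η`. -/
inductive Reachable (σ : List G.view₁.Obs → A₁) : List G.view₁.Obs → Q → Prop
  | init (h : G.init ∉ T) : Reachable σ [G.view₁.obs G.init] G.init
  | step {η : List G.view₁.Obs} {q q' : Q} {b : A₂} (h : Reachable σ η q)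
      (hq : q' ∈ (G.δ q (σ η) b).support) (hT : q' ∉ T) : Reachable σ (η ++ [G.view₁.obs q']) q'

variable {G T}

theorem ReachRank.succ {σ : List G.view₁.Obs → A₁} {n : ℕ} {η : List G.view₁.Obs} {q : Q}
    (h : G.ReachRank T σ n η q) : G.ReachRank T σ (n + 1) η q := by
  induction n generalizing η q with
  | zero => exact h.elim
  | succ n ih =>
    intro b
    obtain ⟨q', hq', h'⟩ := h b
    exact ⟨q', hq', h'.imp_right ih⟩

theorem ReachRank.mono {σ : List G.view₁.Obs → A₁} {n m : ℕ} (hnm : n ≤ m)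
    {η : List G.view₁.Obs} {q : Q} (h : G.ReachRank T σ n η q) : G.ReachRank T σ m η q := by
  induction m, hnm using Nat.le_induction with
  | base => exact h
  | succ m _ ih => exact ih.succ

/-- If every action of player 2 allowed a ranked or target successor, the maximum of these finitely
many ranks would bound a rank of `q` itself. -/
theorem exists_avoiding_action [Finite A₂] {σ : List G.view₁.Obs → A₁} {η : List G.view₁.Obs}
    {q : Q} (h : ¬ ∃ n, G.ReachRank T σ n η q) :
    ∃ b, ∀ q' ∈ (G.δ q (σ η) b).support,
      q' ∉ T ∧ ¬ ∃ n, G.ReachRank T σ n (η ++ [G.view₁.obs q']) q' := by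
  by_contra! hc
  apply h
  have hc' : ∀ b, ∃ n, ∃ q' ∈ (G.δ q (σ η) b).support,
      q' ∈ T ∨ G.ReachRank T σ n (η ++ [G.view₁.obs q']) q' := by
    intro b
    obtain ⟨q', hq', h'⟩ := hc b
    by_cases hT : q' ∈ T
    · exact ⟨0, q', hq', Or.inl hT⟩
    · obtain ⟨n, hn⟩ := h' hT
      exact ⟨n, q', hq', Or.inr hn⟩
  choose f hf using hc'
  obtain ⟨N, hN⟩ := Finite.exists_le f
  refine ⟨N + 1, fun b => ?_⟩
  obtain ⟨q', hq', h'⟩ := hf b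
  exact ⟨q', hq', h'.imp_right fun h => h.mono (hN b)⟩

/-- Plays are infinite, so a finite path has to be prolonged: two fixed actions are repeated and a
possible successor is chosen each time. -/
theorem exists_play_extension [Nonempty A₁] [Nonempty A₂] (ρ : ℕ → Round Q A₁ A₂) (k : ℕ)
    (h0 : (ρ 0).state = G.init)
    (h : ∀ j < k, 0 < G.δ (ρ j).state (ρ j).act₁ (ρ j).act₂ (ρ (j + 1)).state) :
    ∃ ρ' ∈ G.Plays, (∀ j < k, ρ' j = ρ j) ∧ (ρ' k).state = (ρ k).state := by
  obtain ⟨a⟩ := ‹Nonempty A₁›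
  obtain ⟨b⟩ := ‹Nonempty A₂›
  have hs : ∀ q, ∃ q', q' ∈ (G.δ q a b).support := fun q => (G.δ q a b).support_nonempty
  choose f hf using hs
  have hk : ((if k < k then ρ k else ⟨f^[k - k] (ρ k).state, a, b⟩ : Round Q A₁ A₂)).state =
    (ρ k).state := by simp
  refine ⟨fun i => if i < k then ρ i else ⟨f^[i - k] (ρ k).state, a, b⟩, ⟨?_, fun j => ?_⟩, ?_, hk⟩
  · by_cases hk0 : 0 < k
    · simp [hk0, h0]
    · obtain rfl : k = 0 := by omega
      simpa using h0
  · rcases lt_trichotomy (j + 1) k with hj | hj | hj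
    · simp only [hj, (by omega : j < k), if_true]
      exact h j (by omega)
    · subst hj
      simp only [lt_irrefl, if_false, Nat.lt_succ_self, if_true, Nat.sub_self,
        Function.iterate_zero, id]
      exact h j (by omega)
    · have h1 : ¬ j + 1 < k := by omega
      have h2 : ¬ j < k := by omega
      simp only [if_neg h1, if_neg h2]
      rw [(by omega : j + 1 - k = (j - k) + 1), Function.iterate_succ_apply']
      exact pos_iff_ne_zero.mpr (hf _)
  · intro j hj
    simp [hj]

/-- Observation-based strategies are constrained only on prefixes of plays, and player 2 needs
concrete actions to replay; both require an actual play behind an abstractly reachable situation. -/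
theorem Reachable.exists_play [Nonempty A₁] [Nonempty A₂] {σ : List G.view₁.Obs → A₁}
    {η : List G.view₁.Obs} {q : Q} (h : G.Reachable T σ η q) :
    ∃ ρ ∈ G.Plays, ∃ k, (∀ j < k, (ρ j).act₁ = σ (G.view₁.obsList (histOf ρ j))) ∧
      (∀ i ≤ k, (ρ i).state ∉ T) ∧ G.view₁.obsList (histOf ρ k) = η ∧ (ρ k).state = q := by
  induction h with
  | init h =>
    obtain ⟨a⟩ := ‹Nonempty A₁›
    obtain ⟨b⟩ := ‹Nonempty A₂›
    obtain ⟨ρ, hρ, -, h2⟩ := G.exists_play_extension (fun _ => ⟨G.init, a, b⟩) 0 rfl (by simp)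
    simp only at h2
    refine ⟨ρ, hρ, 0, by simp, ?_, ?_, h2⟩
    · intro i hi
      obtain rfl : i = 0 := by omega
      rwa [h2]
    · rw [View.obsList_histOf_zero, h2]
  | @step η q q' b hr hq hT ih =>
    obtain ⟨ρ, hρ, k, h1, h2, h3, h4⟩ := ih
    -- The actions of round `k` in `ρ` are unconstrained and may be replaced by `σ η` and `b`. The
    -- actions stored with `q'` are placeholders.
    let ρ₁ : ℕ → Round Q A₁ A₂ := fun i =>
      if i < k then ρ i else if i = k then ⟨q, σ η, b⟩ else ⟨q', σ η, b⟩
    have e1 : ∀ i < k, ρ₁ i = ρ i := fun i hi => by simp [ρ₁, hi]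
    have e2 : ρ₁ k = ⟨q, σ η, b⟩ := by simp [ρ₁]
    have e3 : ρ₁ (k + 1) = ⟨q', σ η, b⟩ := by simp [ρ₁]
    have e4 : ∀ i ≤ k, (ρ₁ i).state = (ρ i).state := by
      intro i hi
      rcases hi.lt_or_eq with hi | rfl
      · rw [e1 i hi]
      · rw [e2, h4]
    obtain ⟨ρ', hρ', f1, f2⟩ := G.exists_play_extension ρ₁ (k + 1) (by rw [e4 0 (by omega), hρ.1])
      (by
        intro j hj
        rcases Nat.lt_or_ge j k with hj' | hj'
        · rw [e1 j hj', e4 (j + 1) hj']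
          exact hρ.2 j
        · obtain rfl : j = k := by omega
          rw [e2, e3]
          exact pos_iff_ne_zero.mpr hq)
    have g4 : ∀ i ≤ k, (ρ' i).state = (ρ i).state := fun i hi => by
      rw [f1 i (by omega), e4 i hi]
    have g5 : ∀ i ≤ k, histOf ρ' i = histOf ρ i := fun i hi =>
      histOf_congr (fun j hj => by rw [f1 j (by omega), e1 j (by omega)]) (g4 i hi)
    rw [e3] at f2
    refine ⟨ρ', hρ', k + 1, ?_, ?_, ?_, f2⟩
    · intro j hj
      rw [g5 j (by omega), f1 j hj]
      rcases Nat.lt_or_ge j k with hj' | hj'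
      · rw [e1 j hj', h1 j hj']
      · obtain rfl : j = k := by omega
        rw [e2, h3]
    · intro i hi
      rcases hi.lt_or_eq with hi | rfl
      · rw [g4 i (by omega)]
        exact h2 i (by omega)
      · rwa [f2]
    · rw [View.obsList_histOf_succ, g5 k le_rfl, h3, f2]

theorem reachable_of_play {σ : List G.view₁.Obs → A₁} {ρ : ℕ → Round Q A₁ A₂} (hρ : ρ ∈ G.Plays)
    {k : ℕ} (hσ : ∀ j < k, (ρ j).act₁ = σ (G.view₁.obsList (histOf ρ j)))
    (hT : ∀ i ≤ k, (ρ i).state ∉ T) :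
    G.Reachable T σ (G.view₁.obsList (histOf ρ k)) (ρ k).state := by
  induction k with
  | zero =>
    rw [View.obsList_histOf_zero, hρ.1]
    exact .init (hρ.1 ▸ hT 0 le_rfl)
  | succ k ih =>
    rw [View.obsList_histOf_succ]
    refine .step (b := (ρ k).act₂) (ih (fun j hj => hσ j (by omega)) fun i hi => hT i (by omega))
      ?_ (hT _ le_rfl)
    rw [← hσ k (by omega)]
    exact (hρ.2 k).ne'

/-- For each list of observations that occurs, the value at any representative prefix serves; other
lists get a default action. -/
theorem exists_obsList_strategy [Nonempty A₁] (hG : G.view₁.ActionsInvisible)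
    {σ : Hist Q A₁ A₂ → A₁} (hσ : G.ObservationBased G.view₁ σ) :
    ∃ σ' : List G.view₁.Obs → A₁, ∀ h ∈ G.Prefs, σ h = σ' (G.view₁.obsList h) := by
  classical
  refine ⟨fun η => if h : ∃ h ∈ G.Prefs, G.view₁.obsList h = η then σ h.choose else
    Classical.arbitrary _, fun h hh => ?_⟩
  have hex : ∃ h' ∈ G.Prefs, G.view₁.obsList h' = G.view₁.obsList h := ⟨h, hh, rfl⟩
  simp only [hex, dif_pos]
  refine hσ h hh _ hex.choose_spec.1 ?_
  rw [View.indist_iff_obsList hG]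
  exact hex.choose_spec.2.symm

theorem observationBased_obsList (hG : G.view₁.ActionsInvisible) (σ : List G.view₁.Obs → A₁) :
    G.ObservationBased G.view₁ fun h => σ (G.view₁.obsList h) := by
  intro h _ h' _ hi
  rw [View.indist_iff_obsList hG] at hi
  simp only [hi]

section Prob

variable [Finite Q] [Finite A₁] [Finite A₂]

/-- If `T` cannot be reached with positive probability from some reachable state, then player 2 has
a counter-strategy. -/
theorem exists_counter_strategy [Nonempty A₁] [Nonempty A₂] {σ : Hist Q A₁ A₂ → A₁}
    {σ' : List G.view₁.Obs → A₁} (hσ : ∀ h ∈ G.Prefs, σ h = σ' (G.view₁.obsList h))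
    {η : List G.view₁.Obs} {q : Q} (hr : G.Reachable T σ' η q)
    (hn : ¬ ∃ n, G.ReachRank T σ' n η q) :
    ∃ π : Hist Q A₁ A₂ → PMF A₂, G.law (fun h => PMF.pure (σ h)) π (Reach T) < 1 ∧
      (η.length = 1 → G.law (fun h => PMF.pure (σ h)) π (Reach T) = 0) := by
  classical
  obtain ⟨ρ₀, hρ₀, k, h1, h2, h3, h4⟩ := hr.exists_play
  have hb : ∀ (η : List G.view₁.Obs) (q : Q), ∃ b, (¬ ∃ n, G.ReachRank T σ' n η q) →
      ∀ q' ∈ (G.δ q (σ' η) b).support,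
      q' ∉ T ∧ ¬ ∃ n, G.ReachRank T σ' n (η ++ [G.view₁.obs q']) q' := by
    intro η q
    by_cases h : ∃ n, G.ReachRank T σ' n η q
    · exact ⟨Classical.arbitrary _, fun h' => (h' h).elim⟩
    · obtain ⟨b, hb⟩ := exists_avoiding_action h
      exact ⟨b, fun _ => hb⟩
  choose β hβ using hb
  -- Player 2 replays `ρ₀` for `k` rounds, which reaches the unranked situation with positive
  -- probability, and avoids ranked and target successors from then on.
  let π : Hist Q A₁ A₂ → PMF A₂ := fun h =>
    if h.past.length < k then PMF.pure (ρ₀ h.past.length).act₂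
    else PMF.pure (β (G.view₁.obsList h) h.last)
  let E : Set (ℕ → Round Q A₁ A₂) := {ρ | (∀ i < k, ρ i = ρ₀ i) ∧ (ρ k).state = (ρ₀ k).state}
  have hpre : ∀ ρ ∈ G.Plays, ∀ j, σ (histOf ρ j) = σ' (G.view₁.obsList (histOf ρ j)) :=
    fun ρ hρ j => hσ _ ⟨ρ, hρ, j, rfl⟩
  have hE : 0 < G.law (fun h => PMF.pure (σ h)) π E ∧
      (k = 0 → G.law (fun h => PMF.pure (σ h)) π E = 1) := by
    have hzero : k = 0 → G.law (fun h => PMF.pure (σ h)) π E = 1 := by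
      rintro rfl
      rw [← prob_compl_eq_zero_iff₀ (by
        refine MeasurableSet.nullMeasurableSet ?_
        have : E = {ρ | ρ 0 ∈ {r | r.state = (ρ₀ 0).state}} := by
          ext ρ; simp [E]
        rw [this]
        exact measurableSet_round 0 _)]
      change ∀ᵐ ρ ∂_, ρ ∈ E
      filter_upwards [G.ae_initial (fun h => PMF.pure (σ h)) π] with ρ hρ
      exact ⟨by simp, by rw [hρ.1, hρ₀.1]⟩
    refine ⟨?_, hzero⟩
    cases k with
    | zero => simp [hzero rfl]
    | succ n =>
      have hEe : E = agree ρ₀ n ∩ {ρ | (ρ (n + 1)).state = (ρ₀ (n + 1)).state} := by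
        ext ρ
        simp only [E, agree, Set.mem_inter_iff, Set.mem_ofPred_eq, Nat.lt_succ_iff]
      rw [hEe, law_agree_inter_state]
      refine ENNReal.mul_pos (G.law_agree_pos _ _ hρ₀ n fun i hi => ?_).ne' (hρ₀.2 n).ne'
      simp only [PMF.support_pure, Set.mem_singleton_iff, π, histOf_past_length,
        (by omega : i < n + 1), if_true, and_true]
      rw [hpre _ hρ₀, h1 i (by omega)]
  have hEm : MeasurableSet E := by
    have : E = (⋂ i, ⋂ (_ : i < k), {ρ | ρ i ∈ ({ρ₀ i} : Set (Round Q A₁ A₂))}) ∩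
        {ρ | ρ k ∈ {r | r.state = (ρ₀ k).state}} := by
      ext ρ; simp [E]
    rw [this]
    exact (MeasurableSet.iInter fun i => MeasurableSet.iInter fun _ =>
      measurableSet_round i _).inter (measurableSet_round k _)
  -- On `E` the play misses `T` up to round `k`, and "outside `T` and without rank" is invariant
  -- afterwards. Hence almost every play that visits `T` lies outside `E`.
  have hle : G.law (fun h => PMF.pure (σ h)) π (Reach T) ≤
      G.law (fun h => PMF.pure (σ h)) π Eᶜ := by
    refine measure_mono_ae ?_
    filter_upwards [G.ae_play (fun h => PMF.pure (σ h)) π] with ρ hρ hR hρE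
    obtain ⟨hρ, hc⟩ := hρ
    simp only [PMF.support_pure, Set.mem_singleton_iff] at hc
    have inv : ∀ j, k ≤ j → (ρ j).state ∉ T ∧
        ¬ ∃ n, G.ReachRank T σ' n (G.view₁.obsList (histOf ρ j)) (ρ j).state := by
      intro j hj
      induction j, hj using Nat.le_induction with
      | base =>
        rw [hρE.2, histOf_congr hρE.1 hρE.2, h3]
        exact ⟨h2 k le_rfl, h4 ▸ hn⟩
      | succ j hj ih =>
        rw [View.obsList_histOf_succ]
        refine hβ _ _ ih.2 _ ?_
        have hp := hρ.2 j
        have ha2 := (hc j).2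
        simp only [π, histOf_past_length, if_neg (not_lt.mpr hj), PMF.support_pure,
          Set.mem_singleton_iff, histOf_last] at ha2
        rw [ha2, (hc j).1, hpre ρ hρ] at hp
        exact hp.ne'
    obtain ⟨i, hi⟩ := hR
    rcases Nat.lt_or_ge i k with hik | hik
    · rw [hρE.1 i hik] at hi
      exact h2 i hik.le hi
    · exact (inv i hik).1 hi
  rw [prob_compl_eq_one_sub hEm] at hle
  refine ⟨π, hle.trans_lt (ENNReal.sub_lt_self ENNReal.one_ne_top one_ne_zero hE.1.ne'), ?_⟩
  intro hlen
  -- With a single observation there is nothing to replay: `E` only fixes the initial state and has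
  -- probability one.
  have hk : k = 0 := by
    have := congrArg List.length h3
    rw [hlen] at this
    simpa [View.obsList] using this
  rw [hE.2 hk, tsub_self] at hle
  exact le_antisymm hle zero_le

theorem PureAlmostSureWinning.exists_reachRank [Nonempty A₁] [Nonempty A₂] (hG : G.OneSided)
    (h : G.PureAlmostSureWinning (Reach T)) :
    ∃ σ : List G.view₁.Obs → A₁, ∀ η q, G.Reachable T σ η q → ∃ n, G.ReachRank T σ n η q := by
  obtain ⟨σ, hσ, hw⟩ := h
  obtain ⟨σ', hσ'⟩ := exists_obsList_strategy hG.1 hσ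
  refine ⟨σ', fun η q hr => ?_⟩
  by_contra hn
  obtain ⟨π, hπ, -⟩ := exists_counter_strategy hσ' hr hn
  exact hπ.ne (hw π (G.observationBased_of_perfect hG.2 π))

theorem PurePositiveWinning.exists_reachRank [Nonempty A₁] [Nonempty A₂] (hG : G.OneSided)
    (h : G.PurePositiveWinning (Reach T)) (hT : G.init ∉ T) :
    ∃ (σ : List G.view₁.Obs → A₁) (n : ℕ), G.ReachRank T σ n [G.view₁.obs G.init] G.init := by
  obtain ⟨σ, hσ, hw⟩ := h
  obtain ⟨σ', hσ'⟩ := exists_obsList_strategy hG.1 hσ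
  refine ⟨σ', ?_⟩
  by_contra hn
  obtain ⟨π, -, hπ⟩ := exists_counter_strategy hσ' (.init hT) hn
  exact (hw π (G.observationBased_of_perfect hG.2 π)).ne' (hπ rfl)

end Prob

end StochGame

/-! ### From ranks to probabilities. -/

namespace StochGame

open MeasureTheory ProbabilityTheory

/-- A common lower bound for conditional probabilities passes from the pieces of a partition to
their union. -/
theorem mul_measure_iUnion_le {Ω ι : Type*} [MeasurableSpace Ω] [Countable ι] (μ : Measure Ω)
    {A : ι → Set Ω} (hd : Pairwise (Function.onFun Disjoint A)) (hA : ∀ i, MeasurableSet (A i))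
    {H : Set Ω} (hH : MeasurableSet H) {c : ENNReal} (h : ∀ i, c * μ (A i) ≤ μ (A i ∩ H)) :
    c * μ (⋃ i, A i) ≤ μ ((⋃ i, A i) ∩ H) := by
  rw [measure_iUnion hd hA, Set.iUnion_inter, measure_iUnion
    (fun i j hij => (hd hij).mono Set.inter_subset_left Set.inter_subset_left)
    (fun i => (hA i).inter hH), ← ENNReal.tsum_mul_left]
  exact ENNReal.tsum_le_tsum h

variable {Q A₁ A₂ : Type*} {G : StochGame Q A₁ A₂} {T : Set Q}

/-- The plays that visit `T` in round `N` at the latest. -/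
def reachBy (T : Set Q) (N : ℕ) : Set (ℕ → Round Q A₁ A₂) := {ρ | ∃ i ≤ N, (ρ i).state ∈ T}

theorem measurableSet_reachBy (T : Set Q) (N : ℕ) [Finite Q] [Finite A₁] [Finite A₂] :
    MeasurableSet (reachBy (A₁ := A₁) (A₂ := A₂) T N) := by
  have : reachBy (A₁ := A₁) (A₂ := A₂) T N =
      ⋃ i, ⋃ (_ : i ≤ N), {ρ | ρ i ∈ {r | r.state ∈ T}} := by
    ext ρ
    simp [reachBy]
  rw [this]
  exact MeasurableSet.iUnion fun i => MeasurableSet.iUnion fun _ => measurableSet_round i _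

theorem reachBy_subset_reach (T : Set Q) (N : ℕ) :
    reachBy (A₁ := A₁) (A₂ := A₂) T N ⊆ Reach T := fun _ ⟨i, _, hi⟩ => ⟨i, hi⟩

theorem reachBy_mono (T : Set Q) {N M : ℕ} (h : N ≤ M) :
    reachBy (A₁ := A₁) (A₂ := A₂) T N ⊆ reachBy T M :=
  fun _ ⟨i, hi, hT⟩ => ⟨i, hi.trans h, hT⟩

/-- The prefix of length `n + 1` of a play and the next state, as a union over the next round. -/
theorem agree_inter_state_eq (ρ₀ : ℕ → Round Q A₁ A₂) (n : ℕ) (q : Q) :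
    agree ρ₀ n ∩ {ρ | (ρ (n + 1)).state = q} =
      ⋃ r : {r : Round Q A₁ A₂ // r.state = q}, agree (Function.update ρ₀ (n + 1) r.1) (n + 1) := by
  ext ρ
  simp only [agree, Set.mem_inter_iff, Set.mem_ofPred_eq, Set.mem_iUnion]
  constructor
  · rintro ⟨h, h'⟩
    refine ⟨⟨ρ (n + 1), h'⟩, fun i hi => ?_⟩
    rcases hi.lt_or_eq with hi | rfl
    · rw [Function.update_of_ne hi.ne]
      exact h i (by omega)
    · simp
  · rintro ⟨r, h⟩
    refine ⟨fun i hi => ?_, ?_⟩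
    · rw [h i (by omega), Function.update_of_ne (by omega)]
    · rw [h _ le_rfl, Function.update_self]
      exact r.2

section Prob

variable [Finite Q] [Finite A₁] [Finite A₂]

variable (G) in
theorem exists_min_prob : ∃ ε : ENNReal, 0 < ε ∧ ε ≤ 1 ∧
    ∀ q a b q', q' ∈ (G.δ q a b).support → ε ≤ G.δ q a b q' := by
  classical
  rcases isEmpty_or_nonempty (Q × A₁ × A₂ × Q) with he | he
  · exact ⟨1, one_pos, le_rfl, fun q a b q' _ => (he.false (q, a, b, q')).elim⟩
  -- Replacing zeros by 1 makes the minimum positive and at most 1 without affecting the support.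
  let f : Q × A₁ × A₂ × Q → ENNReal := fun x =>
    if G.δ x.1 x.2.1 x.2.2.1 x.2.2.2 = 0 then 1 else G.δ x.1 x.2.1 x.2.2.1 x.2.2.2
  obtain ⟨x, hx⟩ := Finite.exists_min f
  refine ⟨f x, ?_, ?_, fun q a b q' h => ?_⟩
  · simp only [f]
    split_ifs with h
    · exact one_pos
    · exact pos_iff_ne_zero.mpr h
  · simp only [f]
    split_ifs
    · exact le_rfl
    · exact PMF.coe_le_one _ _
  · have := hx (q, a, b, q')
    simp only [f] at this ⊢
    rwa [if_neg h] at this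

theorem exists_play_of_law_agree_ne_zero {σ : Hist Q A₁ A₂ → A₁} {π : Hist Q A₁ A₂ → PMF A₂}
    {ρ₀ : ℕ → Round Q A₁ A₂} {m : ℕ}
    (h : G.law (fun h => PMF.pure (σ h)) π (agree ρ₀ m) ≠ 0) :
    ∃ ρ ∈ agree ρ₀ m, ρ ∈ G.Plays ∧ ∀ j, (ρ j).act₁ = σ (histOf ρ j) := by
  by_contra! hc
  apply h
  refine measure_mono_null ?_ (ae_iff.mp (G.ae_play (fun h => PMF.pure (σ h)) π))
  rintro ρ hρ ⟨h1, h2⟩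
  obtain ⟨j, hj⟩ := hc ρ hρ h1
  apply hj
  simpa using (h2 j).1

theorem histOf_eq_of_agree {ρ ρ₀ : ℕ → Round Q A₁ A₂} {m : ℕ} (h : ρ ∈ agree ρ₀ m) :
    histOf ρ m = histOf ρ₀ m :=
  histOf_congr (fun i hi => h i hi.le) (by rw [h m le_rfl])

/-- Each round moves to the successor promised by the rank with conditional probability at least
`ε`, whatever action player 2 has drawn. -/
theorem law_agree_reachBy {ε : ENNReal} (hε : ∀ q a b q', q' ∈ (G.δ q a b).support →
      ε ≤ G.δ q a b q') (hε1 : ε ≤ 1) (σ : List G.view₁.Obs → A₁) (π : Hist Q A₁ A₂ → PMF A₂)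
    (n : ℕ) (ρ₀ : ℕ → Round Q A₁ A₂) (m : ℕ)
    (h : G.ReachRank T σ n (G.view₁.obsList (histOf ρ₀ m)) (ρ₀ m).state) :
    ε ^ n * G.law (fun h => PMF.pure (σ (G.view₁.obsList h))) π (agree ρ₀ m) ≤
      G.law (fun h => PMF.pure (σ (G.view₁.obsList h))) π (agree ρ₀ m ∩ reachBy T (m + n)) := by
  induction n generalizing ρ₀ m with
  | zero => exact h.elim
  | succ n ih =>
    -- A cylinder of positive measure contains a play compatible with `σ`, which forces the action
    -- of player 1 in round `m` of `ρ₀` to be the one the rank speaks of.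
    by_cases hz : G.law (fun h => PMF.pure (σ (G.view₁.obsList h))) π (agree ρ₀ m) = 0
    · simp [hz]
    obtain ⟨ρ, hρ, -, hc⟩ := exists_play_of_law_agree_ne_zero
      (σ := fun h => σ (G.view₁.obsList h)) hz
    have ha : (ρ₀ m).act₁ = σ (G.view₁.obsList (histOf ρ₀ m)) := by
      rw [← hρ m le_rfl, hc m, histOf_eq_of_agree hρ]
    obtain ⟨q', hq', h'⟩ := h (ρ₀ m).act₂
    rw [← ha] at hq'
    have h1 : ε * G.law (fun h => PMF.pure (σ (G.view₁.obsList h))) π (agree ρ₀ m) ≤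
        G.law (fun h => PMF.pure (σ (G.view₁.obsList h))) π
          (agree ρ₀ m ∩ {ρ | (ρ (m + 1)).state = q'}) := by
      rw [law_agree_inter_state, mul_comm]
      gcongr
      exact hε _ _ _ _ hq'
    have h2 : ε ^ n * G.law (fun h => PMF.pure (σ (G.view₁.obsList h))) π
        (agree ρ₀ m ∩ {ρ | (ρ (m + 1)).state = q'}) ≤
        G.law (fun h => PMF.pure (σ (G.view₁.obsList h))) π
          ((agree ρ₀ m ∩ {ρ | (ρ (m + 1)).state = q'}) ∩ reachBy T (m + (n + 1))) := by
      by_cases hT : q' ∈ T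
      · refine (mul_le_of_le_one_left' (pow_le_one' hε1 n)).trans
          (measure_mono (Set.subset_inter subset_rfl ?_))
        rintro ρ ⟨-, hρ⟩
        have hρ : (ρ (m + 1)).state = q' := hρ
        exact ⟨m + 1, by omega, hρ ▸ hT⟩
      · have h' := h'.resolve_left hT
        -- The event fixes the next state but not the next actions, so it is cut into cylinders
        -- before the induction hypothesis applies.
        rw [agree_inter_state_eq]
        refine mul_measure_iUnion_le _ ?_ (fun r => measurableSet_agree _ _)
          (measurableSet_reachBy _ _) fun r => ?_
        · intro r r' hr
          refine Set.disjoint_left.mpr fun ρ h1 h2 => hr (Subtype.ext ?_)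
          have e1 := h1 (m + 1) le_rfl
          have e2 := h2 (m + 1) le_rfl
          rw [Function.update_self] at e1 e2
          rw [← e1, ← e2]
        · rw [show m + (n + 1) = m + 1 + n by omega]
          refine ih _ _ ?_
          rw [View.obsList_histOf_succ, Function.update_self, r.2,
            histOf_congr (ρ' := ρ₀) (fun i hi => Function.update_of_ne (by omega) _ _)
              (by rw [Function.update_of_ne (by omega)])]
          exact h'
    calc _ = ε ^ n * (ε * G.law (fun h => PMF.pure (σ (G.view₁.obsList h))) π (agree ρ₀ m)) := by
          rw [pow_succ, mul_assoc]
      _ ≤ _ := by gcongr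
      _ ≤ _ := h2
      _ ≤ _ := measure_mono (Set.inter_subset_inter_left _ Set.inter_subset_left)

theorem purePositiveWinning_of_reachRank (hG : G.OneSided) (σ : List G.view₁.Obs → A₁) (n : ℕ)
    (h : G.ReachRank T σ n [G.view₁.obs G.init] G.init) : G.PurePositiveWinning (Reach T) := by
  refine ⟨_, observationBased_obsList hG.1 σ, fun π _ => ?_⟩
  obtain ⟨ε, hε, hε1, hδ⟩ := G.exists_min_prob
  -- The countably many cylinders of a first round at the initial state cover almost everything, so
  -- one of them has positive measure.
  have hex : ∃ r : Round Q A₁ A₂, r.state = G.init ∧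
      0 < G.law (fun h => PMF.pure (σ (G.view₁.obsList h))) π (agree (fun _ => r) 0) := by
    by_contra! hc
    have hU : Set.univ ⊆ (⋃ r : {r : Round Q A₁ A₂ // r.state = G.init}, agree (fun _ => r.1) 0) ∪
        {ρ | ¬ ((ρ 0).state = G.init ∧
          (ρ 0).act₁ ∈ (PMF.pure (σ (G.view₁.obsList (histOf ρ 0)))).support ∧
          (ρ 0).act₂ ∈ (π (histOf ρ 0)).support)} := by
      intro ρ _
      by_cases hρ : (ρ 0).state = G.init
      · left
        refine Set.mem_iUnion.mpr ⟨⟨ρ 0, hρ⟩, fun i hi => ?_⟩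
        obtain rfl : i = 0 := by omega
        rfl
      · exact Or.inr fun h => hρ h.1
    have hz := measure_mono_null hU (measure_union_null
      (measure_iUnion_null fun r => le_antisymm (hc r.1 r.2) zero_le)
      (ae_iff.mp (G.ae_initial (fun h => PMF.pure (σ (G.view₁.obsList h))) π)))
    rw [measure_univ] at hz
    exact one_ne_zero hz
  obtain ⟨r, hr, hpos⟩ := hex
  have h1 := law_agree_reachBy hδ hε1 σ π n (fun _ => r) 0 (by
    rw [View.obsList_histOf_zero, hr]
    exact h)
  refine lt_of_lt_of_le ?_ (h1.trans (measure_mono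
    (Set.inter_subset_right.trans (reachBy_subset_reach T _))))
  exact ENNReal.mul_pos (ENNReal.pow_pos hε n).ne' hpos.ne'

theorem law_reach_eq_one_of_init_mem (h : G.init ∈ T) (σ : Hist Q A₁ A₂ → PMF A₁)
    (π : Hist Q A₁ A₂ → PMF A₂) : G.law σ π (Reach T) = 1 := by
  rw [← prob_compl_eq_zero_iff (measurableSet_reach T)]
  change ∀ᵐ ρ ∂_, ρ ∈ Reach T
  filter_upwards [G.ae_initial σ π] with ρ hρ
  exact ⟨0, hρ.1 ▸ h⟩

theorem compl_reachBy_eq [Nonempty (Round Q A₁ A₂)] (T : Set Q) (m : ℕ) :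
    (reachBy (A₁ := A₁) (A₂ := A₂) T m)ᶜ =
      ⋃ x : {x : (i : Finset.Iic m) → Round Q A₁ A₂ // ∀ i, (x i).state ∉ T},
        agree (fun i => if h : i ≤ m then x.1 ⟨i, Finset.mem_Iic.mpr h⟩ else
          Classical.arbitrary _) m := by
  ext ρ
  simp only [reachBy, Set.mem_compl_iff, Set.mem_ofPred_eq, not_exists, not_and, Set.mem_iUnion]
  constructor
  · intro h
    refine ⟨⟨fun i => ρ i, fun i => h i (Finset.mem_Iic.mp i.2)⟩, fun i hi => ?_⟩
    simp [hi]
  · rintro ⟨x, hx⟩ i hi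
    rw [hx i hi]
    simp only [hi, dif_pos]
    exact x.2 _

/-- As long as `T` has not been visited the situation is reachable, so each block of `N` rounds
succeeds with conditional probability at least `ε ^ N`. The bound must be uniform for the failures
to decay geometrically. -/
theorem pureAlmostSureWinning_of_reachRank (hG : G.OneSided) (σ : List G.view₁.Obs → A₁) (N : ℕ)
    (h : ∀ η q, G.Reachable T σ η q → G.ReachRank T σ N η q) :
    G.PureAlmostSureWinning (Reach T) := by
  refine ⟨_, observationBased_obsList hG.1 σ, fun π _ => ?_⟩
  obtain ⟨ε, hε, hε1, hδ⟩ := G.exists_min_prob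
  set μ := G.law (fun h => PMF.pure (σ (G.view₁.obsList h))) π with hμ
  have hne : Nonempty (Round Q A₁ A₂) := by
    by_contra hc
    rw [not_nonempty_iff] at hc
    have : IsEmpty (ℕ → Round Q A₁ A₂) := ⟨fun ρ => hc.false (ρ 0)⟩
    have h1 : μ Set.univ = 1 := measure_univ
    rw [Set.eq_empty_of_isEmpty (Set.univ : Set (ℕ → Round Q A₁ A₂)), measure_empty] at h1
    exact zero_ne_one h1
  have hstep : ∀ m, μ (reachBy T (m + N))ᶜ ≤ (1 - ε ^ N) * μ (reachBy T m)ᶜ := by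
    intro m
    have h1 : ε ^ N * μ (reachBy T m)ᶜ ≤ μ ((reachBy T m)ᶜ ∩ reachBy T (m + N)) := by
      rw [compl_reachBy_eq]
      refine mul_measure_iUnion_le _ ?_ (fun r => measurableSet_agree _ _)
        (measurableSet_reachBy _ _) fun x => ?_
      · intro x x' hx
        refine Set.disjoint_left.mpr fun ρ h1 h2 => hx (Subtype.ext (funext fun i => ?_))
        have e1 := h1 i (Finset.mem_Iic.mp i.2)
        have e2 := h2 i (Finset.mem_Iic.mp i.2)
        simp only [Finset.mem_Iic.mp i.2, dif_pos] at e1 e2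
        rw [← e1, ← e2]
      · set ρ₀ : ℕ → Round Q A₁ A₂ := fun i =>
          if h : i ≤ m then x.1 ⟨i, Finset.mem_Iic.mpr h⟩ else Classical.arbitrary _ with hρ₀
        by_cases hz : μ (agree ρ₀ m) = 0
        · simp [hz]
        obtain ⟨ρ, hρ, hp, hc⟩ := exists_play_of_law_agree_ne_zero
          (σ := fun h => σ (G.view₁.obsList h)) hz
        refine law_agree_reachBy hδ hε1 σ π N ρ₀ m ?_
        rw [← histOf_eq_of_agree hρ, ← hρ m le_rfl]
        refine h _ _ (reachable_of_play hp (fun j _ => hc j) fun i hi => ?_)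
        rw [hρ i hi]
        simp only [hρ₀, hi, dif_pos]
        exact x.2 _
    have h2 : μ (reachBy T (m + N))ᶜ + μ ((reachBy T m)ᶜ ∩ reachBy T (m + N)) =
        μ (reachBy T m)ᶜ := by
      rw [← measure_inter_add_sdiff (reachBy T m)ᶜ (measurableSet_reachBy T (m + N)), add_comm]
      congr 2
      ext ρ
      simp only [Set.mem_compl_iff, Set.mem_sdiff]
      exact ⟨fun h => ⟨fun h' => h (reachBy_mono T (by omega) h'), h⟩, fun h => h.2⟩
    have hfin : ε ^ N * μ (reachBy T m)ᶜ ≠ ⊤ :=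
      ENNReal.mul_ne_top (ENNReal.pow_ne_top (hε1.trans_lt ENNReal.one_lt_top).ne)
        (measure_ne_top _ _)
    rw [ENNReal.sub_mul (fun _ _ => measure_ne_top _ _), one_mul]
    refine ENNReal.le_sub_of_add_le_right hfin ?_
    rw [← h2]
    gcongr
    rw [h2]
    exact h1
  have hpow : ∀ j : ℕ, μ (Reach T)ᶜ ≤ (1 - ε ^ N) ^ j := by
    intro j
    refine (measure_mono (Set.compl_subset_compl.mpr (reachBy_subset_reach T (j * N)))).trans ?_
    induction j with
    | zero => simpa using prob_le_one
    | succ j ih =>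
      rw [Nat.succ_mul, pow_succ']
      exact (hstep _).trans (mul_le_mul_right ih _)
  have hlt : 1 - ε ^ N < 1 :=
    ENNReal.sub_lt_self ENNReal.one_ne_top one_ne_zero (ENNReal.pow_pos hε N).ne'
  have hlim := ENNReal.tendsto_pow_atTop_nhds_zero_of_lt_one hlt
  have hz : μ (Reach T)ᶜ = 0 :=
    le_antisymm (ge_of_tendsto' hlim hpow) zero_le
  rwa [prob_compl_eq_zero_iff (measurableSet_reach T)] at hz

end Prob

end StochGame

/-! ### Deterministic games of perfect observation: attractors and positional strategies. -/

namespace StochGame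

section Deterministic

variable {S A B : Type*} {H : StochGame S A B} {step : S → A → B → S}

theorem state_succ_of_deterministic (hδ : ∀ ℓ a b, H.δ ℓ a b = PMF.pure (step ℓ a b))
    {ρ : ℕ → Round S A B} (hρ : ρ ∈ H.Plays) (j : ℕ) :
    (ρ (j + 1)).state = step (ρ j).state (ρ j).act₁ (ρ j).act₂ := by
  have h := (hρ.2 j).ne'
  rw [hδ, ← PMF.mem_support_iff] at h
  simpa using h

theorem exists_compatible_play (hδ : ∀ ℓ a b, H.δ ℓ a b = PMF.pure (step ℓ a b))
    (τ : Hist S A B → A) (β : Hist S A B → B) :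
    ∃ ρ ∈ H.Plays, Compatible τ ρ ∧ ∀ j, (ρ j).act₂ = β (histOf ρ j) := by
  let h : ℕ → Hist S A B := fun k => Nat.rec ⟨[], H.init⟩
    (fun _ h => ⟨h.past ++ [⟨h.last, τ h, β h⟩], step h.last (τ h) (β h)⟩) k
  let ρ : ℕ → Round S A B := fun k => ⟨(h k).last, τ (h k), β (h k)⟩
  have hh : ∀ k, histOf ρ k = h k := by
    intro k
    induction k with
    | zero => simp [histOf, ρ, h]
    | succ k ih =>
      have h1 : (histOf ρ (k + 1)).past = (h (k + 1)).past := by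
        rw [histOf_succ_past, ih]
      have h2 : (histOf ρ (k + 1)).last = (h (k + 1)).last := rfl
      cases hx : histOf ρ (k + 1)
      cases hy : h (k + 1)
      rw [hx, hy] at h1 h2
      simp only at h1 h2
      rw [h1, h2]
  refine ⟨ρ, ⟨rfl, fun j => ?_⟩, fun j => ?_, fun j => ?_⟩
  · rw [hδ, pos_iff_ne_zero, ← PMF.mem_support_iff]
    simp only [PMF.support_pure, Set.mem_singleton_iff]
    rfl
  · rw [hh]
  · rw [hh]

/-- A compatible play can be continued after `k` rounds with any choices of player 2. -/
theorem exists_compatible_branch (hδ : ∀ ℓ a b, H.δ ℓ a b = PMF.pure (step ℓ a b))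
    {τ : Hist S A B → A} {ρ₀ : ℕ → Round S A B} (hρ₀ : ρ₀ ∈ H.Plays) (hc : Compatible τ ρ₀)
    (k : ℕ) (β : Hist S A B → B) :
    ∃ ρ ∈ H.Plays, Compatible τ ρ ∧ histOf ρ k = histOf ρ₀ k ∧
      ∀ j, k ≤ j → (ρ j).act₂ = β (histOf ρ j) := by
  -- The length of the history tells player 2 whether to copy `ρ₀` or to follow `β`.
  obtain ⟨ρ, hρ, h1, h2⟩ := exists_compatible_play hδ τ
    fun h => if h.past.length < k then (ρ₀ h.past.length).act₂ else β h
  have hst : ∀ j, j ≤ k → histOf ρ j = histOf ρ₀ j ∧ (ρ j).state = (ρ₀ j).state := by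
    intro j
    induction j with
    | zero =>
      intro _
      have : (ρ 0).state = (ρ₀ 0).state := by rw [hρ.1, hρ₀.1]
      exact ⟨histOf_congr (by simp) this, this⟩
    | succ j ih =>
      intro hj
      obtain ⟨e1, e2⟩ := ih (by omega)
      have ej : ρ j = ρ₀ j := by
        refine Round.ext e2 ?_ ?_
        · rw [h1 j, hc j, e1]
        · rw [h2 j, histOf_past_length, if_pos (by omega)]
      have : (ρ (j + 1)).state = (ρ₀ (j + 1)).state := by
        rw [state_succ_of_deterministic hδ hρ, state_succ_of_deterministic hδ hρ₀, ej]
      refine ⟨?_, this⟩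
      have hp : (histOf ρ (j + 1)).past = (histOf ρ₀ (j + 1)).past := by
        rw [histOf_succ_past, histOf_succ_past, e1, ej]
      have hl : (histOf ρ (j + 1)).last = (histOf ρ₀ (j + 1)).last := this
      cases hx : histOf ρ (j + 1)
      cases hy : histOf ρ₀ (j + 1)
      rw [hx, hy] at hp hl
      simp only at hp hl
      rw [hp, hl]
  refine ⟨ρ, hρ, h1, (hst k le_rfl).1, fun j hj => ?_⟩
  rw [h2 j, histOf_past_length, if_neg (not_lt.mpr hj)]

/-- Player 1 can reach `α` in at most `n` rounds without leaving `W` on the way. -/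
def Attr (step : S → A → B → S) (W α : Set S) : ℕ → S → Prop
  | 0, ℓ => ℓ ∈ α
  | n + 1, ℓ => ℓ ∈ α ∨ ∃ a, ∀ b, step ℓ a b ∈ W ∧ Attr step W α n (step ℓ a b)

variable {W α : Set S}

theorem Attr.succ {n : ℕ} {ℓ : S} (h : Attr step W α n ℓ) : Attr step W α (n + 1) ℓ := by
  induction n generalizing ℓ with
  | zero => exact Or.inl h
  | succ n ih => exact h.imp_right fun ⟨a, ha⟩ => ⟨a, fun b => ⟨(ha b).1, ih (ha b).2⟩⟩

theorem Attr.mono {n m : ℕ} (hnm : n ≤ m) {ℓ : S} (h : Attr step W α n ℓ) :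
    Attr step W α m ℓ := by
  induction m, hnm using Nat.le_induction with
  | base => exact h
  | succ m _ ih => exact ih.succ

/-- Finitely many answers of player 2 have a common bound on their ranks; hence ranks in `ℕ` suffice
even for infinite sets of states. -/
theorem exists_not_attr [Finite B] {ℓ : S} (h : ¬ ∃ n, Attr step W α n ℓ) (a : A)
    (ha : ∀ b, step ℓ a b ∈ W) : ∃ b, ¬ ∃ n, Attr step W α n (step ℓ a b) := by
  by_contra! hc
  choose f hf using hc
  obtain ⟨N, hN⟩ := Finite.exists_le f
  exact h ⟨N + 1, Or.inr ⟨a, fun b => ⟨ha b, (hf b).mono (hN b)⟩⟩⟩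

/-- Outside the attractor, player 2 can answer every move of `τ` by staying outside, provided that
all answers remain in `W`, which `τ` guarantees. -/
theorem exists_avoiding_play [Finite B] [Nonempty B]
    (hδ : ∀ ℓ a b, H.δ ℓ a b = PMF.pure (step ℓ a b))
    {τ : Hist S A B → A} (hW : ∀ ρ ∈ H.Plays, Compatible τ ρ → ∀ j, (ρ j).state ∈ W)
    {ρ₀ : ℕ → Round S A B} (hρ₀ : ρ₀ ∈ H.Plays) (hc : Compatible τ ρ₀) (k : ℕ)
    (hk : ¬ ∃ n, Attr step W α n (ρ₀ k).state) :
    ∃ ρ ∈ H.Plays, Compatible τ ρ ∧ ∀ j, k ≤ j → (ρ j).state ∉ α := by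
  have hb : ∀ ℓ a, ∃ b, (∃ b, ¬ ∃ n, Attr step W α n (step ℓ a b)) →
      ¬ ∃ n, Attr step W α n (step ℓ a b) := by
    intro ℓ a
    by_cases h : ∃ b, ¬ ∃ n, Attr step W α n (step ℓ a b)
    · exact ⟨h.choose, fun _ => h.choose_spec⟩
    · exact ⟨Classical.arbitrary _, fun h' => (h h').elim⟩
  choose β hβ using hb
  obtain ⟨ρ, hρ, h1, h2, h3⟩ := exists_compatible_branch hδ hρ₀ hc k fun h => β h.last (τ h)
  have inv : ∀ j, k ≤ j → ¬ ∃ n, Attr step W α n (ρ j).state := by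
    intro j hj
    induction j, hj using Nat.le_induction with
    | base =>
      have : (ρ k).state = (ρ₀ k).state := congrArg Hist.last h2
      rwa [this]
    | succ j hj ih =>
      rw [state_succ_of_deterministic hδ hρ, h3 j hj, h1 j]
      refine hβ _ _ (exists_not_attr ih _ fun b => ?_)
      -- Branching off with an arbitrary answer `b` gives another compatible play, so this successor
      -- too lies in `W`.
      obtain ⟨ρ', hρ', g1, g2, g3⟩ := exists_compatible_branch hδ hρ h1 j fun _ => b
      have := hW ρ' hρ' g1 (j + 1)
      rw [state_succ_of_deterministic hδ hρ', g3 j le_rfl, g1 j, g2] at this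
      have e : (ρ' j).state = (ρ j).state := congrArg Hist.last g2
      rwa [e] at this
  exact ⟨ρ, hρ, h1, fun j hj hα => inv j hj ⟨0, hα⟩⟩

/-- Ranks and positional choices for the attractor of `α`. -/
theorem exists_rank_of_attr [Nonempty A] :
    ∃ (f : S → A) (r : S → ℕ), ∀ ℓ, (∃ n, Attr step W α n ℓ) → ℓ ∉ α → ∀ b,
      step ℓ (f ℓ) b ∈ W ∧ (∃ n, Attr step W α n (step ℓ (f ℓ) b)) ∧
        r (step ℓ (f ℓ) b) < r ℓ := by
  classical
  let r : S → ℕ := fun ℓ => sInf {n | Attr step W α n ℓ}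
  have hex : ∀ ℓ, ∃ a, (∃ n, Attr step W α n ℓ) → ℓ ∉ α → ∀ b,
      step ℓ a b ∈ W ∧ (∃ n, Attr step W α n (step ℓ a b)) ∧ r (step ℓ a b) < r ℓ := by
    intro ℓ
    by_cases h : (∃ n, Attr step W α n ℓ) ∧ ℓ ∉ α
    · have hr : Attr step W α (r ℓ) ℓ := Nat.sInf_mem (s := {n | Attr step W α n ℓ}) h.1
      cases hn : r ℓ with
      | zero =>
        rw [hn] at hr
        exact (h.2 hr).elim
      | succ n =>
        rw [hn] at hr
        obtain ⟨a, ha⟩ := hr.resolve_left h.2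
        exact ⟨a, fun _ _ b => ⟨(ha b).1, ⟨n, (ha b).2⟩, Nat.lt_succ_of_le (Nat.sInf_le (ha b).2)⟩⟩
    · exact ⟨Classical.arbitrary _, fun h1 h2 => (h ⟨h1, h2⟩).elim⟩
  choose f hf using hex
  exact ⟨f, r, hf⟩

/-- If the initial state were outside the attractor of `α`, player 2 could avoid `α` against `τ`; so
the attractor itself serves as `W`. -/
theorem SureWinning.exists_rank_reach [Finite B] [Nonempty A] [Nonempty B]
    (hδ : ∀ ℓ a b, H.δ ℓ a b = PMF.pure (step ℓ a b)) (h : H.SureWinning (Reach α)) :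
    ∃ (f : S → A) (r : S → ℕ) (W : Set S), H.init ∈ W ∧
      ∀ ℓ ∈ W, ℓ ∉ α → ∀ b, step ℓ (f ℓ) b ∈ W ∧ r (step ℓ (f ℓ) b) < r ℓ := by
  obtain ⟨τ, -, hτ⟩ := h
  obtain ⟨f, r, hfr⟩ := exists_rank_of_attr (step := step) (W := Set.univ) (α := α)
  refine ⟨f, r, {ℓ | ∃ n, Attr step Set.univ α n ℓ}, ?_, fun ℓ hℓ hα b => (hfr ℓ hℓ hα b).2⟩
  by_contra hn
  obtain ⟨ρ₀, hρ₀, hc, -⟩ := exists_compatible_play hδ τ fun _ => Classical.arbitrary B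
  obtain ⟨ρ, hρ, h1, h2⟩ := exists_avoiding_play (W := Set.univ) (α := α) hδ
    (fun _ _ _ _ => trivial) hρ₀ hc 0 (by rw [hρ₀.1]; exact hn)
  obtain ⟨i, hi⟩ := hτ ρ hρ h1
  exact h2 i (Nat.zero_le i) hi

/-- Here `W` consists of the states on plays compatible with `τ`. Each of them is in the attractor
of `α` relative to `W`, since otherwise a compatible play would miss `α` from some point on. -/
theorem SureWinning.exists_rank_buchi [Finite B] [Nonempty A] [Nonempty B]
    (hδ : ∀ ℓ a b, H.δ ℓ a b = PMF.pure (step ℓ a b)) (h : H.SureWinning (Buchi α)) :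
    ∃ (f : S → A) (r : S → ℕ) (W : Set S), H.init ∈ W ∧
      ∀ ℓ ∈ W, ∀ b, step ℓ (f ℓ) b ∈ W ∧ (ℓ ∉ α → r (step ℓ (f ℓ) b) < r ℓ) := by
  classical
  obtain ⟨τ, -, hτ⟩ := h
  let W : Set S := {ℓ | ∃ ρ ∈ H.Plays, Compatible τ ρ ∧ ∃ j, (ρ j).state = ℓ}
  have hW : ∀ ρ ∈ H.Plays, Compatible τ ρ → ∀ j, (ρ j).state ∈ W :=
    fun ρ hρ hc j => ⟨ρ, hρ, hc, j, rfl⟩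
  obtain ⟨f, r, hfr⟩ := exists_rank_of_attr (step := step) (W := W) (α := α)
  have hA : ∀ ℓ ∈ W, ∃ n, Attr step W α n ℓ := by
    rintro ℓ ⟨ρ₀, hρ₀, hc, j, rfl⟩
    by_contra hn
    obtain ⟨ρ, hρ, h1, h2⟩ := exists_avoiding_play hδ hW hρ₀ hc j hn
    obtain ⟨i, hi, hi'⟩ := hτ ρ hρ h1 j
    exact h2 i hi hi'
  -- In accepting states no rank has to drop. It is enough to stay in `W`, for which an action of
  -- `τ` at a visit of the state is used.
  have hstay : ∀ ℓ, ∃ a, ℓ ∈ W → ∀ b, step ℓ a b ∈ W := by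
    intro ℓ
    by_cases hℓ : ℓ ∈ W
    · obtain ⟨ρ₀, hρ₀, hc, j, rfl⟩ := hℓ
      refine ⟨(ρ₀ j).act₁, fun _ b => ?_⟩
      obtain ⟨ρ, hρ, g1, g2, g3⟩ := exists_compatible_branch hδ hρ₀ hc j fun _ => b
      refine ⟨ρ, hρ, g1, j + 1, ?_⟩
      have e : (ρ j).state = (ρ₀ j).state := congrArg Hist.last g2
      rw [state_succ_of_deterministic hδ hρ, g3 j le_rfl, g1 j, g2, hc j, e]
    · exact ⟨Classical.arbitrary _, fun h => (hℓ h).elim⟩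
  choose g hg using hstay
  refine ⟨fun ℓ => if ℓ ∈ α then g ℓ else f ℓ, r, W, ?_, fun ℓ hℓ b => ?_⟩
  · obtain ⟨ρ₀, hρ₀, hc, -⟩ := exists_compatible_play hδ τ fun _ => Classical.arbitrary B
    exact ⟨ρ₀, hρ₀, hc, 0, hρ₀.1⟩
  · by_cases hα : ℓ ∈ α
    · simp only [hα, if_true, not_true_eq_false, false_implies, and_true]
      exact hg ℓ hℓ b
    · simp only [hα, if_false, not_false_eq_true, true_implies]
      exact ⟨(hfr ℓ (hA ℓ hℓ) hα b).1, (hfr ℓ (hA ℓ hℓ) hα b).2.2⟩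

end Deterministic

/-! ### From a ranked positional strategy in the belief game to ranks in the original game. -/

section Belief

variable {Q A₁ A₂ : Type*} {G : StochGame Q A₁ A₂} {T : Set Q}

theorem beliefStep_empty {o : Set Q} {h : o ⊆ ∅} (x : A₁ × Set Q) (γ : G.view₁.Obs) :
    G.beliefStep T (.pair ∅ o h) x γ = .pair ∅ o h := by
  simp [beliefStep]

theorem beliefStep_blocked {s o : Set Q} {h : o ⊆ s} {a : A₁} {u : Set Q} {γ : G.view₁.Obs}
    (hs : s.Nonempty) (hu : ¬ ∀ q ∈ o, ∀ b : A₂, ((G.δ q a b).support ∩ u).Nonempty) :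
    G.beliefStep T (.pair s o h) (a, u) γ = .lost₁ := by
  simp only [beliefStep, if_neg hs.ne_empty, if_pos hu]

theorem beliefStep_disjoint {s o : Set Q} {h : o ⊆ s} {a : A₁} {u : Set Q} {γ : G.view₁.Obs}
    (hs : s.Nonempty) (hu : ∀ q ∈ o, ∀ b : A₂, ((G.δ q a b).support ∩ u).Nonempty)
    (hp : ¬ (G.Post a s ∩ G.cls γ).Nonempty) :
    G.beliefStep T (.pair s o h) (a, u) γ = .lost₂ := by
  simp only [beliefStep, if_neg hs.ne_empty, if_neg (not_not.mpr hu), if_pos hp]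

theorem beliefStep_pair {s o : Set Q} {h : o ⊆ s} {a : A₁} {u : Set Q} {γ : G.view₁.Obs}
    (hs : s.Nonempty) (hu : ∀ q ∈ o, ∀ b : A₂, ((G.δ q a b).support ∩ u).Nonempty)
    (hp : (G.Post a s ∩ G.cls γ).Nonempty) :
    ∃ o' h', G.beliefStep T (.pair s o h) (a, u) γ = .pair ((G.Post a s ∩ G.cls γ) \ T) o' h' ∧
      (o = ∅ → o' = (G.Post a s ∩ G.cls γ) \ T) ∧
      (o ≠ ∅ → o' = (G.Post a o ∩ G.cls γ ∩ u) \ T) := by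
  simp only [beliefStep, if_neg hs.ne_empty, if_neg (not_not.mpr hu), if_neg (not_not.mpr hp)]
  by_cases ho : o = ∅
  · rw [if_pos ho]
    exact ⟨_, subset_rfl, rfl, fun _ => rfl, fun h => (h ho).elim⟩
  · rw [if_neg ho]
    exact ⟨_, Set.sdiff_subset_sdiff_left (Set.inter_subset_left.trans
      (Set.inter_subset_inter_left _ (G.Post_mono a h))), rfl, fun h => (ho h).elim, fun _ => rfl⟩

theorem pair_mem_accepting_iff {s o : Set Q} {h : o ⊆ s} :
    BeliefState.pair s o h ∈ BeliefState.accepting Q ↔ o = ∅ := by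
  constructor
  · rintro (⟨s', h', e⟩ | e)
    · cases e
      rfl
    · cases e
  · rintro rfl
    exact Or.inl ⟨s, h, rfl⟩

theorem lost₁_notMem_accepting : BeliefState.lost₁ ∉ BeliefState.accepting Q := by
  rintro (⟨s', h', e⟩ | e) <;> cases e

variable (G T) in
/-- The state of the belief game after the observations `η` if player 1 plays the positional
strategy `f`. -/
noncomputable def beliefAfter (f : BeliefState Q → A₁ × Set Q) (η : List G.view₁.Obs) :
    BeliefState Q :=
  η.tail.foldl (fun ℓ γ => G.beliefStep T ℓ (f ℓ) γ) (G.beliefInit T)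

/-- The list must be nonempty because its head, the observation of the initial state, is not a move
of player 2 and is dropped by `beliefAfter`. -/
theorem beliefAfter_append (f : BeliefState Q → A₁ × Set Q) {η : List G.view₁.Obs} (hη : η ≠ [])
    (γ : G.view₁.Obs) : G.beliefAfter T f (η ++ [γ]) =
      G.beliefStep T (G.beliefAfter T f η) (f (G.beliefAfter T f η)) γ := by
  rw [beliefAfter, List.tail_append_of_ne_nil hη, List.foldl_append]
  rfl

section Ranked

variable {f : BeliefState Q → A₁ × Set Q} {r : BeliefState Q → ℕ} {W : Set (BeliefState Q)}

/-- This state is absorbing and not accepting, so its rank would have to be smaller than itself. -/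
theorem lost₁_notMem_of_rank [Nonempty G.view₁.Obs]
    (hW : ∀ ℓ ∈ W, ℓ ∉ BeliefState.accepting Q → ∀ γ,
      G.beliefStep T ℓ (f ℓ) γ ∈ W ∧ r (G.beliefStep T ℓ (f ℓ) γ) < r ℓ) :
    BeliefState.lost₁ ∉ W := fun h =>
  lt_irrefl _ (hW _ h lost₁_notMem_accepting (Classical.arbitrary _)).2

/-- Since `.lost₁` is avoided, the witness contains a possible successor of `q` for each action of
player 2. Outside `T` this successor is in the next obligation set for its own observation, where
the rank is smaller. -/
theorem reachRank_of_mem_obligation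
    (hW : ∀ ℓ ∈ W, ℓ ∉ BeliefState.accepting Q → ∀ γ,
      G.beliefStep T ℓ (f ℓ) γ ∈ W ∧ r (G.beliefStep T ℓ (f ℓ) γ) < r ℓ)
    (n : ℕ) (η : List G.view₁.Obs) (hη : η ≠ []) {s o : Set Q} (h : o ⊆ s)
    (hℓ : G.beliefAfter T f η = .pair s o h) (hm : BeliefState.pair s o h ∈ W)
    (hr : r (.pair s o h) < n) {q : Q} (hq : q ∈ o) :
    G.ReachRank T (fun η => (f (G.beliefAfter T f η)).1) n η q := by
  have : Nonempty G.view₁.Obs := ⟨G.view₁.obs q⟩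
  have hlost := lost₁_notMem_of_rank hW
  induction n generalizing η s o q with
  | zero => omega
  | succ n ih =>
    intro b
    have ho : o ≠ ∅ := Set.Nonempty.ne_empty ⟨q, hq⟩
    have hacc : BeliefState.pair s o h ∉ BeliefState.accepting Q :=
      fun h' => ho (pair_mem_accepting_iff.mp h')
    have hnext := hW _ hm hacc
    rcases hf : f (.pair s o h) with ⟨a, u⟩
    rw [hf] at hnext
    have hs : s.Nonempty := ⟨q, h hq⟩
    have hu : ∀ q ∈ o, ∀ b : A₂, ((G.δ q a b).support ∩ u).Nonempty := by
      by_contra hu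
      have := (hnext (G.view₁.obs q)).1
      rw [beliefStep_blocked hs hu] at this
      exact hlost this
    obtain ⟨q', hq', hqu⟩ := hu q hq b
    refine ⟨q', by simpa only [hℓ, hf] using hq', ?_⟩
    by_cases hT : q' ∈ T
    · exact Or.inl hT
    right
    have hpost : q' ∈ G.Post a o := ⟨q, hq, b, hq'⟩
    have hcls : q' ∈ G.cls (G.view₁.obs q') := rfl
    obtain ⟨o', h', e, -, ho'⟩ := beliefStep_pair (T := T) (h := h) hs hu
      ⟨q', G.Post_mono a h hpost, hcls⟩
    have hn := hnext (G.view₁.obs q')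
    rw [e] at hn
    refine ih _ (by simp) h' ?_ hn.1 (by omega) ?_
    · rw [beliefAfter_append f hη, hℓ, hf, e]
    · rw [ho' ho]
      exact ⟨⟨⟨hpost, hcls⟩, hqu⟩, hT⟩

/-- The belief follows every possible successor outside `T`. The rank drops while obligations
remain, and an empty obligation set is refilled with the whole belief. -/
theorem beliefAfter_step
    (hW : ∀ ℓ ∈ W, ∀ γ, G.beliefStep T ℓ (f ℓ) γ ∈ W ∧
      (ℓ ∉ BeliefState.accepting Q → r (G.beliefStep T ℓ (f ℓ) γ) < r ℓ))
    (η : List G.view₁.Obs) (hη : η ≠ []) {s o : Set Q} {h : o ⊆ s}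
    (hℓ : G.beliefAfter T f η = .pair s o h) (hm : BeliefState.pair s o h ∈ W) {q q' : Q}
    (hq : q ∈ s) {b : A₂} (hq' : q' ∈ (G.δ q (f (.pair s o h)).1 b).support) (hT : q' ∉ T) :
    ∃ s' o', ∃ h' : o' ⊆ s', G.beliefAfter T f (η ++ [G.view₁.obs q']) = .pair s' o' h' ∧
      BeliefState.pair s' o' h' ∈ W ∧ q' ∈ s' ∧ (o = ∅ → o' = s') ∧
      (o ≠ ∅ → r (.pair s' o' h') < r (.pair s o h)) := by
  have : Nonempty G.view₁.Obs := ⟨G.view₁.obs q⟩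
  have hlost := lost₁_notMem_of_rank (f := f) (r := r) (W := W)
    fun ℓ hℓ hα γ => ⟨(hW ℓ hℓ γ).1, (hW ℓ hℓ γ).2 hα⟩
  have hnext := hW _ hm
  rcases hf : f (.pair s o h) with ⟨a, u⟩
  rw [hf] at hnext hq'
  have hs : s.Nonempty := ⟨q, hq⟩
  have hu : ∀ q ∈ o, ∀ b : A₂, ((G.δ q a b).support ∩ u).Nonempty := by
    by_contra hu
    have := (hnext (G.view₁.obs q)).1
    rw [beliefStep_blocked hs hu] at this
    exact hlost this
  have hpost : q' ∈ G.Post a s := ⟨q, hq, b, hq'⟩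
  have hcls : q' ∈ G.cls (G.view₁.obs q') := rfl
  obtain ⟨o', h', e, ho1, -⟩ := beliefStep_pair (T := T) (h := h) hs hu ⟨q', hpost, hcls⟩
  have hn := hnext (G.view₁.obs q')
  rw [e] at hn
  refine ⟨_, o', h', ?_, hn.1, ⟨⟨hpost, hcls⟩, hT⟩, ho1, fun ho => hn.2 fun h'' => ho
    (pair_mem_accepting_iff.mp h'')⟩
  rw [beliefAfter_append f hη, hℓ, hf, e]

/-- A state of the belief need not be an obligation. Following arbitrary successors, the target is
hit or the obligation set empties after at most `N` rounds; one round refills it, and the state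
reached is then an obligation of rank at most `N`. -/
theorem reachRank_of_mem_belief
    (hW : ∀ ℓ ∈ W, ∀ γ, G.beliefStep T ℓ (f ℓ) γ ∈ W ∧
      (ℓ ∉ BeliefState.accepting Q → r (G.beliefStep T ℓ (f ℓ) γ) < r ℓ))
    {N : ℕ} (hN : ∀ ℓ, r ℓ ≤ N) (η : List G.view₁.Obs) (hη : η ≠ [])
    {s o : Set Q} (h : o ⊆ s) (hℓ : G.beliefAfter T f η = .pair s o h)
    (hm : BeliefState.pair s o h ∈ W) {q : Q} (hq : q ∈ s) [Nonempty A₂] :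
    G.ReachRank T (fun η => (f (G.beliefAfter T f η)).1) (N + 2 + (N + 1)) η q := by
  have hobl := @reachRank_of_mem_obligation _ _ _ G T f r W
    fun ℓ hℓ hα γ => ⟨(hW ℓ hℓ γ).1, (hW ℓ hℓ γ).2 hα⟩
  have hempty : ∀ (η : List G.view₁.Obs), η ≠ [] → ∀ {s : Set Q} {h : ∅ ⊆ s},
      G.beliefAfter T f η = .pair s ∅ h → BeliefState.pair s ∅ h ∈ W → ∀ {q : Q}, q ∈ s →
      G.ReachRank T (fun η => (f (G.beliefAfter T f η)).1) (N + 2) η q := by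
    intro η hη s h hℓ hm q hq b
    obtain ⟨q', hq'⟩ := (G.δ q (f (.pair s ∅ h)).1 b).support_nonempty
    refine ⟨q', by simpa only [hℓ] using hq', ?_⟩
    by_cases hT : q' ∈ T
    · exact Or.inl hT
    obtain ⟨s', o', h', e, hm', hqs, ho, -⟩ := beliefAfter_step hW η hη hℓ hm hq hq' hT
    right
    refine hobl (N + 1) _ (by simp) h' e hm' (Nat.lt_succ_of_le (hN _)) ?_
    rwa [ho rfl]
  have hall : ∀ (n : ℕ) (η : List G.view₁.Obs), η ≠ [] → ∀ {s o : Set Q} {h : o ⊆ s},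
      G.beliefAfter T f η = .pair s o h → BeliefState.pair s o h ∈ W → r (.pair s o h) < n →
      ∀ {q : Q}, q ∈ s →
      G.ReachRank T (fun η => (f (G.beliefAfter T f η)).1) (N + 2 + n) η q := by
    intro n
    induction n with
    | zero =>
      intro η _ s o h _ _ hr
      omega
    | succ n ih =>
      intro η hη s o h hℓ hm hr q hq
      by_cases ho : o = ∅
      · subst ho
        exact (hempty η hη hℓ hm hq).mono (by omega)
      intro b
      obtain ⟨q', hq'⟩ := (G.δ q (f (.pair s o h)).1 b).support_nonempty
      refine ⟨q', by simpa only [hℓ] using hq', ?_⟩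
      by_cases hT : q' ∈ T
      · exact Or.inl hT
      obtain ⟨s', o', h', e, hm', hqs, -, hr'⟩ := beliefAfter_step hW η hη hℓ hm hq hq' hT
      right
      exact ih _ (by simp) e hm' (by have := hr' ho; omega) hqs
  exact hall (N + 1) η hη hℓ hm (Nat.lt_succ_of_le (hN _)) hq

/-- The belief contains every state compatible with the observations, so bounds for beliefs cover
all reachable situations. -/
theorem exists_belief_of_reachable
    (hW : ∀ ℓ ∈ W, ∀ γ, G.beliefStep T ℓ (f ℓ) γ ∈ W ∧
      (ℓ ∉ BeliefState.accepting Q → r (G.beliefStep T ℓ (f ℓ) γ) < r ℓ))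
    (hinit : G.beliefInit T ∈ W) {η : List G.view₁.Obs} {q : Q}
    (hr : G.Reachable T (fun η => (f (G.beliefAfter T f η)).1) η q) :
    η ≠ [] ∧ ∃ s o, ∃ h : o ⊆ s, G.beliefAfter T f η = .pair s o h ∧
      BeliefState.pair s o h ∈ W ∧ q ∈ s := by
  induction hr with
  | init h =>
    have e : G.beliefInit T = .pair {G.init} {G.init} subset_rfl := by
      rw [beliefInit, if_neg h]
    exact ⟨by simp, _, _, _, e, e ▸ hinit, rfl⟩
  | step _ hq hT ih =>
    obtain ⟨hη, s, o, h, e, hm, hqs⟩ := ih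
    simp only [e] at hq
    obtain ⟨s', o', h', e', hm', hqs', -⟩ := beliefAfter_step hW _ hη e hm hqs hq hT
    exact ⟨by simp, s', o', h', e', hm', hqs'⟩

end Ranked

end Belief

end StochGame

/-! ### The two equivalences: from ranks in the original game to strategies in the belief game. -/

namespace StochGame

variable {Q A₁ A₂ : Type*} {G : StochGame Q A₁ A₂} {T : Set Q}

instance [Finite Q] : Finite (BeliefState Q) := by
  refine Finite.of_injective (β := Set Q × Set Q × Fin 3)
    (fun ℓ => match ℓ with
      | .pair s o _ => (s, o, 0)
      | .lost₁ => (∅, ∅, 1)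
      | .lost₂ => (∅, ∅, 2)) ?_
  rintro (⟨s, o, h⟩ | _ | _) (⟨s', o', h'⟩ | _ | _) e
  all_goals simp_all

instance [Finite Q] : Finite G.view₁.Obs := Quotient.finite _

theorem pureAlmostSureWinning_of_buchi [Finite Q] [Finite A₁] [Finite A₂] [Nonempty A₁]
    [Nonempty A₂] (hG : G.OneSided)
    (h : (G.beliefGame T).SureWinning (Buchi (BeliefState.accepting Q))) :
    G.PureAlmostSureWinning (Reach T) := by
  have : Nonempty G.view₁.Obs := ⟨G.view₁.obs G.init⟩
  obtain ⟨f, r, W, hinit, hW⟩ := h.exists_rank_buchi (step := G.beliefStep T) fun _ _ _ => rfl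
  obtain ⟨N, hN⟩ := Finite.exists_le r
  refine pureAlmostSureWinning_of_reachRank hG (fun η => (f (G.beliefAfter T f η)).1)
    (N + 2 + (N + 1)) fun η q hr => ?_
  obtain ⟨hη, s, o, h, e, hm, hq⟩ := exists_belief_of_reachable hW hinit hr
  exact reachRank_of_mem_belief hW hN η hη h e hm hq

theorem purePositiveWinning_of_init_mem [Finite Q] [Finite A₁] [Finite A₂] [Nonempty A₁]
    (hG : G.OneSided) (h : G.init ∈ T) : G.PurePositiveWinning (Reach T) := by
  refine ⟨_, observationBased_obsList hG.1 fun _ => Classical.arbitrary A₁, fun π _ => ?_⟩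
  rw [law_reach_eq_one_of_init_mem h]
  exact one_pos

theorem purePositiveWinning_of_reach [Finite Q] [Finite A₁] [Finite A₂] [Nonempty A₁]
    (hG : G.OneSided)
    (h : (G.beliefGame T).SureWinning (Reach (BeliefState.accepting Q))) :
    G.PurePositiveWinning (Reach T) := by
  have : Nonempty G.view₁.Obs := ⟨G.view₁.obs G.init⟩
  by_cases hT : G.init ∈ T
  · exact purePositiveWinning_of_init_mem hG hT
  obtain ⟨f, r, W, hinit, hW⟩ := h.exists_rank_reach (step := G.beliefStep T) fun _ _ _ => rfl
  have e : G.beliefInit T = .pair {G.init} {G.init} subset_rfl := by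
    rw [beliefInit, if_neg hT]
  have hinit : G.beliefInit T ∈ W := hinit
  rw [e] at hinit
  exact purePositiveWinning_of_reachRank hG (fun η => (f (G.beliefAfter T f η)).1) _
    (reachRank_of_mem_obligation hW _ [G.view₁.obs G.init] (List.cons_ne_nil _ _) subset_rfl e
      hinit (Nat.lt_succ_self _) rfl)

section Strategy

variable (T) (σ : List G.view₁.Obs → A₁)

/-- The least number of rounds in which all states of `o` can reach `T`. -/
noncomputable def maxRank (η : List G.view₁.Obs) (o : Set Q) : ℕ :=
  sInf {n | ∀ q ∈ o, G.ReachRank T σ n η q}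

/-- The witness set for the states of smaller rank. -/
noncomputable def rankWitness (η : List G.view₁.Obs) : BeliefState Q → Set Q
  | .pair _ o _ => {q | q ∈ T ∨ G.ReachRank T σ (maxRank T σ η o - 1) (η ++ [G.view₁.obs q]) q}
  | _ => ∅

/-- The observations in the game `G` that correspond to a history of the belief game. -/
def beliefObs (h : Hist (BeliefState Q) (A₁ × Set Q) G.view₁.Obs) : List G.view₁.Obs :=
  G.view₁.obs G.init :: h.past.map Round.act₂

/-- The strategy in the belief game that plays like `σ` and decreases the ranks. -/
noncomputable def beliefStrategy (h : Hist (BeliefState Q) (A₁ × Set Q) G.view₁.Obs) :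
    A₁ × Set Q :=
  (σ (beliefObs h), rankWitness T σ (beliefObs h) h.last)

variable {T σ}

theorem beliefObs_succ (ρ : ℕ → Round (BeliefState Q) (A₁ × Set Q) G.view₁.Obs) (k : ℕ) :
    beliefObs (histOf ρ (k + 1)) = beliefObs (histOf ρ k) ++ [(ρ k).act₂] := by
  simp [beliefObs, histOf_succ_past]

/-- The infimum `maxRank` is attained and is nonzero when `o` has an element, since no state has
rank 0; so the predecessor in `rankWitness` is a genuine decrease, and player 1 is never blocked. -/
theorem nonempty_inter_rankWitness {η : List G.view₁.Obs} {s o : Set Q} {h : o ⊆ s} {n : ℕ}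
    (hn : ∀ q ∈ o, G.ReachRank T σ n η q) :
    ∀ q ∈ o, ∀ b : A₂, ((G.δ q (σ η) b).support ∩ rankWitness T σ η (.pair s o h)).Nonempty := by
  intro q hq b
  have hR : ∀ q ∈ o, G.ReachRank T σ (maxRank T σ η o) η q :=
    Nat.sInf_mem (s := {n | ∀ q ∈ o, G.ReachRank T σ n η q}) ⟨n, hn⟩
  have h1 := hR q hq
  rcases hm : maxRank T σ η o with _ | m
  · rw [hm] at h1
    exact h1.elim
  · rw [hm] at h1
    obtain ⟨q', hq', h'⟩ := h1 b
    refine ⟨q', hq', ?_⟩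
    simpa only [rankWitness, hm, Set.mem_ofPred_eq, Nat.add_sub_cancel] using h'

variable {ρ : ℕ → Round (BeliefState Q) (A₁ × Set Q) G.view₁.Obs}

/-- The next obligation set keeps only states of the witness set outside `T`, so the bound on its
ranks drops in every round; at 0 the set is empty. An impossible observation leads to `.lost₂`,
which is accepting. -/
theorem exists_accepting_of_reachRank (hρ : ρ ∈ (G.beliefGame T).Plays)
    (hc : Compatible (beliefStrategy T σ) ρ) (n k : ℕ) {s o : Set Q} {h : o ⊆ s}
    (hk : (ρ k).state = .pair s o h)
    (hn : ∀ q ∈ o, G.ReachRank T σ n (beliefObs (histOf ρ k)) q) :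
    ∃ j, k ≤ j ∧ (ρ j).state ∈ BeliefState.accepting Q := by
  induction n generalizing k s o with
  | zero =>
    refine ⟨k, le_rfl, ?_⟩
    rw [hk, pair_mem_accepting_iff]
    exact Set.eq_empty_of_forall_notMem fun q hq => hn q hq
  | succ n ih =>
    by_cases ho : o = ∅
    · exact ⟨k, le_rfl, by rw [hk, pair_mem_accepting_iff, ho]⟩
    have hs : s.Nonempty := (Set.nonempty_iff_ne_empty.mpr ho).mono h
    have hst : (ρ (k + 1)).state = G.beliefStep T (ρ k).state (ρ k).act₁ (ρ k).act₂ :=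
      state_succ_of_deterministic (fun _ _ _ => rfl) hρ k
    rw [hc k, beliefStrategy, histOf_last, hk] at hst
    have hu := nonempty_inter_rankWitness (s := s) (h := h) hn
    by_cases hp : (G.Post (σ (beliefObs (histOf ρ k))) s ∩ G.cls (ρ k).act₂).Nonempty
    · obtain ⟨o', h', e, -, ho'⟩ := beliefStep_pair (T := T) (h := h) hs hu hp
      rw [e] at hst
      obtain ⟨j, hj, hj'⟩ := ih (k + 1) hst fun q hq => by
        rw [ho' ho] at hq
        obtain ⟨⟨⟨-, hcls⟩, hqu⟩, hT⟩ := hq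
        have hqu := Or.resolve_left hqu hT
        have hcls : G.view₁.obs q = (ρ k).act₂ := hcls
        -- The announced observation is that of `q`, so the observation list built from the moves of
        -- player 2 is the one under which the rank of `q` was taken.
        rw [beliefObs_succ, ← hcls]
        refine hqu.mono ?_
        have : maxRank T σ (beliefObs (histOf ρ k)) o ≤ n + 1 := Nat.sInf_le hn
        omega
      exact ⟨j, by omega, hj'⟩
    · rw [beliefStep_disjoint hs hu hp] at hst
      exact ⟨k + 1, by omega, hst ▸ Or.inr rfl⟩

theorem exists_uniform_rank [Finite Q] {η : List G.view₁.Obs} {o : Set Q}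
    (h : ∀ q ∈ o, ∃ n, G.ReachRank T σ n η q) : ∃ n, ∀ q ∈ o, G.ReachRank T σ n η q := by
  choose! g hg using h
  obtain ⟨N, hN⟩ := Finite.exists_le g
  exact ⟨N, fun q hq => (hg q hq).mono (hN q)⟩

/-- Reachability of all belief states supplies ranks for all obligations, which in turn keeps the
witnesses valid and excludes `.lost₁`. -/
theorem belief_reachable [Finite Q] (hσ : ∀ η q, G.Reachable T σ η q → ∃ n, G.ReachRank T σ n η q)
    (hρ : ρ ∈ (G.beliefGame T).Plays) (hc : Compatible (beliefStrategy T σ) ρ) (k : ℕ) :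
    (ρ k).state = .lost₂ ∨ ∃ s o, ∃ h : o ⊆ s, (ρ k).state = .pair s o h ∧
      ∀ q ∈ s, G.Reachable T σ (beliefObs (histOf ρ k)) q := by
  induction k with
  | zero =>
    right
    have h0 : (ρ 0).state = G.beliefInit T := hρ.1
    rw [h0, beliefInit]
    by_cases hT : G.init ∈ T
    · rw [if_pos hT]
      exact ⟨_, _, _, rfl, fun q hq => hq.elim⟩
    · rw [if_neg hT]
      refine ⟨_, _, subset_rfl, rfl, fun q hq => ?_⟩
      obtain rfl : q = G.init := hq
      exact .init hT
  | succ k ih =>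
    have hst : (ρ (k + 1)).state = G.beliefStep T (ρ k).state (ρ k).act₁ (ρ k).act₂ :=
      state_succ_of_deterministic (fun _ _ _ => rfl) hρ k
    rcases ih with h2 | ⟨s, o, h, hk, hr⟩
    · rw [h2] at hst
      exact Or.inl hst
    rw [hk] at hst
    rcases s.eq_empty_or_nonempty with rfl | hs
    · rw [beliefStep_empty] at hst
      exact Or.inr ⟨_, _, _, hst, fun q hq => hq.elim⟩
    rw [hc k, beliefStrategy, histOf_last, hk] at hst
    obtain ⟨n, hn⟩ := exists_uniform_rank fun q (hq : q ∈ o) => hσ _ q (hr q (h hq))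
    have hu := nonempty_inter_rankWitness (s := s) (h := h) hn
    by_cases hp : (G.Post (σ (beliefObs (histOf ρ k))) s ∩ G.cls (ρ k).act₂).Nonempty
    · obtain ⟨o', h', e, -, -⟩ := beliefStep_pair (T := T) (h := h) hs hu hp
      rw [e] at hst
      refine Or.inr ⟨_, _, _, hst, fun q hq => ?_⟩
      obtain ⟨⟨⟨q₀, hq₀, b, hb⟩, hcls⟩, hT⟩ := hq
      have hcls : G.view₁.obs q = (ρ k).act₂ := hcls
      rw [beliefObs_succ, ← hcls]
      exact .step (hr q₀ hq₀) hb hT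
    · rw [beliefStep_disjoint hs hu hp] at hst
      exact Or.inl hst

end Strategy

/-- At any time the obligations are reachable and finite in number, so they have a common rank and
will be discharged. No uniform bound over time is needed. -/
theorem buchi_of_pureAlmostSureWinning [Finite Q] [Finite A₁] [Finite A₂] [Nonempty A₁]
    [Nonempty A₂] (hG : G.OneSided) (h : G.PureAlmostSureWinning (Reach T)) :
    (G.beliefGame T).SureWinning (Buchi (BeliefState.accepting Q)) := by
  obtain ⟨σ, hσ⟩ := h.exists_reachRank hG
  refine ⟨beliefStrategy T σ, observationBased_of_perfect _ rfl _, fun ρ hρ hc i => ?_⟩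
  rcases belief_reachable hσ hρ hc i with h | ⟨s, o, h, hi, hr⟩
  · exact ⟨i, le_rfl, h ▸ Or.inr rfl⟩
  · obtain ⟨n, hn⟩ := exists_uniform_rank fun q (hq : q ∈ o) => hσ _ q (hr q (h hq))
    exact exists_accepting_of_reachRank hρ hc n i hi hn

/-- Only the first obligation set, the initial state alone, has to be discharged, so its rank is all
that is used. -/
theorem reach_of_purePositiveWinning [Finite Q] [Finite A₁] [Finite A₂] [Nonempty A₁]
    [Nonempty A₂] (hG : G.OneSided) (h : G.PurePositiveWinning (Reach T)) :
    (G.beliefGame T).SureWinning (Reach (BeliefState.accepting Q)) := by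
  by_cases hT : G.init ∈ T
  · refine ⟨fun _ => (Classical.arbitrary A₁, ∅), observationBased_of_perfect _ rfl _,
      fun ρ hρ _ => ⟨0, ?_⟩⟩
    have h0 : (ρ 0).state = G.beliefInit T := hρ.1
    rw [h0, beliefInit, if_pos hT, pair_mem_accepting_iff]
  · obtain ⟨σ, n, hσ⟩ := h.exists_reachRank hG hT
    refine ⟨beliefStrategy T σ, observationBased_of_perfect _ rfl _, fun ρ hρ hc => ?_⟩
    have h0 : (ρ 0).state = G.beliefInit T := hρ.1
    rw [beliefInit, if_neg hT] at h0
    obtain ⟨j, -, hj⟩ := exists_accepting_of_reachRank hρ hc n 0 h0 fun q hq => by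
      obtain rfl : q = G.init := hq
      simpa [beliefObs, histOf] using hσ
    exact ⟨j, hj⟩

end StochGame

/-! ### Polynomial bounds and loops of the random access machine. -/

theorem Polynomial.eval_nat_mono (P : Polynomial ℕ) {x y : ℕ} (h : x ≤ y) :
    P.eval x ≤ P.eval y := by
  simp only [Polynomial.eval_eq_sum, Polynomial.sum]
  gcongr

/-- For arguments of at least 2 constant factors and sums are absorbed by a larger exponent; this
gives the single constant `c` of the time bound. -/
theorem Polynomial.exists_eval_le_pow (P : Polynomial ℕ) :
    ∃ c : ℕ, ∀ x : ℕ, 2 ≤ x → P.eval x ≤ x ^ c := by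
  induction P using Polynomial.induction_on with
  | C a =>
    refine ⟨a, fun x hx => ?_⟩
    rw [Polynomial.eval_C]
    exact (Nat.lt_pow_self (by omega)).le
  | add p q hp hq =>
    obtain ⟨c, hc⟩ := hp
    obtain ⟨c', hc'⟩ := hq
    refine ⟨c + c' + 1, fun x hx => ?_⟩
    have h1 : x ^ c ≤ x ^ (c + c') := Nat.pow_le_pow_right (by omega) (by omega)
    have h2 : x ^ c' ≤ x ^ (c + c') := Nat.pow_le_pow_right (by omega) (by omega)
    rw [Polynomial.eval_add, pow_succ]
    have := hc x hx
    have := hc' x hx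
    nlinarith
  | monomial n a h =>
    obtain ⟨c, hc⟩ := h
    refine ⟨c + 1, fun x hx => ?_⟩
    have := hc x hx
    simp only [Polynomial.eval_mul, Polynomial.eval_C, Polynomial.eval_pow, Polynomial.eval_X,
      pow_succ] at this ⊢
    rw [← mul_assoc]
    exact Nat.mul_le_mul_right x this

theorem RProg.loop_runs {e : RExpr} {p : RProg} (I : ℕ → RStore → Prop) (N C : ℕ)
    (hstep : ∀ i < N, ∀ s, I i s → e.eval s ≠ 0 ∧ ∃ t s', p.Runs s t s' ∧ t ≤ C ∧ I (i + 1) s')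
    (hend : ∀ s, I N s → e.eval s = 0) (s : RStore) (hs : I 0 s) :
    ∃ t s', (RProg.loop e p).Runs s t s' ∧ I N s' ∧ t ≤ N * (C + e.cost + 1) + e.cost + 1 := by
  induction N generalizing I s with
  | zero => exact ⟨_, _, .loopDone (hend s hs), hs, by omega⟩
  | succ N ih =>
    obtain ⟨h0, t, s', hr, ht, hI⟩ := hstep 0 (by omega) s hs
    obtain ⟨t', s'', hr', hI', ht'⟩ := ih (fun i => I (i + 1))
      (fun i hi => hstep (i + 1) (by omega)) hend s' hI
    refine ⟨_, _, .loopStep h0 hr hr', hI', ?_⟩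
    rw [Nat.succ_mul]
    omega

namespace RStore

/-- The header of the input word is that of a description of a game. -/
def Valid (s : RStore) : Prop :=
  1 ≤ s.arr 0 0 ∧ 1 ≤ s.arr 0 1 ∧ 1 ≤ s.arr 0 2 ∧ s.arr 0 3 ≤ s.arr 0 0 ∧ s.arr 0 4 ≤ s.arr 0 0

/-- The quantity in terms of which running times are measured. -/
def size (s : RStore) : ℕ := 2 ^ s.arr 0 0 * (s.arr 0 1 * s.arr 0 2)

theorem Valid.congr {s s' : RStore} (h : s.Valid) (e : s'.arr = s.arr) : s'.Valid := by
  unfold Valid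
  rw [e]
  exact h

theorem size_congr {s s' : RStore} (e : s'.arr = s.arr) : s'.size = s.size := by
  unfold size
  rw [e]

theorem Valid.two_pow_le_size {s : RStore} (h : s.Valid) : 2 ^ s.arr 0 0 ≤ s.size := by
  obtain ⟨-, h1, h2, -⟩ := h
  exact Nat.le_mul_of_pos_right _ (Nat.mul_pos h1 h2)

theorem Valid.two_le_size {s : RStore} (h : s.Valid) : 2 ≤ s.size :=
  le_trans (by simpa using Nat.pow_le_pow_right (n := 2) (by omega) h.1) h.two_pow_le_size

end RStore

/-! ### A calculus of functions and predicates computable in polynomial time. -/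

open Polynomial in
/-- The function `f` of the input array and of the variables below `d` is computed, into any
variable `D ≥ d` and without changes to the variables below `D`, by a program whose running time
is polynomial in the size of the input and in the variables; its values are polynomially bounded
as well. -/
structure Comp (d : ℕ) (f : RStore → ℕ) : Prop where
  loc : ∀ s s' : RStore, s.arr 0 = s'.arr 0 → (∀ i < d, s.var i = s'.var i) → f s = f s'
  bdd : ∃ P : ℕ[X], ∀ (s : RStore) (V : ℕ), s.Valid → (∀ i < d, s.var i ≤ V) →
    f s ≤ P.eval (s.size + V)
  prog : ∀ D ≥ d, ∃ (p : RProg) (P : ℕ[X]), ∀ (s : RStore) (V : ℕ), s.Valid →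
    (∀ i < D, s.var i ≤ V) → ∃ t s', p.Runs s t s' ∧ s'.var D = f s ∧
      (∀ i < D, s'.var i = s.var i) ∧ s'.arr = s.arr ∧ t ≤ P.eval (s.size + V)

namespace Comp

open Polynomial

variable {d : ℕ} {f g : RStore → ℕ}

theorem mono {d' : ℕ} (h : d ≤ d') (hf : Comp d f) : Comp d' f where
  loc s s' h1 h2 := hf.loc s s' h1 fun i hi => h2 i (by omega)
  bdd := by
    obtain ⟨P, hP⟩ := hf.bdd
    exact ⟨P, fun s V hs hV => hP s V hs fun i hi => hV i (by omega)⟩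
  prog D hD := hf.prog D (by omega)

theorem var {r : ℕ} (h : r < d) : Comp d fun s => s.var r where
  loc s s' h1 h2 := h2 r h
  bdd := ⟨X, fun s V hs hV => by
    rw [eval_X]
    have := hV r h
    omega⟩
  prog D hD := ⟨.assign D (.var r), C 2, fun s V hs hV => ⟨_, _, .assign _ _ _,
    by simp [RStore.setVar, RExpr.eval],
    fun i hi => by simp [RStore.setVar, hi.ne], rfl, by simp [RExpr.cost]⟩⟩

/-- A value that is read off the input with an expression without variables. -/
theorem const (E : RExpr) (h1 : ∀ s s' : RStore, s.arr 0 = s'.arr 0 → E.eval s = E.eval s')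
    (h2 : ∃ P : ℕ[X], ∀ s : RStore, s.Valid → E.eval s ≤ P.eval s.size) : Comp d E.eval where
  loc s s' h _ := h1 s s' h
  bdd := by
    obtain ⟨P, hP⟩ := h2
    exact ⟨P, fun s V hs _ => (hP s hs).trans (P.eval_nat_mono (by omega))⟩
  prog D hD := ⟨.assign D E, C (E.cost + 1), fun s V hs hV => ⟨_, _, .assign _ _ _,
    by simp [RStore.setVar],
    fun i hi => by simp [RStore.setVar, hi.ne], rfl, by simp⟩⟩

theorem lit (n : ℕ) : Comp d fun _ => n :=
  const (.lit n) (fun _ _ _ => rfl) ⟨C n, fun s _ => by simp [RExpr.eval]⟩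

/-- The combination of two values by an expression. -/
theorem binop (hf : Comp d f) (hg : Comp d g) (op : (ℕ → ℕ) → ℕ → ℕ → ℕ) (E : ℕ → RExpr) (c : ℕ)
    (hE : ∀ s D, (E D).eval s = op (s.arr 0) (s.var D) (s.var (D + 1)))
    (hc : ∀ D, (E D).cost ≤ c) (P : ℕ[X]) (hP : ∀ w x y, op w x y ≤ P.eval (x + y)) :
    Comp d fun s => op (s.arr 0) (f s) (g s) where
  loc s s' h1 h2 := by
    rw [hf.loc s s' h1 h2, hg.loc s s' h1 h2, h1]
  bdd := by
    obtain ⟨Pf, hPf⟩ := hf.bdd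
    obtain ⟨Pg, hPg⟩ := hg.bdd
    refine ⟨P.comp (Pf + Pg), fun s V hs hV => (hP _ _ _).trans ?_⟩
    rw [eval_comp, eval_add]
    exact P.eval_nat_mono (add_le_add (hPf s V hs hV) (hPg s V hs hV))
  prog D hD := by
    obtain ⟨Pf, hPf⟩ := hf.bdd
    obtain ⟨pf, Tf, hTf⟩ := hf.prog D hD
    obtain ⟨pg, Tg, hTg⟩ := hg.prog (D + 1) (by omega)
    -- Variables serve as a stack: `f` is left in `D`, and `g` is computed into `D + 1` without
    -- touching `D`. Its time is measured with the value of `f` among the variables.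
    refine ⟨.seq pf (.seq pg (.assign D (E D))), Tf + Tg.comp (X + Pf) + C (c + 1),
      fun s V hs hV => ?_⟩
    obtain ⟨t₁, s₁, r₁, v₁, k₁, a₁, b₁⟩ := hTf s V hs hV
    have hfV := hPf s V hs fun i hi => hV i (by omega)
    obtain ⟨t₂, s₂, r₂, v₂, k₂, a₂, b₂⟩ := hTg s₁ (V + Pf.eval (s.size + V)) (hs.congr a₁) (by
      intro i hi
      rcases Nat.lt_succ_iff_lt_or_eq.mp hi with hi | rfl
      · rw [k₁ i hi]
        exact (hV i hi).trans (by omega)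
      · rw [v₁]
        omega)
    have hg1 : g s₁ = g s := hg.loc s₁ s (by rw [a₁]) fun i hi => k₁ i (by omega)
    refine ⟨_, _, .seq r₁ (.seq r₂ (.assign _ _ _)), ?_, ?_, ?_, ?_⟩
    · simp only [RStore.setVar, Function.update_self]
      rw [hE, v₂, k₂ D (by omega), v₁, hg1, a₂, a₁]
    · intro i hi
      simp only [RStore.setVar, Function.update_of_ne hi.ne]
      rw [k₂ i (by omega), k₁ i hi]
    · exact a₂.trans a₁
    · rw [eval_add, eval_add, eval_comp, eval_add, eval_X, eval_C]
      rw [RStore.size_congr a₁, ← add_assoc] at b₂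
      have := hc D
      omega

theorem add (hf : Comp d f) (hg : Comp d g) : Comp d fun s => f s + g s :=
  binop hf hg (fun _ x y => x + y) (fun D => .add (.var D) (.var (D + 1))) 3 (fun _ _ => rfl)
    (fun _ => le_rfl) X fun _ _ _ => by simp

theorem sub (hf : Comp d f) (hg : Comp d g) : Comp d fun s => f s - g s :=
  binop hf hg (fun _ x y => x - y) (fun D => .sub (.var D) (.var (D + 1))) 3 (fun _ _ => rfl)
    (fun _ => le_rfl) X fun _ x y => by
      rw [eval_X]
      omega

/-- The comparison of an entry of the input word with a value. -/
theorem test (hf : Comp d f) (hg : Comp d g) :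
    Comp d fun s => if s.arr 0 (f s) = g s then 1 else 0 :=
  binop hf hg (fun w x y => if w x = y then 1 else 0)
    (fun D => .sub (.lit 1) (.add (.sub (.get 0 (.var D)) (.var (D + 1)))
      (.sub (.var (D + 1)) (.get 0 (.var D))))) 20
    (fun s D => by
      simp only [RExpr.eval]
      split_ifs <;> omega)
    (fun _ => by simp [RExpr.cost]) 1 fun _ x y => by
      rw [eval_one]
      split_ifs <;> omega

theorem congr (hf : Comp d f) (h : ∀ s, f s = g s) : Comp d g := funext h ▸ hf

/-- Intermediate values need the separate bound `hP`, since iterating a polynomially bounded step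
can grow too fast. The body is assumed computable at all computable arguments, so it can be used
both at program variables and at literals. -/
theorem natRec {e : RStore → ℕ} {body : ℕ → ℕ → RStore → ℕ} (he : Comp d e) (hf : Comp d f)
    (hb : ∀ d' ≥ d, ∀ x y : RStore → ℕ, Comp d' x → Comp d' y →
      Comp d' fun s => body (x s) (y s) s)
    (hP : ∃ P : ℕ[X], ∀ (s : RStore) (V : ℕ), s.Valid → (∀ i < d, s.var i ≤ V) → ∀ j ≤ e s,
      Nat.rec (f s) (fun i acc => body i acc s) j ≤ P.eval (s.size + V)) :
    Comp d fun s => Nat.rec (f s) (fun i acc => body i acc s) (e s) where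
  loc s s' h1 h2 := by
    have : ∀ i acc, body i acc s = body i acc s' := fun i acc =>
      (hb d le_rfl _ _ (lit i) (lit acc)).loc s s' h1 h2
    simp only [he.loc s s' h1 h2, hf.loc s s' h1 h2, this]
  bdd := by
    obtain ⟨P, hP⟩ := hP
    exact ⟨P, fun s V hs hV => hP s V hs hV _ le_rfl⟩
  prog D hD := by
    obtain ⟨P, hP⟩ := hP
    obtain ⟨Pe, hPe⟩ := he.bdd
    obtain ⟨pe, Te, hTe⟩ := he.prog D hD
    obtain ⟨pf, Tf, hTf⟩ := hf.prog (D + 1) (by omega)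
    have hbody := hb (D + 3) (by omega) _ _ (var (r := D + 2) (by omega))
      (var (r := D + 1) (by omega))
    obtain ⟨pb, Tb, hTb⟩ := hbody.prog (D + 3) le_rfl
    have hloc : ∀ i acc, ∀ s s' : RStore, s.arr 0 = s'.arr 0 → (∀ i < d, s.var i = s'.var i) →
        body i acc s = body i acc s' := fun i acc =>
      (hb d le_rfl _ _ (lit i) (lit acc)).loc
    -- `D` holds the number of iterations, `D + 1` the accumulator, `D + 2` the counter and `D + 3`
    -- the new value.
    refine ⟨.seq pe (.seq pf (.seq (.assign (D + 2) (.lit 0)) (.seq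
      (.loop (.sub (.var D) (.var (D + 2))) (.seq pb (.seq (.assign (D + 1) (.var (D + 3)))
        (.assign (D + 2) (.add (.var (D + 2)) (.lit 1))))))
      (.assign D (.var (D + 1)))))),
      Te + Tf.comp (X + Pe) + Pe * (Tb.comp (X + Pe + P) + C 10) + C 8, fun s V hs hV => ?_⟩
    have hV' : ∀ i < d, s.var i ≤ V := fun i hi => hV i (by omega)
    obtain ⟨t₁, s₁, r₁, v₁, k₁, a₁, b₁⟩ := hTe s V hs hV
    have heV := hPe s V hs hV'
    obtain ⟨t₂, s₂, r₂, v₂, k₂, a₂, b₂⟩ := hTf s₁ (V + Pe.eval (s.size + V)) (hs.congr a₁) (by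
      intro i hi
      rcases Nat.lt_succ_iff_lt_or_eq.mp hi with hi | rfl
      · rw [k₁ i hi]
        exact (hV i hi).trans (by omega)
      · rw [v₁]
        omega)
    have hf₁ : f s₁ = f s := hf.loc s₁ s (by rw [a₁]) fun i hi => k₁ i (by omega)
    let R : ℕ → ℕ := fun j => Nat.rec (f s) (fun i acc => body i acc s) j
    let I : ℕ → RStore → Prop := fun j st => st.arr = s.arr ∧ (∀ i < D, st.var i = s.var i) ∧
      st.var D = e s ∧ st.var (D + 1) = R j ∧ st.var (D + 2) = j
    obtain ⟨t₄, s₄, r₄, ⟨a₄, k₄, -, v₄, -⟩, b₄⟩ := RProg.loop_runs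
      (e := .sub (.var D) (.var (D + 2)))
      (p := .seq pb (.seq (.assign (D + 1) (.var (D + 3)))
        (.assign (D + 2) (.add (.var (D + 2)) (.lit 1))))) I (e s)
      (Tb.eval (s.size + V + Pe.eval (s.size + V) + P.eval (s.size + V)) + 6) (by
        rintro j hj st ⟨ia, ik, iD, iacc, ij⟩
        refine ⟨by simp only [RExpr.eval, iD, ij]; omega, ?_⟩
        obtain ⟨t, s', r, v, k, a, b⟩ := hTb st
          (V + Pe.eval (s.size + V) + P.eval (s.size + V)) (hs.congr ia) (by
            intro i hi
            have hR : R j ≤ P.eval (s.size + V) := hP s V hs hV' j hj.le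
            rcases (by omega : i < D ∨ i = D ∨ i = D + 1 ∨ i = D + 2) with hi | rfl | rfl | rfl
            · rw [ik i hi]
              have := hV i hi
              omega
            · omega
            · omega
            · omega)
        refine ⟨_, _, .seq r (.seq (.assign _ _ _) (.assign _ _ _)), ?_, ?_, ?_, ?_, ?_, ?_⟩
        · simp only [RExpr.cost]
          rw [RStore.size_congr ia, ← add_assoc, ← add_assoc] at b
          omega
        · exact a.trans ia
        · intro i hi
          simp only [RStore.setVar]
          rw [Function.update_of_ne (by omega), Function.update_of_ne (by omega), k i (by omega),
            ik i hi]
        · simp only [RStore.setVar]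
          rw [Function.update_of_ne (by omega), Function.update_of_ne (by omega), k D (by omega),
            iD]
        · simp only [RStore.setVar]
          rw [Function.update_of_ne (by omega), Function.update_self]
          simp only [RExpr.eval]
          rw [v, ij, iacc, hloc _ _ st s (by rw [ia]) fun i hi => ik i (by omega)]
        · simp only [RStore.setVar, Function.update_self, RExpr.eval]
          rw [Function.update_of_ne (by omega), k _ (by omega), ij])
      (by
        rintro st ⟨-, -, iD, -, ij⟩
        simp only [RExpr.eval, iD, ij]
        omega) (s₂.setVar (D + 2) 0) (by
        refine ⟨a₂.trans a₁, fun i hi => ?_, ?_, ?_, ?_⟩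
        · simp only [RStore.setVar]
          rw [Function.update_of_ne (by omega), k₂ i (by omega), k₁ i hi]
        · simp only [RStore.setVar]
          rw [Function.update_of_ne (by omega), k₂ D (by omega), v₁]
        · simp only [RStore.setVar]
          rw [Function.update_of_ne (by omega), v₂, hf₁]
          rfl
        · simp [RStore.setVar])
    refine ⟨_, _, .seq r₁ (.seq r₂ (.seq (.assign _ _ _) (.seq r₄ (.assign _ _ _)))),
      ?_, ?_, a₄, ?_⟩
    · simp only [RStore.setVar, Function.update_self, RExpr.eval]
      exact v₄
    · intro i hi
      simp only [RStore.setVar]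
      rw [Function.update_of_ne hi.ne, k₄ i hi]
    · simp only [eval_add, eval_mul, eval_comp, eval_X, eval_C]
      rw [RStore.size_congr a₁, ← add_assoc] at b₂
      simp only [RExpr.cost] at b₄ ⊢
      have h5 : e s * (Tb.eval (s.size + V + Pe.eval (s.size + V) + P.eval (s.size + V)) + 10) ≤
          Pe.eval (s.size + V) *
            (Tb.eval (s.size + V + Pe.eval (s.size + V) + P.eval (s.size + V)) + 10) :=
        Nat.mul_le_mul_right _ heV
      have h6 : Tb.eval (s.size + V + Pe.eval (s.size + V) + P.eval (s.size + V)) + 6 +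
          (1 + 1 + 1) + 1 =
          Tb.eval (s.size + V + Pe.eval (s.size + V) + P.eval (s.size + V)) + 10 := by omega
      rw [h6] at b₄
      omega

end Comp

namespace Comp

open Polynomial

variable {d : ℕ} {e f g : RStore → ℕ}

theorem natRec_add_eq_sum (F : ℕ → ℕ) (n : ℕ) :
    (Nat.rec 0 (fun i acc => acc + F i) n : ℕ) = ∑ i ∈ Finset.range n, F i := by
  induction n with
  | zero => rfl
  | succ n ih => rw [Finset.sum_range_succ, ← ih]

theorem sum {body : ℕ → RStore → ℕ} (he : Comp d e)
    (hb : ∀ d' ≥ d, ∀ x : RStore → ℕ, Comp d' x → Comp d' fun s => body (x s) s) :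
    Comp d fun s => ∑ i ∈ Finset.range (e s), body i s := by
  refine (natRec (f := fun _ => 0) (body := fun i acc s => acc + body i s) he (lit 0)
    (fun d' hd' x y hx hy => hy.add (hb d' hd' x hx)) ?_).congr
    fun s => natRec_add_eq_sum (fun i => body i s) _
  obtain ⟨Pe, hPe⟩ := he.bdd
  have hbody := hb (d + 1) (by omega) _ (var (r := d) (by omega))
  obtain ⟨Pb, hPb⟩ := hbody.bdd
  refine ⟨Pe * Pb.comp (X + Pe), fun s V hs hV j hj => ?_⟩
  have heV := hPe s V hs hV
  rw [natRec_add_eq_sum, eval_mul, eval_comp, eval_add, eval_X]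
  have hle : ∀ i ∈ Finset.range j,
      body i s ≤ Pb.eval (s.size + V + Pe.eval (s.size + V)) := by
    intro i hi
    rw [Finset.mem_range] at hi
    -- Storing the index in the fresh variable `d` allows one polynomial bound for the body to be
    -- used for all indices.
    have h1 : body i s = body i (s.setVar d i) := by
      refine (hb d le_rfl _ (lit i)).loc s (s.setVar d i) rfl fun r hr => ?_
      simp [RStore.setVar, hr.ne]
    have h2 := hPb (s.setVar d i) (V + Pe.eval (s.size + V)) (hs.congr rfl) (by
      intro r hr
      rcases Nat.lt_succ_iff_lt_or_eq.mp hr with hr | rfl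
      · simp only [RStore.setVar]
        rw [Function.update_of_ne hr.ne]
        exact (hV r hr).trans (by omega)
      · simp only [RStore.setVar, Function.update_self]
        omega)
    simp only [RStore.size_congr (s := s) (s' := s.setVar d i) rfl] at h2
    rw [h1, add_assoc]
    simpa only [RStore.setVar, Function.update_self] using h2
  refine (Finset.sum_le_card_nsmul _ _ _ hle).trans ?_
  rw [Finset.card_range, smul_eq_mul]
  exact Nat.mul_le_mul_right _ (hj.trans heV)

/-- The machine only adds, so a product is a repeated sum. -/
theorem mul (hf : Comp d f) (hg : Comp d g) : Comp d fun s => f s * g s :=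
  (sum (body := fun _ s => g s) hf fun _ hd' _ _ => hg.mono hd').congr fun s => by simp

/-- The power of a constant with an exponent that is at most the number of states. -/
theorem pow (b : ℕ) (hf : Comp d f) (hle : ∀ s, f s ≤ s.arr 0 0) : Comp d fun s => b ^ f s := by
  have hrec : ∀ j, (Nat.rec 1 (fun _ acc => acc * b) j : ℕ) = b ^ j := by
    intro j
    induction j with
    | zero => rfl
    | succ j ih => rw [pow_succ, ← ih]
  refine (natRec (f := fun _ => 1) (body := fun _ acc _ => acc * b) hf (lit 1)
    (fun d' hd' x y hx hy => hy.mul (lit b)) ?_).congr fun s => hrec _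
  -- As `b ≤ 2 ^ (b + 1)` and the exponent is at most the number `n` of states, the power is at most
  -- `(2 ^ n) ^ (b + 1)`, and `2 ^ n` is at most the size.
  refine ⟨X ^ (b + 1), fun s V hs hV j hj => ?_⟩
  rw [hrec, eval_pow, eval_X]
  calc b ^ j ≤ (2 ^ (b + 1)) ^ j := Nat.pow_le_pow_left
        ((Nat.lt_pow_self (by omega)).le.trans (Nat.pow_le_pow_right (by omega) (by omega))) _
    _ ≤ (2 ^ (b + 1)) ^ s.arr 0 0 := Nat.pow_le_pow_right (by positivity) (hj.trans (hle s))
    _ = (2 ^ s.arr 0 0) ^ (b + 1) := by rw [← pow_mul, ← pow_mul, mul_comm]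
    _ ≤ (s.size + V) ^ (b + 1) :=
      Nat.pow_le_pow_left (hs.two_pow_le_size.trans (Nat.le_add_right _ _)) _

end Comp

open Classical in
/-- A predicate with a characteristic function that is computed in polynomial time. -/
def CompPred (d : ℕ) (p : RStore → Prop) : Prop := Comp d fun s => if p s then 1 else 0

namespace CompPred

variable {d : ℕ} {p q : RStore → Prop} {e f g : RStore → ℕ}

theorem congr (hp : CompPred d p) (h : ∀ s, p s ↔ q s) : CompPred d q :=
  (funext fun s => propext (h s) : p = q) ▸ hp

theorem eq_zero (hf : Comp d f) : CompPred d fun s => f s = 0 :=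
  ((Comp.lit 1).sub hf).congr fun s => by split_ifs <;> omega

theorem le (hf : Comp d f) (hg : Comp d g) : CompPred d fun s => f s ≤ g s :=
  (eq_zero (hf.sub hg)).congr fun s => by omega

theorem lt (hf : Comp d f) (hg : Comp d g) : CompPred d fun s => f s < g s :=
  (le (hf.add (Comp.lit 1)) hg).congr fun s => by omega

theorem eq (hf : Comp d f) (hg : Comp d g) : CompPred d fun s => f s = g s :=
  (eq_zero ((hf.sub hg).add (hg.sub hf))).congr fun s => by omega

theorem not (hp : CompPred d p) : CompPred d fun s => ¬ p s :=
  (eq_zero hp).congr fun s => by by_cases h : p s <;> simp [h]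

theorem and (hp : CompPred d p) (hq : CompPred d q) : CompPred d fun s => p s ∧ q s :=
  (Comp.mul hp hq).congr fun s => by by_cases h : p s <;> by_cases h' : q s <;> simp [h, h']

theorem test (hf : Comp d f) (hg : Comp d g) : CompPred d fun s => s.arr 0 (f s) = g s :=
  (Comp.test hf hg).congr fun s => by split_ifs <;> rfl

theorem exists_lt {p : ℕ → RStore → Prop} (he : Comp d e)
    (hp : ∀ d' ≥ d, ∀ x : RStore → ℕ, Comp d' x → CompPred d' fun s => p (x s) s) :
    CompPred d fun s => ∃ i < e s, p i s := by
  classical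
  refine (not (eq_zero (Comp.sum (body := fun i s => if p i s then 1 else 0) he
    fun d' hd' x hx => hp d' hd' x hx))).congr fun s => ?_
  simp

theorem forall_lt {p : ℕ → RStore → Prop} (he : Comp d e)
    (hp : ∀ d' ≥ d, ∀ x : RStore → ℕ, Comp d' x → CompPred d' fun s => p (x s) s) :
    CompPred d fun s => ∀ i < e s, p i s :=
  (not (exists_lt (p := fun i s => ¬ p i s) he fun d' hd' x hx => (hp d' hd' x hx).not)).congr
    fun s => by push Not; rfl

end CompPred

namespace Comp

variable {d : ℕ} {p : RStore → Prop} {f g : RStore → ℕ}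

/-- Both branches are computed and weighted with the characteristic functions of the condition and
of its negation. -/
theorem ite [∀ s, Decidable (p s)] (hp : CompPred d p) (hf : Comp d f) (hg : Comp d g) :
    Comp d fun s => if p s then f s else g s :=
  ((mul hp hf).add (mul hp.not hg)).congr fun s => by by_cases h : p s <;> simp [h]

theorem sum_range_ite_le (m : ℕ) : ∀ n : ℕ,
    ∑ j ∈ Finset.range n, (if j + 1 ≤ m then 1 else 0) = min n m
  | 0 => by simp
  | n + 1 => by
    rw [Finset.sum_range_succ, sum_range_ite_le m n]
    split_ifs <;> omega

/-- The quotient counts the positive multiples of the divisor up to the dividend; the test `0 < g s`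
gives the value 0 for division by 0. -/
theorem div (hf : Comp d f) (hg : Comp d g) : Comp d fun s => f s / g s := by
  classical
  refine (sum (body := fun j s => if 0 < g s ∧ (j + 1) * g s ≤ f s then 1 else 0) hf
    fun d' hd' x hx => ite (((CompPred.lt (lit 0) (hg.mono hd'))).and
      (CompPred.le ((hx.add (lit 1)).mul (hg.mono hd')) (hf.mono hd'))) (lit 1) (lit 0)).congr
    fun s => ?_
  rcases Nat.eq_zero_or_pos (g s) with h | h
  · simp [h]
  · simp only [h, true_and, ← Nat.le_div_iff_mul_le h]
    rw [sum_range_ite_le, min_eq_right (Nat.div_le_self _ _)]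

theorem mod (hf : Comp d f) (hg : Comp d g) : Comp d fun s => f s % g s :=
  (hf.sub (hg.mul (hf.div hg))).congr fun s => by
    have := Nat.div_add_mod (f s) (g s)
    omega

end Comp

/-! ### The computation of the belief game from the description of a game -/

namespace BeliefTable

/-- Digit `j` of `i` in base `b`, for `j` at most the number `w 0` of states. -/
def digit (b : ℕ) (w : ℕ → ℕ) (i j : ℕ) : ℕ := i / b ^ (j - (j - w 0)) % b

/-- State `q'` is a possible successor of `q`. -/
def Succ (w : ℕ → ℕ) (q a b q' : ℕ) : Prop :=
  w (5 + 2 * w 0 + 2 * (((q * w 1 + a) * w 2 + b) * w 0 + q')) ≠ 0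

def HasObs (w : ℕ → ℕ) (q γ : ℕ) : Prop := w (5 + q) = γ

def IsTarget (w : ℕ → ℕ) (q : ℕ) : Prop := w (5 + w 0 + q) = 1

/-- State `q` is in the belief, for digits at least `1`, or in the obligation set, for digits at
least `2`, of the pair with number `ℓ`. -/
def InPair (c : ℕ) (w : ℕ → ℕ) (ℓ q : ℕ) : Prop := c ≤ digit 3 w ℓ q

def InWitness (w : ℕ → ℕ) (u q : ℕ) : Prop := 1 ≤ digit 2 w u q

def NoObligation (w : ℕ → ℕ) (ℓ : ℕ) : Prop := ∀ q < w 0, ¬ InPair 2 w ℓ q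

def InPost (c : ℕ) (w : ℕ → ℕ) (ℓ a q' : ℕ) : Prop :=
  ∃ q < w 0, InPair c w ℓ q ∧ ∃ b < w 2, Succ w q a b q'

def Blocked (w : ℕ → ℕ) (ℓ a u : ℕ) : Prop :=
  ∃ q < w 0, InPair 2 w ℓ q ∧ ∃ b < w 2, ∀ q' < w 0, ¬ (Succ w q a b q' ∧ InWitness w u q')

def Consistent (w : ℕ → ℕ) (ℓ a γ : ℕ) : Prop :=
  ∃ q' < w 0, InPost 1 w ℓ a q' ∧ HasObs w q' γ

def InNewBelief (w : ℕ → ℕ) (ℓ a γ q' : ℕ) : Prop :=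
  (InPost 1 w ℓ a q' ∧ HasObs w q' γ) ∧ ¬ IsTarget w q'

def InNewObligation (w : ℕ → ℕ) (ℓ a u γ q' : ℕ) : Prop :=
  ((InPost 2 w ℓ a q' ∧ HasObs w q' γ) ∧ InWitness w u q') ∧ ¬ IsTarget w q'

-- The digit is 2 in the obligation set, 1 in the rest of the belief and 0 elsewhere. If nothing was
-- owed, the new obligation set is the whole belief and the digit 1 does not occur.
open Classical in
noncomputable def newDigit (w : ℕ → ℕ) (ℓ a u γ q' : ℕ) : ℕ :=
  if NoObligation w ℓ then (if InNewBelief w ℓ a γ q' then 2 else 0)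
  else if InNewObligation w ℓ a u γ q' then 2
  else if InNewBelief w ℓ a γ q' then 1 else 0

-- Numbers below `3 ^ w 0` are pairs, with 0 for the empty belief; the next two numbers are the
-- absorbing states. The exponent is a truncated form of `q`, equal to `q` in the range of the sum.
open Classical in
noncomputable def next (w : ℕ → ℕ) (ℓ a u γ : ℕ) : ℕ :=
  if 3 ^ w 0 ≤ ℓ then ℓ
  else if ℓ = 0 then ℓ
  else if Blocked w ℓ a u then 3 ^ w 0
  else if ¬ Consistent w ℓ a γ then 3 ^ w 0 + 1
  else ∑ q ∈ Finset.range (w 0), newDigit w ℓ a u γ q * 3 ^ (q - (q - w 0))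

open Classical in
noncomputable def init (w : ℕ → ℕ) : ℕ :=
  if IsTarget w (w 4) then 0 else 2 * 3 ^ (w 4 - (w 4 - w 0))

/-- A disjunction written with the connectives provided for `CompPred`, conjunction and negation. -/
def Accepting (w : ℕ → ℕ) (ℓ : ℕ) : Prop :=
  ¬ (¬ (3 ^ w 0 ≤ ℓ ∧ ℓ = 3 ^ w 0 + 1) ∧ ¬ (ℓ < 3 ^ w 0 ∧ NoObligation w ℓ))

/-- The number of states of the belief game. -/
def numStates (w : ℕ → ℕ) : ℕ := 3 ^ w 0 + 2

/-- The number of actions of player 1 in the belief game. -/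
def numActions (w : ℕ → ℕ) : ℕ := w 1 * 2 ^ w 0

/-- The length of the description of the belief game. -/
def length (w : ℕ → ℕ) : ℕ := 4 + numStates w + numStates w * numActions w * w 3

/-- Entry `j` of the successor table. -/
noncomputable def tableEntry (w : ℕ → ℕ) (j : ℕ) : ℕ :=
  next w (j / w 3 / numActions w) (j / w 3 % numActions w / 2 ^ w 0)
    (j / w 3 % numActions w % 2 ^ w 0) (j % w 3)

open Classical in
/-- Entry `i` of the description of the belief game. -/
noncomputable def entry (w : ℕ → ℕ) (i : ℕ) : ℕ :=
  if i < 4 then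
    if i = 0 then numStates w
    else if i = 1 then numActions w
    else if i = 2 then w 3
    else init w
  else if i - 4 < numStates w then (if Accepting w (i - 4) then 1 else 0)
  else tableEntry w (i - 4 - numStates w)

section Comp

variable {d : ℕ} {i j ℓ q a b u γ q' : RStore → ℕ}

/-- Only header entries are read as values. Numerators and other later entries, which may be huge,
enter through the comparisons of `Comp.test`. -/
theorem comp_header {r : ℕ} (h : ∃ P : Polynomial ℕ, ∀ s : RStore, s.Valid →
    s.arr 0 r ≤ P.eval s.size) : Comp d fun s => s.arr 0 r :=
  Comp.const (.get 0 (.lit r)) (fun _ _ h => congrFun h r) h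

theorem comp_zero : Comp d fun s => s.arr 0 0 :=
  comp_header ⟨.X, fun s hs => by
    rw [Polynomial.eval_X]
    exact (Nat.lt_two_pow_self).le.trans hs.two_pow_le_size⟩

theorem comp_one : Comp d fun s => s.arr 0 1 :=
  comp_header ⟨.X, fun s hs => by
    rw [Polynomial.eval_X, RStore.size]
    exact (Nat.le_mul_of_pos_right _ hs.2.2.1).trans (Nat.le_mul_of_pos_left _ (by positivity))⟩

theorem comp_two : Comp d fun s => s.arr 0 2 :=
  comp_header ⟨.X, fun s hs => by
    rw [Polynomial.eval_X, RStore.size]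
    exact (Nat.le_mul_of_pos_left _ hs.2.1).trans (Nat.le_mul_of_pos_left _ (by positivity))⟩

theorem comp_three : Comp d fun s => s.arr 0 3 :=
  comp_header ⟨.X, fun s hs => by
    rw [Polynomial.eval_X]
    exact hs.2.2.2.1.trans ((Nat.lt_two_pow_self).le.trans hs.two_pow_le_size)⟩

theorem comp_four : Comp d fun s => s.arr 0 4 :=
  comp_header ⟨.X, fun s hs => by
    rw [Polynomial.eval_X]
    exact hs.2.2.2.2.trans ((Nat.lt_two_pow_self).le.trans hs.two_pow_le_size)⟩

/-- The exponent is the minimum of `j` and the number of states, which keeps the power polynomial in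
the size for every `j`. -/
theorem comp_min_pow (c : ℕ) (hj : Comp d j) :
    Comp d fun s => c ^ (j s - (j s - s.arr 0 0)) :=
  Comp.pow c (hj.sub (hj.sub comp_zero)) fun s => by omega

theorem comp_pow (c : ℕ) : Comp d fun s => c ^ s.arr 0 0 := Comp.pow c comp_zero fun _ => le_rfl

theorem comp_digit (c : ℕ) (hi : Comp d i) (hj : Comp d j) :
    Comp d fun s => digit c (s.arr 0) (i s) (j s) :=
  (hi.div (comp_min_pow c hj)).mod (Comp.lit c)

theorem comp_succ (hq : Comp d q) (ha : Comp d a) (hb : Comp d b) (hq' : Comp d q') :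
    CompPred d fun s => Succ (s.arr 0) (q s) (a s) (b s) (q' s) :=
  (CompPred.test (((Comp.lit 5).add ((Comp.lit 2).mul comp_zero)).add
    ((Comp.lit 2).mul ((((((hq.mul comp_one).add ha).mul comp_two).add hb).mul comp_zero).add hq')))
    (Comp.lit 0)).not

theorem comp_hasObs (hq : Comp d q) (hγ : Comp d γ) :
    CompPred d fun s => HasObs (s.arr 0) (q s) (γ s) :=
  CompPred.test ((Comp.lit 5).add hq) hγ

theorem comp_isTarget (hq : Comp d q) : CompPred d fun s => IsTarget (s.arr 0) (q s) :=
  CompPred.test (((Comp.lit 5).add comp_zero).add hq) (Comp.lit 1)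

theorem comp_inPair (c : ℕ) (hℓ : Comp d ℓ) (hq : Comp d q) :
    CompPred d fun s => InPair c (s.arr 0) (ℓ s) (q s) :=
  CompPred.le (Comp.lit c) (comp_digit 3 hℓ hq)

theorem comp_inWitness (hu : Comp d u) (hq : Comp d q) :
    CompPred d fun s => InWitness (s.arr 0) (u s) (q s) :=
  CompPred.le (Comp.lit 1) (comp_digit 2 hu hq)

theorem comp_noObligation (hℓ : Comp d ℓ) :
    CompPred d fun s => NoObligation (s.arr 0) (ℓ s) :=
  CompPred.forall_lt (p := fun q s => ¬ InPair 2 (s.arr 0) (ℓ s) q) comp_zero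
    fun _ hd _ hx => (comp_inPair 2 (hℓ.mono hd) hx).not

theorem comp_inPost (c : ℕ) (hℓ : Comp d ℓ) (ha : Comp d a) (hq' : Comp d q') :
    CompPred d fun s => InPost c (s.arr 0) (ℓ s) (a s) (q' s) :=
  CompPred.exists_lt (p := fun q s => InPair c (s.arr 0) (ℓ s) q ∧
      ∃ b < s.arr 0 2, Succ (s.arr 0) q (a s) b (q' s)) comp_zero
    fun _ hd x hx => (comp_inPair c (hℓ.mono hd) hx).and
      (CompPred.exists_lt (p := fun b s => Succ (s.arr 0) (x s) (a s) b (q' s)) comp_two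
        fun _ hd' _ hy => comp_succ (hx.mono hd') (ha.mono (hd.trans hd')) hy
          (hq'.mono (hd.trans hd')))

theorem comp_blocked (hℓ : Comp d ℓ) (ha : Comp d a) (hu : Comp d u) :
    CompPred d fun s => Blocked (s.arr 0) (ℓ s) (a s) (u s) :=
  CompPred.exists_lt (p := fun q s => InPair 2 (s.arr 0) (ℓ s) q ∧ ∃ b < s.arr 0 2,
      ∀ q' < s.arr 0 0, ¬ (Succ (s.arr 0) q (a s) b q' ∧ InWitness (s.arr 0) (u s) q')) comp_zero
    fun _ hd x hx => (comp_inPair 2 (hℓ.mono hd) hx).and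
      (CompPred.exists_lt (p := fun b s => ∀ q' < s.arr 0 0,
          ¬ (Succ (s.arr 0) (x s) (a s) b q' ∧ InWitness (s.arr 0) (u s) q')) comp_two
        fun _ hd' y hy => CompPred.forall_lt (p := fun q' s =>
            ¬ (Succ (s.arr 0) (x s) (a s) (y s) q' ∧ InWitness (s.arr 0) (u s) q')) comp_zero
          fun _ hd'' _ hz => ((comp_succ (hx.mono (hd'.trans hd''))
            (ha.mono ((hd.trans hd').trans hd'')) (hy.mono hd'') hz).and
              (comp_inWitness (hu.mono ((hd.trans hd').trans hd'')) hz)).not)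

theorem comp_consistent (hℓ : Comp d ℓ) (ha : Comp d a) (hγ : Comp d γ) :
    CompPred d fun s => Consistent (s.arr 0) (ℓ s) (a s) (γ s) :=
  CompPred.exists_lt (p := fun q' s => InPost 1 (s.arr 0) (ℓ s) (a s) q' ∧
      HasObs (s.arr 0) q' (γ s)) comp_zero
    fun _ hd _ hx => (comp_inPost 1 (hℓ.mono hd) (ha.mono hd) hx).and
      (comp_hasObs hx (hγ.mono hd))

theorem comp_inNewBelief (hℓ : Comp d ℓ) (ha : Comp d a) (hγ : Comp d γ) (hq' : Comp d q') :
    CompPred d fun s => InNewBelief (s.arr 0) (ℓ s) (a s) (γ s) (q' s) :=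
  ((comp_inPost 1 hℓ ha hq').and (comp_hasObs hq' hγ)).and (comp_isTarget hq').not

theorem comp_inNewObligation (hℓ : Comp d ℓ) (ha : Comp d a) (hu : Comp d u) (hγ : Comp d γ)
    (hq' : Comp d q') :
    CompPred d fun s => InNewObligation (s.arr 0) (ℓ s) (a s) (u s) (γ s) (q' s) :=
  (((comp_inPost 2 hℓ ha hq').and (comp_hasObs hq' hγ)).and (comp_inWitness hu hq')).and
    (comp_isTarget hq').not

open Classical in
theorem comp_newDigit (hℓ : Comp d ℓ) (ha : Comp d a) (hu : Comp d u) (hγ : Comp d γ)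
    (hq' : Comp d q') :
    Comp d fun s => newDigit (s.arr 0) (ℓ s) (a s) (u s) (γ s) (q' s) :=
  Comp.ite (comp_noObligation hℓ)
    (Comp.ite (comp_inNewBelief hℓ ha hγ hq') (Comp.lit 2) (Comp.lit 0))
    (Comp.ite (comp_inNewObligation hℓ ha hu hγ hq') (Comp.lit 2)
      (Comp.ite (comp_inNewBelief hℓ ha hγ hq') (Comp.lit 1) (Comp.lit 0)))

open Classical in
theorem comp_next (hℓ : Comp d ℓ) (ha : Comp d a) (hu : Comp d u) (hγ : Comp d γ) :
    Comp d fun s => next (s.arr 0) (ℓ s) (a s) (u s) (γ s) :=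
  Comp.ite (CompPred.le (comp_pow 3) hℓ) hℓ
    (Comp.ite (CompPred.eq_zero hℓ) hℓ
      (Comp.ite (comp_blocked hℓ ha hu) (comp_pow 3)
        (Comp.ite (comp_consistent hℓ ha hγ).not ((comp_pow 3).add (Comp.lit 1))
          (Comp.sum (body := fun q s => newDigit (s.arr 0) (ℓ s) (a s) (u s) (γ s) q *
              3 ^ (q - (q - s.arr 0 0))) comp_zero
            fun _ hd _ hx => (comp_newDigit (hℓ.mono hd) (ha.mono hd) (hu.mono hd) (hγ.mono hd)
              hx).mul (comp_min_pow 3 hx)))))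

open Classical in
theorem comp_init : Comp d fun s => init (s.arr 0) :=
  Comp.ite (comp_isTarget comp_four) (Comp.lit 0) ((Comp.lit 2).mul (comp_min_pow 3 comp_four))

theorem comp_accepting (hℓ : Comp d ℓ) : CompPred d fun s => Accepting (s.arr 0) (ℓ s) :=
  (((CompPred.le (comp_pow 3) hℓ).and (CompPred.eq hℓ ((comp_pow 3).add (Comp.lit 1)))).not.and
    ((CompPred.lt hℓ (comp_pow 3)).and (comp_noObligation hℓ)).not).not

theorem comp_numStates : Comp d fun s => numStates (s.arr 0) := (comp_pow 3).add (Comp.lit 2)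

theorem comp_numActions : Comp d fun s => numActions (s.arr 0) := comp_one.mul (comp_pow 2)

theorem comp_length : Comp d fun s => length (s.arr 0) :=
  ((Comp.lit 4).add comp_numStates).add ((comp_numStates.mul comp_numActions).mul comp_three)

theorem comp_tableEntry (hj : Comp d j) : Comp d fun s => tableEntry (s.arr 0) (j s) :=
  comp_next ((hj.div comp_three).div comp_numActions)
    (((hj.div comp_three).mod comp_numActions).div (comp_pow 2))
    (((hj.div comp_three).mod comp_numActions).mod (comp_pow 2)) (hj.mod comp_three)

open Classical in
theorem comp_entry (hi : Comp d i) : Comp d fun s => entry (s.arr 0) (i s) :=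
  Comp.ite (CompPred.lt hi (Comp.lit 4))
    (Comp.ite (CompPred.eq_zero hi) comp_numStates
      (Comp.ite (CompPred.eq hi (Comp.lit 1)) comp_numActions
        (Comp.ite (CompPred.eq hi (Comp.lit 2)) comp_three comp_init)))
    (Comp.ite (CompPred.lt (hi.sub (Comp.lit 4)) comp_numStates)
      (comp_accepting (hi.sub (Comp.lit 4)))
      (comp_tableEntry ((hi.sub (Comp.lit 4)).sub comp_numStates)))

end Comp

end BeliefTable

open Polynomial in
/-- If the length and the entries of a word can be computed in polynomial time, then so can the
word. -/
theorem exists_program_of_comp {len : (ℕ → ℕ) → ℕ} {entry : (ℕ → ℕ) → ℕ → ℕ}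
    (hlen : Comp 1 fun s => len (s.arr 0)) (hentry : Comp 3 fun s => entry (s.arr 0) (s.var 2)) :
    ∃ (P : RProg) (c : ℕ), ∀ w : List ℕ, (RStore.input w).Valid →
      P.OutputsWithin w ((List.range (len ((RStore.input w).arr 0))).map
        (entry ((RStore.input w).arr 0))) ((RStore.input w).size ^ c) := by
  obtain ⟨Pl, hPl⟩ := hlen.bdd
  obtain ⟨pl, Tl, hTl⟩ := hlen.prog 1 le_rfl
  obtain ⟨pe, Te, hTe⟩ := hentry.prog 3 le_rfl
  obtain ⟨c, hc⟩ := (Tl + Pl * (Te.comp (X + Pl) + C 15) + C 15).exists_eval_le_pow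
  refine ⟨.seq pl (.seq (.assign 2 (.lit 0)) (.seq
    (.loop (.sub (.var 1) (.var 2)) (.seq pe (.seq (.put 1 (.var 2) (.var 3))
      (.assign 2 (.add (.var 2) (.lit 1)))))) (.assign 0 (.var 1)))), c, fun w hw => ?_⟩
  set s := RStore.input w with hs
  set L := len (s.arr 0) with hL
  have hLb : L ≤ Pl.eval s.size := hPl s 0 hw fun i _ => Nat.le_refl 0
  obtain ⟨t₁, s₁, r₁, v₁, k₁, a₁, b₁⟩ := hTl s 0 hw fun i _ => Nat.le_refl 0
  -- Variable 1 holds the length, 2 the index and 3 the current entry. Writing to array 1 preserves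
  -- the input in array 0, the only array on which the entries depend.
  let I : ℕ → RStore → Prop := fun j st => st.arr 0 = s.arr 0 ∧ st.var 0 = 0 ∧ st.var 1 = L ∧
    st.var 2 = j ∧ ∀ i < j, st.arr 1 i = entry (s.arr 0) i
  obtain ⟨t₂, s₂, r₂, ⟨-, -, v₂, -, o₂⟩, b₂⟩ := RProg.loop_runs
    (e := .sub (.var 1) (.var 2)) (p := .seq pe (.seq (.put 1 (.var 2) (.var 3))
      (.assign 2 (.add (.var 2) (.lit 1))))) I L (Te.eval (s.size + Pl.eval s.size) + 7) (by
      rintro j hj st ⟨ia, i0, i1, i2, io⟩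
      refine ⟨by simp only [RExpr.eval, i1, i2]; omega, ?_⟩
      have hv : st.Valid := by
        unfold RStore.Valid
        rw [ia]
        exact hw
      have hsz : st.size = s.size := by
        unfold RStore.size
        rw [ia]
      obtain ⟨t, s', r, v, k, a, b⟩ := hTe st (Pl.eval s.size) hv (by
        intro i hi
        rcases (by omega : i = 0 ∨ i = 1 ∨ i = 2) with rfl | rfl | rfl <;> omega)
      refine ⟨_, _, .seq r (.seq (.put _ _ _ _) (.assign _ _ _)), ?_, ?_, ?_, ?_, ?_, ?_⟩
      · rw [hsz] at b
        simp only [RExpr.cost]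
        omega
      · simp [RStore.setVar, RStore.setArr, a, ia]
      · simp [RStore.setVar, RStore.setArr, k 0 (by omega), i0]
      · simp [RStore.setVar, RStore.setArr, k 1 (by omega), i1]
      · simp [RStore.setVar, RStore.setArr, RExpr.eval, k 2 (by omega), i2]
      · intro i hi
        simp only [RStore.setVar, RStore.setArr, RExpr.eval, Function.update_self,
          k 2 (by omega), i2, v, ia]
        rcases Nat.lt_succ_iff_lt_or_eq.mp hi with hi | rfl
        · rw [Function.update_of_ne hi.ne, a, io i hi]
        · rw [Function.update_self])
    (by
      rintro st ⟨-, -, i1, i2, -⟩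
      simp only [RExpr.eval, i1, i2]
      omega) (s₁.setVar 2 0) (by
      refine ⟨by simp [RStore.setVar, a₁], ?_, ?_, ?_, fun i hi => by omega⟩
      · simp only [RStore.setVar]
        rw [Function.update_of_ne (by omega), k₁ 0 (by omega)]
        rfl
      · simp only [RStore.setVar]
        rw [Function.update_of_ne (by omega), v₁]
      · simp [RStore.setVar])
  refine ⟨_, ?_, _, .seq r₁ (.seq (.assign _ _ _) (.seq r₂ (.assign _ _ _))), ?_, ?_⟩
  · refine le_trans ?_ (hc _ hw.two_le_size)
    simp only [eval_add, eval_mul, eval_comp, eval_X, eval_C, RExpr.cost] at b₁ b₂ ⊢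
    have h1 := Nat.mul_le_mul_right (Te.eval (s.size + Pl.eval s.size) + 15) hLb
    have h2 : L * (Te.eval (s.size + Pl.eval s.size) + 7 + (1 + 1 + 1) + 1) ≤
        L * (Te.eval (s.size + Pl.eval s.size) + 15) := Nat.mul_le_mul_left _ (by omega)
    rw [add_zero] at b₁
    omega
  · simp [RStore.setVar, RExpr.eval, v₂]
  · intro i hi
    rw [List.length_map, List.length_range] at hi
    rw [List.getD_eq_getElem _ _ (by simpa using hi)]
    simp only [RStore.setVar, List.getElem_map, List.getElem_range]
    exact o₂ i hi

theorem BeliefTable.exists_program : ∃ (P : RProg) (c : ℕ), ∀ w : List ℕ,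
    (RStore.input w).Valid → P.OutputsWithin w
      ((List.range (length ((RStore.input w).arr 0))).map (entry ((RStore.input w).arr 0)))
      ((RStore.input w).size ^ c) :=
  exists_program_of_comp comp_length (comp_entry (Comp.var (by omega)))

/-! ### Numbering of the states and actions of the belief game -/

namespace BeliefState

variable {Q : Type*}

open Classical in
/-- A pair of a belief and an obligation set, as a function. -/
noncomputable def digits (s o : Set Q) (q : Q) : Fin 3 := if q ∈ o then 2 else if q ∈ s then 1 else 0

theorem one_le_digits {s o : Set Q} (h : o ⊆ s) (q : Q) : 1 ≤ (digits s o q : ℕ) ↔ q ∈ s := by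
  unfold digits
  by_cases h1 : q ∈ o
  · simp [h1, h h1]
  · by_cases h2 : q ∈ s <;> simp [h1, h2]

theorem two_le_digits (s o : Set Q) (q : Q) : 2 ≤ (digits s o q : ℕ) ↔ q ∈ o := by
  unfold digits
  by_cases h1 : q ∈ o
  · simp [h1]
  · by_cases h2 : q ∈ s <;> simp [h1, h2]

/-- The states of the belief game, as functions. -/
noncomputable def equivSum (Q : Type*) : BeliefState Q ≃ (Q → Fin 3) ⊕ Fin 2 where
  toFun
    | .pair s o _ => .inl (digits s o)
    | .lost₁ => .inr 0
    | .lost₂ => .inr 1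
  invFun
    | .inl f => .pair {q | 1 ≤ (f q : ℕ)} {q | 2 ≤ (f q : ℕ)} <| by
      intro q hq
      rw [Set.mem_ofPred_eq] at hq ⊢
      omega
    | .inr 0 => .lost₁
    | .inr 1 => .lost₂
  left_inv := by
    rintro (⟨s, o, h⟩ | _ | _)
    · simp only [one_le_digits h, two_le_digits, Set.ofPred_mem_eq]
    · rfl
    · rfl
  right_inv := by
    rintro (f | i)
    · simp only [Sum.inl.injEq]
      funext q
      unfold digits
      have := (f q).isLt
      ext
      by_cases h1 : 2 ≤ (f q : ℕ)
      · simp only [Set.mem_ofPred_eq, h1, if_true]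
        change 2 = _
        omega
      · by_cases h2 : 1 ≤ (f q : ℕ)
        · simp only [Set.mem_ofPred_eq, h1, h2, if_true, if_false]
          change 1 = _
          omega
        · simp only [Set.mem_ofPred_eq, h1, h2, if_false]
          change 0 = _
          omega
    · fin_cases i <;> rfl

/-- The numbering of the states of the belief game. -/
noncomputable def number {n : ℕ} (eQ : Q ≃ Fin n) : BeliefState Q ≃ Fin (3 ^ n + 2) :=
  (equivSum Q).trans ((Equiv.sumCongr ((eQ.arrowCongr (Equiv.refl _)).trans finFunctionFinEquiv)
    (Equiv.refl _)).trans finSumFinEquiv)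

theorem number_pair {n : ℕ} (eQ : Q ≃ Fin n) {s o : Set Q} (h : o ⊆ s) :
    (number eQ (.pair s o h) : ℕ) = ∑ i : Fin n, (digits s o (eQ.symm i) : ℕ) * 3 ^ (i : ℕ) := rfl

theorem number_pair_lt {n : ℕ} (eQ : Q ≃ Fin n) {s o : Set Q} (h : o ⊆ s) :
    (number eQ (.pair s o h) : ℕ) < 3 ^ n :=
  (finFunctionFinEquiv fun i => digits s o (eQ.symm i)).isLt

theorem number_lost₁ {n : ℕ} (eQ : Q ≃ Fin n) : (number eQ .lost₁ : ℕ) = 3 ^ n := rfl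

theorem number_lost₂ {n : ℕ} (eQ : Q ≃ Fin n) : (number eQ .lost₂ : ℕ) = 3 ^ n + 1 := rfl

/-- All digits vanish exactly when the belief is empty; this is why the table may test the absorbing
empty pair by comparison with 0. -/
theorem number_pair_eq_zero_iff {n : ℕ} (eQ : Q ≃ Fin n) {s o : Set Q} (h : o ⊆ s) :
    (number eQ (.pair s o h) : ℕ) = 0 ↔ s = ∅ := by
  rw [number_pair, Finset.sum_eq_zero_iff, Set.eq_empty_iff_forall_notMem]
  constructor
  · intro h' q hq
    have h1 := h' (eQ q) (Finset.mem_univ _)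
    rw [Equiv.symm_apply_apply] at h1
    have h2 := (one_le_digits h q).mpr hq
    have : 0 < (digits s o q : ℕ) * 3 ^ (eQ q : ℕ) := by positivity
    omega
  · intro h' i _
    have h2 : ¬ 1 ≤ (digits s o (eQ.symm i) : ℕ) := fun h3 => h' _ ((one_le_digits h _).mp h3)
    have : (digits s o (eQ.symm i) : ℕ) = 0 := by omega
    rw [this, zero_mul]

end BeliefState

open Classical in
/-- Sets as functions. -/
noncomputable def Set.equivFunFinTwo (Q : Type*) : Set Q ≃ (Q → Fin 2) where
  toFun u q := if q ∈ u then 1 else 0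
  invFun f := {q | 1 ≤ (f q : ℕ)}
  left_inv u := by
    ext q
    by_cases h : q ∈ u <;> simp [h]
  right_inv f := by
    funext q
    have := (f q).isLt
    ext
    by_cases h : 1 ≤ (f q : ℕ)
    · simp only [Set.mem_ofPred_eq, h, if_true]
      change 1 = _
      omega
    · simp only [Set.mem_ofPred_eq, h, if_false]
      change 0 = _
      omega

/-- The numbering of the sets. -/
noncomputable def Set.number {Q : Type*} {n : ℕ} (eQ : Q ≃ Fin n) : Set Q ≃ Fin (2 ^ n) :=
  (Set.equivFunFinTwo Q).trans ((eQ.arrowCongr (Equiv.refl _)).trans finFunctionFinEquiv)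

/-- The numbering of the actions of player 1 in the belief game. -/
noncomputable def witnessActionNumber {Q A₁ : Type*} {n m : ℕ} (eQ : Q ≃ Fin n) (e₁ : A₁ ≃ Fin m) :
    A₁ × Set Q ≃ Fin (m * 2 ^ n) :=
  (Equiv.prodCongr e₁ (Set.number eQ)).trans finProdFinEquiv

theorem witnessActionNumber_apply {Q A₁ : Type*} {n m : ℕ} (eQ : Q ≃ Fin n) (e₁ : A₁ ≃ Fin m)
    (a : A₁) (u : Set Q) : (witnessActionNumber eQ e₁ (a, u) : ℕ) =
      (Set.number eQ u : ℕ) + 2 ^ n * (e₁ a : ℕ) := rfl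

theorem witnessActionNumber_div {Q A₁ : Type*} {n m : ℕ} (eQ : Q ≃ Fin n) (e₁ : A₁ ≃ Fin m)
    (x : A₁ × Set Q) : (witnessActionNumber eQ e₁ x : ℕ) / 2 ^ n = e₁ x.1 := by
  rw [← Prod.mk.eta (p := x), witnessActionNumber_apply, Nat.add_mul_div_left _ _ (by positivity),
    Nat.div_eq_of_lt (Set.number eQ x.2).isLt, zero_add]

theorem witnessActionNumber_mod {Q A₁ : Type*} {n m : ℕ} (eQ : Q ≃ Fin n) (e₁ : A₁ ≃ Fin m)
    (x : A₁ × Set Q) : (witnessActionNumber eQ e₁ x : ℕ) % 2 ^ n = Set.number eQ x.2 := by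
  rw [← Prod.mk.eta (p := x), witnessActionNumber_apply, Nat.add_mul_mod_self_left,
    Nat.mod_eq_of_lt (Set.number eQ x.2).isLt]

/-! ### Correctness of the computed table. -/

namespace BeliefTable

theorem digit_finFunctionFinEquiv {n b : ℕ} {w : ℕ → ℕ} (hw : w 0 = n) (f : Fin n → Fin b)
    (i : Fin n) : digit b w (finFunctionFinEquiv f) i = f i := by
  have h : ∀ c : Fin (b ^ n), ((finFunctionFinEquiv.symm c i : Fin b) : ℕ) =
      (c : ℕ) / b ^ (i : ℕ) % b := fun _ => rfl
  have h1 := h (finFunctionFinEquiv f)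
  rw [Equiv.symm_apply_apply] at h1
  have := i.isLt
  rw [digit, h1, hw, Nat.sub_eq_zero_of_le i.isLt.le, Nat.sub_zero]

/-- The word `w` describes the game `G` and the set `T` for the given numberings. -/
structure Reads {Q A₁ A₂ : Type*} (G : StochGame Q A₁ A₂) (T : Set Q) (w : ℕ → ℕ)
    {n m₁ m₂ k : ℕ} (eQ : Q ≃ Fin n) (e₁ : A₁ ≃ Fin m₁) (e₂ : A₂ ≃ Fin m₂)
    (eO : G.view₁.Obs ≃ Fin k) : Prop where
  numStates : w 0 = n
  numActions₁ : w 1 = m₁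
  numActions₂ : w 2 = m₂
  numObs : w 3 = k
  init : w 4 = eQ G.init
  obs : ∀ q, w (5 + eQ q) = eO (G.view₁.obs q)
  target : ∀ q, w (5 + n + eQ q) = 1 ↔ q ∈ T
  succ : ∀ q a b q', w (5 + 2 * n + 2 * (((eQ q * m₁ + e₁ a) * m₂ + e₂ b) * n + eQ q')) ≠ 0 ↔
    q' ∈ (G.δ q a b).support

/-- Translates the bounded quantifiers of the table into quantifiers over states or actions. -/
theorem exists_lt_iff_of_equiv {Q : Type*} {n m : ℕ} (hm : m = n) (e : Q ≃ Fin n) (p : ℕ → Prop) :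
    (∃ i < m, p i) ↔ ∃ q, p (e q) := by
  subst hm
  constructor
  · rintro ⟨i, hi, h⟩
    exact ⟨e.symm ⟨i, hi⟩, by simpa using h⟩
  · rintro ⟨q, h⟩
    exact ⟨e q, (e q).isLt, h⟩

theorem forall_lt_iff_of_equiv {Q : Type*} {n m : ℕ} (hm : m = n) (e : Q ≃ Fin n) (p : ℕ → Prop) :
    (∀ i < m, p i) ↔ ∀ q, p (e q) := by
  have := exists_lt_iff_of_equiv hm e fun i => ¬ p i
  rw [← not_iff_not]
  push Not
  exact this

namespace Reads

variable {Q A₁ A₂ : Type*} {G : StochGame Q A₁ A₂} {T : Set Q} {w : ℕ → ℕ}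
  {n m₁ m₂ k : ℕ} {eQ : Q ≃ Fin n} {e₁ : A₁ ≃ Fin m₁} {e₂ : A₂ ≃ Fin m₂}
  {eO : G.view₁.Obs ≃ Fin k} {s o u : Set Q} {h : o ⊆ s} {a : A₁} {b : A₂} {γ : G.view₁.Obs}
  {q q' : Q}

theorem succ_iff (hw : Reads G T w eQ e₁ e₂ eO) :
    Succ w (eQ q) (e₁ a) (e₂ b) (eQ q') ↔ q' ∈ (G.δ q a b).support := by
  rw [Succ, hw.numStates, hw.numActions₁, hw.numActions₂, hw.succ]

theorem hasObs_iff (hw : Reads G T w eQ e₁ e₂ eO) :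
    HasObs w (eQ q) (eO γ) ↔ q ∈ G.cls γ := by
  rw [HasObs, hw.obs, Fin.val_inj, eO.apply_eq_iff_eq]
  rfl

theorem isTarget_iff (hw : Reads G T w eQ e₁ e₂ eO) : IsTarget w (eQ q) ↔ q ∈ T := by
  rw [IsTarget, hw.numStates, hw.target]

theorem digit_number (hw : Reads G T w eQ e₁ e₂ eO) :
    digit 3 w (BeliefState.number eQ (.pair s o h)) (eQ q) = BeliefState.digits s o q := by
  have := digit_finFunctionFinEquiv hw.numStates (fun i => BeliefState.digits s o (eQ.symm i)) (eQ q)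
  rw [Equiv.symm_apply_apply] at this
  exact this

theorem inPair_one_iff (hw : Reads G T w eQ e₁ e₂ eO) :
    InPair 1 w (BeliefState.number eQ (.pair s o h)) (eQ q) ↔ q ∈ s := by
  rw [InPair, hw.digit_number, BeliefState.one_le_digits h]

theorem inPair_two_iff (hw : Reads G T w eQ e₁ e₂ eO) :
    InPair 2 w (BeliefState.number eQ (.pair s o h)) (eQ q) ↔ q ∈ o := by
  rw [InPair, hw.digit_number, BeliefState.two_le_digits]

theorem inWitness_iff (hw : Reads G T w eQ e₁ e₂ eO) :
    InWitness w (Set.number eQ u) (eQ q) ↔ q ∈ u := by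
  have h1 := digit_finFunctionFinEquiv hw.numStates
    (fun i => Set.equivFunFinTwo Q u (eQ.symm i)) (eQ q)
  rw [Equiv.symm_apply_apply] at h1
  have h2 : digit 2 w (Set.number eQ u) (eQ q) = (Set.equivFunFinTwo Q u q : ℕ) := h1
  rw [InWitness, h2]
  exact Set.ext_iff.mp ((Set.equivFunFinTwo Q).symm_apply_apply u) q

theorem noObligation_iff (hw : Reads G T w eQ e₁ e₂ eO) :
    NoObligation w (BeliefState.number eQ (.pair s o h)) ↔ o = ∅ := by
  rw [NoObligation, forall_lt_iff_of_equiv hw.numStates eQ, Set.eq_empty_iff_forall_notMem]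
  simp only [hw.inPair_two_iff]

theorem inPost_one_iff (hw : Reads G T w eQ e₁ e₂ eO) :
    InPost 1 w (BeliefState.number eQ (.pair s o h)) (e₁ a) (eQ q') ↔ q' ∈ G.Post a s := by
  rw [InPost, exists_lt_iff_of_equiv hw.numStates eQ]
  simp only [exists_lt_iff_of_equiv hw.numActions₂ e₂, hw.inPair_one_iff, hw.succ_iff]
  rfl

theorem inPost_two_iff (hw : Reads G T w eQ e₁ e₂ eO) :
    InPost 2 w (BeliefState.number eQ (.pair s o h)) (e₁ a) (eQ q') ↔ q' ∈ G.Post a o := by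
  rw [InPost, exists_lt_iff_of_equiv hw.numStates eQ]
  simp only [exists_lt_iff_of_equiv hw.numActions₂ e₂, hw.inPair_two_iff, hw.succ_iff]
  rfl

theorem blocked_iff (hw : Reads G T w eQ e₁ e₂ eO) :
    Blocked w (BeliefState.number eQ (.pair s o h)) (e₁ a) (Set.number eQ u) ↔
      ¬ ∀ q ∈ o, ∀ b : A₂, ((G.δ q a b).support ∩ u).Nonempty := by
  rw [Blocked, exists_lt_iff_of_equiv hw.numStates eQ]
  simp only [exists_lt_iff_of_equiv hw.numActions₂ e₂, forall_lt_iff_of_equiv hw.numStates eQ,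
    hw.inPair_two_iff, hw.succ_iff, hw.inWitness_iff]
  simp only [Set.Nonempty, Set.mem_inter_iff]
  push Not
  rfl

theorem consistent_iff (hw : Reads G T w eQ e₁ e₂ eO) :
    Consistent w (BeliefState.number eQ (.pair s o h)) (e₁ a) (eO γ) ↔
      (G.Post a s ∩ G.cls γ).Nonempty := by
  rw [Consistent, exists_lt_iff_of_equiv hw.numStates eQ]
  simp only [hw.inPost_one_iff, hw.hasObs_iff]
  rfl

theorem inNewBelief_iff (hw : Reads G T w eQ e₁ e₂ eO) :
    InNewBelief w (BeliefState.number eQ (.pair s o h)) (e₁ a) (eO γ) (eQ q') ↔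
      q' ∈ (G.Post a s ∩ G.cls γ) \ T := by
  rw [InNewBelief, hw.inPost_one_iff, hw.hasObs_iff, hw.isTarget_iff]
  rfl

theorem inNewObligation_iff (hw : Reads G T w eQ e₁ e₂ eO) :
    InNewObligation w (BeliefState.number eQ (.pair s o h)) (e₁ a) (Set.number eQ u) (eO γ)
      (eQ q') ↔ q' ∈ (G.Post a o ∩ G.cls γ ∩ u) \ T := by
  rw [InNewObligation, hw.inPost_two_iff, hw.hasObs_iff, hw.isTarget_iff, hw.inWitness_iff]
  rfl

theorem sum_eq (hw : Reads G T w eQ e₁ e₂ eO) (F : ℕ → ℕ) {s' o' : Set Q} (h' : o' ⊆ s')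
    (hF : ∀ q, F (eQ q) = BeliefState.digits s' o' q) :
    ∑ i ∈ Finset.range (w 0), F i * 3 ^ (i - (i - w 0)) =
      BeliefState.number eQ (.pair s' o' h') := by
  rw [BeliefState.number_pair, hw.numStates, Finset.sum_range]
  refine Finset.sum_congr rfl fun i _ => ?_
  have h1 := hF (eQ.symm i)
  rw [Equiv.apply_symm_apply] at h1
  rw [h1, Nat.sub_eq_zero_of_le i.isLt.le, Nat.sub_zero]

/-- The case distinctions of `next` and `beliefStep` come in the same order, so they are matched
branch by branch; in the last one the digits are compared. -/
theorem next_eq (hw : Reads G T w eQ e₁ e₂ eO) (ℓ : BeliefState Q) :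
    next w (BeliefState.number eQ ℓ) (e₁ a) (Set.number eQ u) (eO γ) =
      BeliefState.number eQ (G.beliefStep T ℓ (a, u) γ) := by
  rcases ℓ with ⟨s, o, h⟩ | _ | _
  · rw [next, if_neg (by rw [hw.numStates]; exact not_le.mpr (BeliefState.number_pair_lt eQ h))]
    by_cases hs : s = ∅
    · rw [if_pos ((BeliefState.number_pair_eq_zero_iff eQ h).mpr hs)]
      subst hs
      rw [StochGame.beliefStep_empty]
    rw [if_neg (mt (BeliefState.number_pair_eq_zero_iff eQ h).mp hs)]
    by_cases hu : ∀ q ∈ o, ∀ b : A₂, ((G.δ q a b).support ∩ u).Nonempty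
    · rw [if_neg (by rw [hw.blocked_iff]; exact not_not.mpr hu)]
      by_cases hp : (G.Post a s ∩ G.cls γ).Nonempty
      · rw [if_neg (by rw [hw.consistent_iff]; exact not_not.mpr hp)]
        obtain ⟨o', h', e, h1, h2⟩ := StochGame.beliefStep_pair (T := T) (h := h)
          (Set.nonempty_iff_ne_empty.mpr hs) hu hp
        rw [e]
        refine hw.sum_eq (newDigit w (BeliefState.number eQ (.pair s o h)) (e₁ a)
          (Set.number eQ u) (eO γ)) h' fun q => ?_
        unfold newDigit BeliefState.digits
        by_cases ho : o = ∅
        · rw [if_pos (hw.noObligation_iff.mpr ho), h1 ho]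
          by_cases hq : q ∈ (G.Post a s ∩ G.cls γ) \ T
          · rw [if_pos (hw.inNewBelief_iff.mpr hq), if_pos hq]
            rfl
          · rw [if_neg (mt hw.inNewBelief_iff.mp hq), if_neg hq, if_neg hq]
            rfl
        · rw [if_neg (mt hw.noObligation_iff.mp ho), h2 ho]
          by_cases hq : q ∈ (G.Post a o ∩ G.cls γ ∩ u) \ T
          · rw [if_pos (hw.inNewObligation_iff.mpr hq), if_pos hq]
            rfl
          · rw [if_neg (mt hw.inNewObligation_iff.mp hq), if_neg hq]
            by_cases hq : q ∈ (G.Post a s ∩ G.cls γ) \ T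
            · rw [if_pos (hw.inNewBelief_iff.mpr hq), if_pos hq]
              rfl
            · rw [if_neg (mt hw.inNewBelief_iff.mp hq), if_neg hq]
              rfl
      · rw [if_pos (mt hw.consistent_iff.mp hp), StochGame.beliefStep_disjoint
          (Set.nonempty_iff_ne_empty.mpr hs) hu hp, BeliefState.number_lost₂, hw.numStates]
    · rw [if_pos (hw.blocked_iff.mpr hu), StochGame.beliefStep_blocked
        (Set.nonempty_iff_ne_empty.mpr hs) hu, BeliefState.number_lost₁, hw.numStates]
  · rw [next, if_pos (by rw [BeliefState.number_lost₁, hw.numStates])]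
    rfl
  · rw [next, if_pos (by rw [BeliefState.number_lost₂, hw.numStates]; omega)]
    rfl

theorem init_eq (hw : Reads G T w eQ e₁ e₂ eO) :
    BeliefTable.init w = BeliefState.number eQ (G.beliefInit T) := by
  rw [BeliefTable.init, hw.init, StochGame.beliefInit]
  by_cases hT : G.init ∈ T
  · rw [if_pos (hw.isTarget_iff.mpr hT), if_pos hT,
      (BeliefState.number_pair_eq_zero_iff eQ _).mpr rfl]
  · rw [if_neg (mt hw.isTarget_iff.mp hT), if_neg hT, BeliefState.number_pair,
      Finset.sum_eq_single (eQ G.init)]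
    · rw [hw.numStates, Nat.sub_eq_zero_of_le (eQ G.init).isLt.le, Nat.sub_zero,
        Equiv.symm_apply_apply, BeliefState.digits, if_pos (Set.mem_singleton _)]
      rfl
    · intro i _ hi
      have : eQ.symm i ∉ ({G.init} : Set Q) := fun h' => hi (by
        rw [← Set.mem_singleton_iff.mp h', Equiv.apply_symm_apply])
      rw [BeliefState.digits, if_neg this, if_neg this]
      exact zero_mul _
    · intro h'
      exact (h' (Finset.mem_univ _)).elim

theorem accepting_iff (hw : Reads G T w eQ e₁ e₂ eO) (ℓ : BeliefState Q) :
    Accepting w (BeliefState.number eQ ℓ) ↔ ℓ ∈ BeliefState.accepting Q := by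
  rw [Accepting, ← not_or, not_not, hw.numStates]
  rcases ℓ with ⟨s, o, h⟩ | _ | _
  · have := BeliefState.number_pair_lt eQ h
    rw [hw.noObligation_iff, StochGame.pair_mem_accepting_iff]
    constructor
    · rintro (⟨h1, -⟩ | ⟨-, h1⟩)
      · omega
      · exact h1
    · exact fun h1 => Or.inr ⟨this, h1⟩
  · rw [BeliefState.number_lost₁]
    constructor
    · rintro (⟨-, h1⟩ | ⟨h1, -⟩) <;> omega
    · exact fun h1 => (StochGame.lost₁_notMem_accepting h1).elim
  · rw [BeliefState.number_lost₂]
    exact ⟨fun _ => Or.inr rfl, fun _ => Or.inl ⟨by omega, rfl⟩⟩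

end Reads

end BeliefTable

/-! ### Positions in words, and the input and output descriptions. -/

theorem List.length_flatMap_finRange {a b : ℕ} (L : Fin a → List ℕ) (h : ∀ i, (L i).length = b) :
    ((List.finRange a).flatMap L).length = a * b := by
  simp [List.length_flatMap, h]

theorem List.getD_flatMap_finRange {a b : ℕ} (L : Fin a → List ℕ) (h : ∀ i, (L i).length = b)
    (i : Fin a) {t : ℕ} (ht : t < b) (l : List ℕ) :
    ((List.finRange a).flatMap L ++ l).getD (i * b + t) 0 = (L i).getD t 0 := by
  induction a with
  | zero => exact i.elim0
  | succ a ih =>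
    rw [List.finRange_succ, List.flatMap_cons, List.flatMap_map, List.append_assoc]
    induction i using Fin.cases with
    | zero =>
      rw [List.getD_append _ _ _ _ (by rw [h]; simpa using ht)]
      simp
    | succ i =>
      rw [List.getD_append_right _ _ _ _ (by rw [h, Fin.val_succ, Nat.succ_mul]; omega), h,
        ← ih (fun i => L i.succ) (fun i => h _) i]
      congr 1
      rw [Fin.val_succ, Nat.succ_mul]
      omega

theorem List.getD_map_finRange {a : ℕ} (f : Fin a → ℕ) (i : Fin a) (l : List ℕ) :
    ((List.finRange a).map f ++ l).getD i 0 = f i := by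
  rw [List.getD_append _ _ _ _ (by simp), List.getD_eq_getElem _ _ (by simp)]
  simp

namespace StochGame

variable {Q A₁ A₂ : Type*} {G : StochGame Q A₁ A₂} {T : Set Q}

theorem Describes.exists_reads {w : List ℕ} (h : G.Describes T w) :
    ∃ (n m₁ m₂ k : ℕ) (eQ : Q ≃ Fin n) (e₁ : A₁ ≃ Fin m₁) (e₂ : A₂ ≃ Fin m₂)
      (eO : G.view₁.Obs ≃ Fin k),
      BeliefTable.Reads G T ((RStore.input w).arr 0) eQ e₁ e₂ eO := by
  obtain ⟨n, m₁, m₂, k, eQ, e₁, e₂, eO, num, den, tgt, hδ, ht, rfl⟩ := h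
  refine ⟨n, m₁, m₂, k, eQ, e₁, e₂, eO, rfl, rfl, rfl, rfl, rfl, fun q => ?_, fun q => ?_,
    fun q a b q' => ?_⟩
  · simp only [RStore.input, if_true, List.append_assoc]
    rw [List.getD_append_right _ _ _ _ (by simp)]
    simp only [List.length_cons, List.length_nil, Nat.reduceAdd, Nat.add_sub_cancel_left]
    rw [List.getD_map_finRange, Equiv.symm_apply_apply]
  · simp only [RStore.input, if_true, List.append_assoc]
    rw [List.getD_append_right _ _ _ _ (by simp; omega),
      List.getD_append_right _ _ _ _ (by simp; omega)]
    simp only [List.length_cons, List.length_nil, Nat.reduceAdd, List.length_map,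
      List.length_finRange, Nat.add_assoc, Nat.add_sub_cancel_left]
    rw [List.getD_map_finRange, Equiv.symm_apply_apply]
    by_cases hq : q ∈ T
    · simp [(ht q).1 hq, hq]
    · simp [(ht q).2 hq, hq]
  · simp only [RStore.input, if_true, List.append_assoc]
    rw [List.getD_append_right _ _ _ _ (by simp; omega),
      List.getD_append_right _ _ _ _ (by simp; omega),
      List.getD_append_right _ _ _ _ (by simp; omega)]
    simp only [List.length_cons, List.length_nil, Nat.reduceAdd, List.length_map,
      List.length_finRange]
    have hx : ∀ N : ℕ, 5 + 2 * n + 2 * N - 5 - n - n = 2 * N := fun N => by omega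
    -- The index is split into offsets of nested blocks; the last `0` selects the numerator, a `1`
    -- would select the denominator.
    have hix : 2 * (((eQ q * m₁ + e₁ a) * m₂ + e₂ b) * n + eQ q' : ℕ) =
        eQ q * (m₁ * (m₂ * (n * 2))) + (e₁ a * (m₂ * (n * 2)) + (e₂ b * (n * 2) +
          (eQ q' * 2 + 0))) := by ring
    have l1 : (eQ q' * 2 + 0 : ℕ) < n * 2 := by have := (eQ q').isLt; omega
    have l2 : (e₂ b * (n * 2) + (eQ q' * 2 + 0) : ℕ) < m₂ * (n * 2) := by
      have := Nat.mul_le_mul_right (n * 2) (e₂ b).isLt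
      rw [Nat.succ_mul] at this
      omega
    have l3 : (e₁ a * (m₂ * (n * 2)) + (e₂ b * (n * 2) + (eQ q' * 2 + 0)) : ℕ) <
        m₁ * (m₂ * (n * 2)) := by
      have := Nat.mul_le_mul_right (m₂ * (n * 2)) (e₁ a).isLt
      rw [Nat.succ_mul] at this
      omega
    rw [hx, hix, ← List.append_nil (List.flatMap _ (List.finRange n)),
      List.getD_flatMap_finRange (b := m₁ * (m₂ * (n * 2))) _ (fun i =>
        List.length_flatMap_finRange _ fun x => List.length_flatMap_finRange _ fun y =>
          List.length_flatMap_finRange _ fun j => rfl) _ l3,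
      ← List.append_nil (List.flatMap _ (List.finRange m₁)),
      List.getD_flatMap_finRange (b := m₂ * (n * 2)) _ (fun x => List.length_flatMap_finRange _
        fun y => List.length_flatMap_finRange _ fun j => rfl) _ l2,
      ← List.append_nil (List.flatMap _ (List.finRange m₂)),
      List.getD_flatMap_finRange (b := n * 2) _ (fun y => List.length_flatMap_finRange _
        fun j => rfl) _ l1,
      ← List.append_nil (List.flatMap _ (List.finRange n)),
      List.getD_flatMap_finRange (b := 2) _ (fun j => rfl) _ (by omega)]
    simp only [Equiv.symm_apply_apply, List.getD_cons_zero]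
    -- A fraction with a finite denominator vanishes only with its numerator, so the support is
    -- visible without division.
    rw [PMF.mem_support_iff, (hδ q a b q').2, Ne, Ne, ENNReal.div_eq_zero_iff]
    simp

open Classical in
/-- The computed word describes the belief game. -/
theorem describesDet_beliefGame {w : ℕ → ℕ} {n m₁ m₂ k : ℕ} {eQ : Q ≃ Fin n} {e₁ : A₁ ≃ Fin m₁}
    {e₂ : A₂ ≃ Fin m₂} {eO : G.view₁.Obs ≃ Fin k} (hw : BeliefTable.Reads G T w eQ e₁ e₂ eO) :
    (G.beliefGame T).DescribesDet (BeliefState.accepting Q)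
      ((List.range (BeliefTable.length w)).map (BeliefTable.entry w)) := by
  refine ⟨⟨rfl, rfl⟩, 3 ^ n + 2, m₁ * 2 ^ n, k, BeliefState.number eQ, witnessActionNumber eQ e₁,
    eO, G.beliefStep T, fun ℓ => if ℓ ∈ BeliefState.accepting Q then 1 else 0, fun _ _ _ => rfl,
    fun ℓ => ⟨fun h => if_pos h, fun h => if_neg h⟩, ?_⟩
  have hS : BeliefTable.numStates w = 3 ^ n + 2 := by rw [BeliefTable.numStates, hw.numStates]
  have hA : BeliefTable.numActions w = m₁ * 2 ^ n := by
    rw [BeliefTable.numActions, hw.numStates, hw.numActions₁]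
  have hlen : BeliefTable.length w = 4 + (3 ^ n + 2) + (3 ^ n + 2) * (m₁ * 2 ^ n * k) := by
    rw [BeliefTable.length, hS, hA, hw.numObs, mul_assoc]
  set S := 3 ^ n + 2 with hSd
  set A := m₁ * 2 ^ n with hAd
  have hrow : ∀ i : Fin S, ((List.finRange A).flatMap fun x => (List.finRange k).map fun y =>
      (BeliefState.number eQ (G.beliefStep T ((BeliefState.number eQ).symm i)
        ((witnessActionNumber eQ e₁).symm x) (eO.symm y)) : ℕ)).length = A * k := fun i =>
    List.length_flatMap_finRange _ fun x => by simp
  refine List.ext_getElem ?_ fun i h1 h2 => ?_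
  · simp only [List.length_map, List.length_range, List.length_append, List.length_cons,
      List.length_nil, List.length_finRange, hlen]
    rw [List.length_flatMap_finRange _ hrow]
  · rw [List.getElem_map, List.getElem_range, ← List.getD_eq_getElem _ 0, List.append_assoc]
    rw [List.length_map, List.length_range, hlen] at h1
    by_cases hi4 : i < 4
    · rw [List.getD_append _ _ _ _ (by simpa using hi4), BeliefTable.entry, if_pos hi4]
      obtain rfl | rfl | rfl | rfl : i = 0 ∨ i = 1 ∨ i = 2 ∨ i = 3 := by omega
      · simpa using hS
      · simpa using hA
      · simpa using hw.numObs
      · have := hw.init_eq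
        simpa [beliefGame] using this
    rw [List.getD_append_right _ _ _ _ (by simpa using hi4), BeliefTable.entry, if_neg hi4]
    simp only [List.length_cons, List.length_nil, Nat.reduceAdd]
    obtain ⟨j, rfl⟩ : ∃ j, i = 4 + j := ⟨i - 4, by omega⟩
    rw [Nat.add_sub_cancel_left, hS]
    by_cases hj : j < S
    · rw [if_pos hj]
      have hget := List.getD_map_finRange (fun i => if (BeliefState.number eQ).symm i ∈
        BeliefState.accepting Q then 1 else 0) ⟨j, hj⟩
        ((List.finRange S).flatMap fun i => (List.finRange A).flatMap fun x =>
          (List.finRange k).map fun y => (BeliefState.number eQ (G.beliefStep T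
            ((BeliefState.number eQ).symm i) ((witnessActionNumber eQ e₁).symm x)
              (eO.symm y)) : ℕ))
      refine Eq.trans ?_ hget.symm
      have hacc := hw.accepting_iff ((BeliefState.number eQ).symm ⟨j, hj⟩)
      rw [Equiv.apply_symm_apply] at hacc
      simp only [hacc]
    · rw [if_neg hj]
      obtain ⟨t, rfl⟩ : ∃ t, j = S + t := ⟨j - S, by omega⟩
      have ht : t < S * (A * k) := by omega
      have hsub : S + t - (3 ^ n + 2) = t := by omega
      rw [List.getD_append_right _ _ _ _ (by simp; omega)]
      simp only [List.length_map, List.length_finRange, Nat.add_sub_cancel_left]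
      rw [hsub]
      have hAk : 0 < A * k := Nat.pos_of_ne_zero fun h0 => by simp [h0] at ht
      have hk : 0 < k := Nat.pos_of_mul_pos_left hAk
      have hAp : 0 < A := Nat.pos_of_mul_pos_right hAk
      have b1 : t / k / A < S := by
        rw [Nat.div_div_eq_div_mul, Nat.div_lt_iff_lt_mul (by positivity), mul_comm k A]
        exact ht
      have b2 : t / k % A < A := Nat.mod_lt _ hAp
      have b3 : t % k < k := Nat.mod_lt _ hk
      -- The three mixed-radix digits of `t` are the state, the action of player 1 and the
      -- observation, as decoded by `tableEntry`.
      have hdec : t = t / k / A * (A * k) + (t / k % A * k + t % k) := by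
        have e1 := Nat.div_add_mod t k
        have e2 := Nat.div_add_mod (t / k) A
        calc t = k * (t / k) + t % k := e1.symm
          _ = k * (A * (t / k / A) + t / k % A) + t % k := by rw [e2]
          _ = _ := by ring
      have b4 : t / k % A * k + t % k < A * k := by
        have := Nat.mul_le_mul_right k (Nat.succ_le_of_lt b2)
        rw [Nat.succ_mul] at this
        omega
      have hget := List.getD_flatMap_finRange _ hrow ⟨_, b1⟩ b4 []
      have hget' := List.getD_flatMap_finRange (b := k) (fun x => (List.finRange k).map fun y =>
        (BeliefState.number eQ (G.beliefStep T ((BeliefState.number eQ).symm ⟨_, b1⟩)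
          ((witnessActionNumber eQ e₁).symm x) (eO.symm y)) : ℕ)) (fun x => by simp) ⟨_, b2⟩ b3 []
      have hget'' := List.getD_map_finRange (fun y =>
        (BeliefState.number eQ (G.beliefStep T ((BeliefState.number eQ).symm ⟨_, b1⟩)
          ((witnessActionNumber eQ e₁).symm ⟨_, b2⟩) (eO.symm y)) : ℕ)) ⟨_, b3⟩ []
      simp only [List.append_nil] at hget hget' hget''
      rw [hget', hget'', ← hdec] at hget
      refine Eq.trans ?_ hget.symm
      have hnext := hw.next_eq (T := T) (a := ((witnessActionNumber eQ e₁).symm ⟨_, b2⟩).1)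
        (u := ((witnessActionNumber eQ e₁).symm ⟨_, b2⟩).2) (γ := eO.symm ⟨_, b3⟩)
        ((BeliefState.number eQ).symm ⟨_, b1⟩)
      rw [← witnessActionNumber_div, ← witnessActionNumber_mod, Equiv.apply_symm_apply,
        Equiv.apply_symm_apply, Equiv.apply_symm_apply] at hnext
      rw [BeliefTable.tableEntry, hA, hw.numObs, hw.numStates]
      exact hnext

end StochGame

/-! ### The main theorem. -/

theorem mainTheorem2 :
    (∀ {Q A₁ A₂ : Type*} [Finite Q] [Finite A₁] [Finite A₂] [Nonempty A₁] [Nonempty A₂]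
      (G : StochGame Q A₁ A₂) (T : Set Q), G.OneSided →
      (G.beliefGame T).IsDeterministic ∧ (G.beliefGame T).PerfectObservation ∧
      (G.PureAlmostSureWinning (StochGame.Reach T) ↔
        (G.beliefGame T).SureWinning (StochGame.Buchi (BeliefState.accepting Q))) ∧
      (G.PurePositiveWinning (StochGame.Reach T) ↔
        (G.beliefGame T).SureWinning (StochGame.Reach (BeliefState.accepting Q)))) ∧
    (∃ (P : RProg) (c : ℕ), ∀ {Q A₁ A₂ : Type*} [Finite Q] [Finite A₁] [Finite A₂]
      [Nonempty A₁] [Nonempty A₂] (G : StochGame Q A₁ A₂) (T : Set Q), G.OneSided →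
      ∀ w : List ℕ, G.Describes T w →
        ∃ v : List ℕ, (G.beliefGame T).DescribesDet (BeliefState.accepting Q) v ∧
          P.OutputsWithin w v (2 ^ (c * Nat.card Q) * (Nat.card A₁ * Nat.card A₂) ^ c)) := by
  refine ⟨fun G T hG => ⟨fun _ _ _ => ⟨_, rfl⟩, ⟨rfl, rfl⟩,
    ⟨StochGame.buchi_of_pureAlmostSureWinning hG, StochGame.pureAlmostSureWinning_of_buchi hG⟩,
    ⟨StochGame.reach_of_purePositiveWinning hG, StochGame.purePositiveWinning_of_reach hG⟩⟩, ?_⟩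
  obtain ⟨P, c, hP⟩ := BeliefTable.exists_program
  refine ⟨P, c, fun {Q A₁ A₂} _ _ _ _ _ G T _ w hw => ?_⟩
  obtain ⟨n, m₁, m₂, k, eQ, e₁, e₂, eO, hr⟩ := hw.exists_reads
  refine ⟨_, StochGame.describesDet_beliefGame hr, ?_⟩
  have hn : Nat.card Q = n := by rw [Nat.card_congr eQ, Nat.card_fin]
  have hm₁ : Nat.card A₁ = m₁ := by rw [Nat.card_congr e₁, Nat.card_fin]
  have hm₂ : Nat.card A₂ = m₂ := by rw [Nat.card_congr e₂, Nat.card_fin]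
  have hk : Nat.card G.view₁.Obs = k := by rw [Nat.card_congr eO, Nat.card_fin]
  -- There are at most as many observations as states, so their number needs no separate place in
  -- the time bound.
  have hkn : k ≤ n := by
    rw [← hk, ← hn]
    exact Nat.card_le_card_of_surjective G.view₁.obs Quotient.mk_surjective
  have hvalid : (RStore.input w).Valid := by
    refine ⟨?_, ?_, ?_, ?_, ?_⟩
    · rw [hr.numStates]
      exact (eQ G.init).pos
    · rw [hr.numActions₁, ← hm₁]
      exact Nat.card_pos
    · rw [hr.numActions₂, ← hm₂]
      exact Nat.card_pos
    · rwa [hr.numObs, hr.numStates]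
    · rw [hr.init, hr.numStates]
      exact (eQ G.init).isLt.le
  have hsize : (RStore.input w).size ^ c =
      2 ^ (c * Nat.card Q) * (Nat.card A₁ * Nat.card A₂) ^ c := by
    rw [RStore.size, hr.numStates, hr.numActions₁, hr.numActions₂, hn, hm₁, hm₂, mul_pow, ← pow_mul,
      mul_comm n c]
  rw [← hsize]
  exact hP w hvalid
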